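/- For a real number $h$, an integer $r\ge 1$, a residue class $c$ modulo $r$ and $\alpha\in\mathbb R$, let $$E_{r,c}(\alpha)=\sum_{\substack{1\le m\le h\\ m\equiv c \bmod r}} e(m\alpha),\qquad e(x)=e^{2\pi i x}.$$ For integers $k,q\ge 1$ and residue classes $c_1,\dots,c_k$ modulo $r$, let $$V_k(q,h;r,c_1,\dots,c_k)=\sum_{\substack{q_1,\dots,q_k\\ 1<q_i\mid q,\ (q_i,r)=1}}\ \prod_{i=1}^k\frac{\mu(q_i)}{\phi(q_i)}\sum_{\substack{a_1,\dots,a_k\\ 1\le a_i\le q_i,\ (a_i,q_i)=1\\ \sum_i a_i/q_i\in\mathbb Z}}\ \prod_{i=1}^k E_{r,c_i}\!\left(\frac{a_i}{q_i}\right).$$ Let $\mathcal B_k$ be the set of perfect matchings of $\{1,\dots,k\}$, that is, of sets $\sigma$ of pairs $(i,j)$ with $1\le i<j\le k$ such that every element of $\{1,\dots,k\}$ lies in exactly one pair of $\sigma$ (so $\mathcal B_k=\emptyset$ for odd $k$). **Theorem 1.** Fix integers $r\ge 1$ and $k\ge 1$. For all residue classes $c_1,\dots,c_k$ modulo $r$,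 all squarefree integers $q\ge 1$ with $(q,r)=1$, and all real $h\ge 3$, $$V_k(q,h;r,c_1,\dots,c_k)=\sum_{\sigma\in\mathcal B_k}\ \prod_{(i,j)\in\sigma}V_2(q,h;r,c_i,c_j)+O_{r,k}\!\left(h^{k/2-1/(7k)}\left(\frac{q}{\phi(q)}\right)^{2^k+k/2}\right),$$ where the implied constant depends only on $r$ and $k$. -/

import Mathlib

/-- The exponential sum `E_{r,c}(α) = ∑ e(m α)` over the positive integers `m ≤ h` with
`m ≡ c (mod r)`, where `e(x) = exp(2 π i x)`. -/
noncomputable def apExpSum (r : ℕ) (h : ℝ) (c : ZMod r) (α : ℝ) : ℂ :=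
  ∑ m ∈ (Finset.Icc 1 ⌊h⌋₊).filter (fun m : ℕ => (m : ZMod r) = c),
    Complex.exp (2 * (Real.pi : ℂ) * Complex.I * ((m : ℂ) * (α : ℂ)))

/-- The tuples `(q_1, …, q_k)` with `1 < q_i`, `q_i ∣ q` and `(q_i, r) = 1` for all `i`. -/
def apModuli (k q r : ℕ) : Finset (Fin k → ℕ) :=
  Fintype.piFinset fun _ => q.divisors.filter fun d => 1 < d ∧ Nat.Coprime d r

open Classical in
/-- The tuples `(a_1, …, a_k)` with `1 ≤ a_i ≤ q_i` and `(a_i, q_i) = 1` for all `i`, and with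
`∑ a_i / q_i` an integer. -/
noncomputable def apNumerators {k : ℕ} (d : Fin k → ℕ) : Finset (Fin k → ℕ) :=
  (Fintype.piFinset fun i => (Finset.Icc 1 (d i)).filter fun a => Nat.Coprime a (d i)).filter
    fun a => ∃ z : ℤ, ∑ i, (a i : ℚ) / (d i : ℚ) = (z : ℚ)

/-- The sum `V_k(q, h; r, c_1, …, c_k)`. -/
noncomputable def apV (k q : ℕ) (h : ℝ) (r : ℕ) (c : Fin k → ZMod r) : ℂ :=
  ∑ d ∈ apModuli k q r,
    (∏ i, ((ArithmeticFunction.moebius (d i) : ℤ) : ℂ) / ((Nat.totient (d i) : ℕ) : ℂ)) *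
      ∑ a ∈ apNumerators d, ∏ i, apExpSum r h (c i) ((a i : ℝ) / (d i : ℝ))

open Classical in
/-- The perfect matchings of a set of `k` elements. Each pair is written with its smaller
element first, and each element lies in exactly one pair. -/
noncomputable def perfectMatchings (k : ℕ) : Finset (Finset (Fin k × Fin k)) :=
  Finset.univ.filter fun σ =>
    (∀ p ∈ σ, p.1 < p.2) ∧ ∀ i, ∃! j, (i, j) ∈ σ ∨ (j, i) ∈ σ

/-! Since `(r, q) = 1`, a reduced fraction `a / d` with `1 < d ∣ q` is the same as a nonzero class
`x` in `ZMod q` of additive order `d`. So `V_k` is a sum over zero-sum tuples of a product of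
one-variable weights (`apV_eq_sum_zeroSum`). The product of the `V_2` over a matching is the part of
that sum where matched entries cancel (`prod_matching_eq_sum_zeroSum`). In the difference a tuple
therefore carries the coefficient `1 - N`, with `N` the number of matchings under which it cancels,
and only `N = 0` and `N ≥ 2` survive (`norm_apV_sub_le`). If `N ≥ 2`, some value occurs three times
up to sign; this costs one free variable and saves a factor `h` over `h ^ (k / 2)`.

From here on only absolute values matter. The sum over the progression is at most `min(h, 1 / (2 ‖r
x / q‖))`, and multiplication by `r` permutes `ZMod q` and preserves orders, so `r` disappears. The
main tool is an inequality of Montgomery and Vaughan (`sum_zeroSum_le_of_order`), which bounds a sum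
over zero-sum tuples by the mean squares of the factors over elements of each order, times an Euler
product. For the majorant these mean squares are of size `h`, which gives `h ^ (k / 2)`.

Tuples that do not cancel in pairs gain `Y = h ^ (1 / (7 k))` (`exists_unpairedSum_le`). Cancelling
pairs are deleted one at a time, each costing a factor `h`, until no two entries cancel. The order
of `x 0` divides the product of its gcds with the other orders. So either that order is at most `h /
Y ^ 2`, and the mean square is smaller by `Y ^ 2`, or some gcd is at least `Y ^ 7`.

In the latter case `x 0` and `x j` are merged into their nonzero sum `y`, and the convolution of the
two majorants must have a small mean square (`order_mul_sum_mergedMajorant_sq_le`). The orders of `x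
0`, `x j`, `y` are `r₁ s t`, `r₂ s t`, `r₁ r₂ s`, with gcd `s t`. If one of the first two, times
`s`, exceeds `h Y ^ 4`, the second moment of the number of representations of `y` is small
(`sum_pairCount_sq_le`). Otherwise the pair comes from nonzero integers `u`, `v` with `t ∣ r₂ u + r₁
v ≠ 0`. The divisor bound then controls the total mass over all `t` (`sum_weighted_pairCount_le`),
while the order of `y` is at most `h ^ 2 / Y ^ 6`. -/

open Finset

set_option linter.unusedSectionVars false

/-- The `n`-tuples of elements of a finite group with sum zero. -/
noncomputable def zeroSum (K : Type*) [AddCommGroup K] [Fintype K] (n : ℕ) :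
    Finset (Fin n → K) := by
  classical exact univ.filter fun x => ∑ i, x i = 0

lemma sum_univ_cons {K : Type*} [Fintype K] {M : Type*} [AddCommMonoid M] {n : ℕ} (Φ : (Fin (n + 1) → K) → M) :
    ∑ x, Φ x = ∑ x' : Fin n → K, ∑ a : K, Φ (Fin.cons a x') := by
  rw [← (Fin.consEquiv (fun _ => K)).sum_comp, Fintype.sum_prod_type_right]
  rfl

/-! ### Sums of products over zero-sum tuples in a finite group. -/

section ZeroSum

variable {K : Type*} [AddCommGroup K] [Fintype K]

@[simp] lemma mem_zeroSum {n : ℕ} {x : Fin n → K} : x ∈ zeroSum K n ↔ ∑ i, x i = 0 := by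
  simp [zeroSum]

lemma sum_zeroSum_succ {M : Type*} [AddCommMonoid M] {n : ℕ} (Φ : (Fin (n + 1) → K) → M) :
    ∑ x ∈ zeroSum K (n + 1), Φ x = ∑ x' : Fin n → K, Φ (Fin.cons (-∑ i, x' i) x') := by
  classical
  rw [zeroSum, sum_filter, sum_univ_cons]
  refine sum_congr rfl fun x' _ => ?_
  rw [sum_eq_single (-∑ i, x' i)]
  · simp [Fin.sum_univ_succ]
  · intro b _ hb
    rw [if_neg]
    simp only [Fin.sum_univ_succ, Fin.cons_zero, Fin.cons_succ]
    exact fun h => hb (eq_neg_of_add_eq_zero_left h)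
  · simp

lemma sum_zeroSum_perm {M : Type*} [AddCommMonoid M] {n : ℕ} (e : Equiv.Perm (Fin n))
    (Φ : (Fin n → K) → M) :
    ∑ x ∈ zeroSum K n, Φ x = ∑ x ∈ zeroSum K n, Φ (x ∘ e) := by
  symm
  refine sum_nbij' (fun x => x ∘ e) (fun x => x ∘ e.symm) ?_ ?_ ?_ ?_ ?_
  · intro x hx
    rw [mem_zeroSum] at *
    exact (Equiv.sum_comp e x).trans hx
  · intro x hx
    rw [mem_zeroSum] at *
    exact (Equiv.sum_comp e.symm x).trans hx
  · intro x _; ext; simp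
  · intro x _; ext; simp
  · intro x _; rfl

lemma exists_perm_zero_one {n : ℕ} {i j : Fin (n + 2)} (hij : i ≠ j) :
    ∃ e : Equiv.Perm (Fin (n + 2)), e 0 = i ∧ e 1 = j := by
  refine ⟨(Equiv.swap 0 i).trans (Equiv.swap (Equiv.swap 0 i 1) j), ?_, ?_⟩
  · simp only [Equiv.trans_apply, Equiv.swap_apply_left]
    apply Equiv.swap_apply_of_ne_of_ne _ hij
    intro h
    have : Equiv.swap 0 i 0 = Equiv.swap 0 i 1 := by simpa using h
    simpa using (Equiv.swap 0 i).injective this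
  · simp

/-- Once the last `n` entries are fixed, entry `0` is a reflected translate of entry `1`, so
Cauchy–Schwarz treats these two and the others are summed freely. -/
lemma sum_zeroSum_le_of_two {n : ℕ} (g : Fin (n + 2) → K → ℝ) (hg : ∀ i u, 0 ≤ g i u) :
    ∑ x ∈ zeroSum K (n + 2), ∏ i, g i (x i) ≤
      √(∑ u, g 0 u ^ 2) * √(∑ u, g 1 u ^ 2) * ∏ i : Fin n, ∑ u, g i.succ.succ u := by
  classical
  rw [sum_zeroSum_succ, sum_univ_cons, prod_univ_sum, Fintype.piFinset_univ, mul_sum]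
  refine sum_le_sum fun x' _ => ?_
  simp only [Fin.prod_univ_succ, Fin.cons_zero, Fin.cons_succ, Fin.sum_univ_succ, Fin.succ_zero_eq_one]
  simp only [← mul_assoc]
  rw [← sum_mul]
  refine mul_le_mul_of_nonneg_right ?_ (prod_nonneg fun i _ => hg _ _)
  refine (Real.sum_mul_le_sqrt_mul_sqrt _ _ _).trans_eq ?_
  congr 2
  exact (((Equiv.addRight (∑ i, x' i)).trans (Equiv.neg K)).sum_comp (fun u => g 0 u ^ 2))

lemma sum_zeroSum_le_of_ne {n : ℕ} (g : Fin n → K → ℝ) (hg : ∀ i u, 0 ≤ g i u)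
    {a b : Fin n} (hab : a ≠ b) :
    ∑ x ∈ zeroSum K n, ∏ i, g i (x i) ≤
      √(∑ u, g a u ^ 2) * √(∑ u, g b u ^ 2) * ∏ i ∈ univ \ {a, b}, ∑ u, g i u := by
  obtain _ | _ | n := n
  · exact a.elim0
  · exact absurd (Subsingleton.elim (α := Fin 1) a b) hab
  obtain ⟨e, rfl, rfl⟩ := exists_perm_zero_one hab
  have h1 := sum_zeroSum_le_of_two (fun i => g (e i)) (fun i u => hg _ _)
  rw [sum_zeroSum_perm e.symm]
  convert h1 using 1
  · refine sum_congr rfl fun x _ => ?_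
    rw [← Equiv.prod_comp e]
    simp
  · congr 1
    symm
    refine prod_nbij (fun i => e i.succ.succ) ?_ ?_ ?_ ?_
    · intro i _
      simp only [mem_sdiff, mem_univ, mem_insert, mem_singleton, EmbeddingLike.apply_eq_iff_eq,
        true_and, not_or]
      exact ⟨Fin.succ_ne_zero _, fun h => Fin.succ_ne_zero i
        (Fin.succ_injective _ (h.trans Fin.succ_zero_eq_one.symm))⟩
    · intro i _ j _ h
      simpa using h
    · intro j hj
      obtain ⟨i, rfl⟩ := e.surjective j
      simp only [coe_sdiff, coe_univ, coe_insert, coe_singleton, Set.mem_sdiff, Set.mem_univ,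
        Set.mem_insert_iff, Set.mem_singleton_iff, EmbeddingLike.apply_eq_iff_eq, true_and,
        not_or] at hj
      obtain ⟨i, rfl⟩ := Fin.exists_succ_eq.mpr hj.1
      obtain ⟨i, rfl⟩ := Fin.exists_succ_eq.mpr (fun h : i = 0 => hj.2 (by rw [h]; rfl))
      exact ⟨i, by simp⟩
    · intro i _; rfl

/-- Classify tuples by the set `S` of their nonzero entries. A zero-sum tuple cannot have exactly
one, so `S` is empty or has at least two elements. In the second case two entries of `S` are treated
by Cauchy–Schwarz and the rest by comparing `ℓ¹` with `ℓ²`, which costs the root of the cardinality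
each time. Spending that root on all of `S` overcounts by two roots, hence the factor `1 /
Fintype.card K`. -/
lemma sum_zeroSum_support_le [DecidableEq K] {n : ℕ} (g : Fin n → K → ℝ) (hg : ∀ i u, 0 ≤ g i u) :
    ∑ x ∈ zeroSum K n, ∏ i, g i (x i) ≤ ∏ i, g i 0 +
      ∑ S : Finset (Fin n) with 2 ≤ #S, (1 / (Fintype.card K : ℝ)) *
        ∏ i, if i ∈ S then √(Fintype.card K * ∑ u with u ≠ 0, g i u ^ 2) else g i 0 := by
  have hp : (0 : ℝ) < Fintype.card K := by exact_mod_cast Fintype.card_pos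
  set p : ℝ := (Fintype.card K : ℝ)
  set A : Fin n → K → ℝ := fun i u => if u = 0 then 0 else g i u with hA
  set B : Fin n → K → ℝ := fun i u => if u = 0 then g i 0 else 0 with hB
  set H : Finset (Fin n) → Fin n → K → ℝ := fun S i => if i ∈ S then A i else B i with hH
  have hH0 : ∀ S i u, 0 ≤ H S i u := by
    intro S i u
    simp only [hH, hA, hB]
    split_ifs
    all_goals dsimp only
    all_goals split_ifs
    all_goals first | exact le_rfl | exact hg _ _
  have hsplit : ∀ x : Fin n → K, ∏ i, g i (x i) = ∑ S : Finset (Fin n), ∏ i, H S i (x i) := by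
    intro x
    have h1 : ∀ i, g i (x i) = A i (x i) + B i (x i) := by
      intro i
      simp only [hA, hB]
      split_ifs with h <;> simp [h]
    rw [prod_congr rfl fun i _ => h1 i, prod_add, powerset_univ]
    refine sum_congr rfl fun S _ => ?_
    rw [← prod_sdiff (subset_univ S), mul_comm]
    congr 1
    · exact prod_congr rfl fun i hi => by simp [hH, (mem_sdiff.mp hi).2]
    · exact prod_congr rfl fun i hi => by simp [hH, hi]
  rw [sum_congr rfl fun x _ => hsplit x, sum_comm, ← sum_filter_add_sum_filter_not univ (fun S : Finset (Fin n) => 2 ≤ #S), add_comm]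
  refine add_le_add ?_ (sum_le_sum fun S hS => ?_)
  · rw [sum_eq_single ∅]
    · refine (sum_le_sum_of_subset_of_nonneg (subset_univ _)
        fun x _ _ => prod_nonneg fun i _ => hH0 _ _ _).trans ?_
      rw [← Fintype.piFinset_univ, ← prod_univ_sum]
      exact (prod_congr rfl fun i _ => by simp [hH, hB]).le
    · intro S hS hne
      have : #S = 1 := by
        have := card_pos.mpr (nonempty_iff_ne_empty.mpr hne)
        have := (mem_filter.mp hS).2
        omega
      obtain ⟨a, rfl⟩ := card_eq_one.mp this
      refine sum_eq_zero fun x hx => ?_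
      by_contra hne
      rw [← ne_eq, prod_ne_zero_iff] at hne
      rw [mem_zeroSum] at hx
      -- A nonvanishing product would make `x a` the only nonzero entry, against the zero sum.
      have ha : x a ≠ 0 := fun h => hne a (mem_univ a) (by simp [hH, hA, h])
      apply ha
      rw [sum_eq_single a] at hx
      · exact hx
      · intro b _ hb
        by_contra h
        exact hne b (mem_univ b) (by simp [hH, hB, h, hb])
      · simp
    · simp
  · obtain ⟨a, ha, b, hb, hab⟩ := one_lt_card.mp ((mem_filter.mp hS).2)
    refine (sum_zeroSum_le_of_ne (H S) (hH0 S) hab).trans ?_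
    set N : Fin n → ℝ := fun i => ∑ u with u ≠ 0, g i u ^ 2 with hN
    have hAsq : ∀ i, ∑ u, A i u ^ 2 = N i := by
      intro i
      rw [hN]
      simp only [hA, sum_filter]
      exact sum_congr rfl fun u _ => by split_ifs <;> simp_all
    have hL1 : ∀ i, ∑ u, H S i u ≤ if i ∈ S then √(p * N i) else g i 0 := by
      intro i
      split_ifs with hi
      · simp only [hH, hi, if_true]
        apply Real.le_sqrt_of_sq_le
        refine sq_sum_le_card_mul_sum_sq.trans_eq ?_
        rw [hAsq i]; rfl
      · simp [hH, hi, hB]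
    have hab' : ∏ i, (if i ∈ S then √(p * N i) else g i 0) =
        (√(p * N a) * √(p * N b)) *
          ∏ i ∈ univ \ {a, b}, (if i ∈ S then √(p * N i) else g i 0) := by
      rw [← prod_sdiff (subset_univ {a, b}), mul_comm, prod_pair hab]
      simp [ha, hb]
    rw [hab']
    have h2 : √(p * N a) * √(p * N b) = p * (√(N a) * √(N b)) := by
      rw [Real.sqrt_mul hp.le, Real.sqrt_mul hp.le]
      linear_combination (√(N a) * √(N b)) * Real.mul_self_sqrt hp.le
    rw [h2]
    have h3 : ∀ i ∈ S, ∑ u, H S i u ^ 2 = N i := by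
      intro i hi
      rw [← hAsq i]
      simp [hH, hi]
    rw [h3 a ha, h3 b hb]
    have h4 : 1 / p * (p * (√(N a) * √(N b)) *
        ∏ i ∈ univ \ {a, b}, (if i ∈ S then √(p * N i) else g i 0)) = √(N a) * √(N b) *
        ∏ i ∈ univ \ {a, b}, (if i ∈ S then √(p * N i) else g i 0) := by
      field_simp
    rw [h4]
    gcongr with i hi
    · exact fun i _ => sum_nonneg fun u _ => hH0 _ _ _
    · exact hL1 i

end ZeroSum

/-! ### Splitting off one prime, and the Montgomery–Vaughan inequality. -/

section ProductDecomposition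

lemma sum_zeroSum_prod {G K L : Type*} [AddCommGroup G] [Fintype G] [AddCommGroup K] [Fintype K]
    [AddCommGroup L] [Fintype L] (e : G ≃+ K × L) {n : ℕ} (Φ : (Fin n → G) → ℝ) :
    ∑ x ∈ zeroSum G n, Φ x =
      ∑ y ∈ zeroSum L n, ∑ u ∈ zeroSum K n, Φ (fun i => e.symm (u i, y i)) := by
  rw [← sum_product']
  refine sum_nbij' (fun x => (fun i => (e (x i)).2, fun i => (e (x i)).1))
    (fun z i => e.symm (z.2 i, z.1 i)) ?_ ?_ ?_ ?_ ?_
  · intro x hx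
    rw [mem_zeroSum] at hx
    simp only [mem_product, mem_zeroSum]
    rw [← Prod.fst_sum, ← Prod.snd_sum, ← map_sum, hx]
    simp
  · rintro ⟨y, u⟩ hz
    simp only [mem_product, mem_zeroSum] at hz
    rw [mem_zeroSum, ← map_sum, map_eq_zero_iff e.symm e.symm.injective]
    ext
    · rw [Prod.fst_sum]; exact hz.2
    · rw [Prod.snd_sum]; exact hz.1
  · intro x _; ext; simp
  · rintro ⟨y, u⟩ _; simp
  · intro x _; simp

lemma addOrderOf_prod_of_coprime {p m : ℕ} (hp : p.Prime) (hpm : p.Coprime m) [NeZero m]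
    (u : ZMod p) (x : ZMod m) :
    addOrderOf (u, x) = if u = 0 then addOrderOf x else p * addOrderOf x := by
  rw [Prod.addOrderOf_mk]
  split_ifs with hu
  · simp [hu]
  · have h1 : addOrderOf u = p := by
      have := Fact.mk hp
      exact addOrderOf_eq_prime (by simp) hu
    rw [h1]
    apply Nat.Coprime.lcm_eq_mul
    apply hpm.coprime_dvd_right
    rw [addOrderOf_dvd_iff_nsmul_eq_zero]
    simp

end ProductDecomposition

/-- The sum of `∏_{i ∈ S} w i` over the subsets `S` with at least two elements. -/
def subsetWeight {k : ℕ} (w : Fin k → ℝ) : ℝ :=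
  ∑ S : Finset (Fin k) with 2 ≤ #S, ∏ i ∈ S, w i

/-- A multilinear form of Montgomery and Vaughan: the sum over tuples with sum zero is controlled
by the mean squares over elements of given order. -/
theorem sum_zeroSum_le_of_order {k : ℕ} {w : Fin k → ℝ} (hw : ∀ i, 0 ≤ w i) (q : ℕ) :
    ∀ [NeZero q], Squarefree q → ∀ (f : Fin k → ZMod q → ℝ) (A : Fin k → ℝ),
      (∀ i x, 0 ≤ f i x) → (∀ i, 0 ≤ A i) →
      (∀ i, ∀ d, d ∣ q → d * ∑ x with addOrderOf x = d, f i x ^ 2 ≤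
        (A i * w i ^ #d.primeFactors) ^ 2) →
      ∑ x ∈ zeroSum (ZMod q) k, ∏ i, f i (x i) ≤
        (∏ p ∈ q.primeFactors, (1 + subsetWeight w / p)) * ∏ i, A i := by
  induction q using induction_on_primes with
  | zero => intro h; exact absurd rfl h.out
  | one =>
    intro _ _ f A hf hA h
    have h1 : ∀ i, f i 0 ≤ A i := by
      intro i
      have := h i 1 (dvd_refl 1)
      have h2 : (univ.filter fun x : ZMod 1 => addOrderOf x = 1) = {0} := by
        ext x; simp [Subsingleton.elim x 0]; exact Subsingleton.elim _ _
      rw [h2] at this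
      exact (abs_le_of_sq_le_sq' (by simpa using this) (hA i)).2
    refine (sum_le_sum_of_subset_of_nonneg (subset_univ _)
        fun x _ _ => prod_nonneg fun i _ => hf _ _).trans ?_
    rw [← Fintype.piFinset_univ, ← prod_univ_sum]
    simp only [Nat.primeFactors_one, prod_empty, one_mul]
    refine prod_le_prod (fun i _ => sum_nonneg fun x _ => hf i x) fun i _ => ?_
    have h2 : (univ : Finset (ZMod 1)) = {0} := by
      ext x; simp [Subsingleton.elim x 0]; exact Subsingleton.elim _ _
    rw [h2]
    simpa using h1 i
  | prime_mul p m hp ih =>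
    intro hne hsq f A hf hA h
    have hm0 : m ≠ 0 := by
      rintro rfl
      exact hne.out (by simp)
    have : NeZero m := ⟨hm0⟩
    have : NeZero p := ⟨hp.ne_zero⟩
    have hpm : p.Coprime m := Nat.coprime_of_squarefree_mul hsq
    have hp0 : (0 : ℝ) < p := by exact_mod_cast hp.pos
    set e : ZMod (p * m) ≃+ ZMod p × ZMod m := (ZMod.chineseRemainder hpm).toAddEquiv with he
    rw [sum_zeroSum_prod e]
    set F : Fin k → ZMod p → ZMod m → ℝ := fun i u x => f i (e.symm (u, x)) with hF
    have hord : ∀ u x, addOrderOf (e.symm (u, x)) =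
        if u = 0 then addOrderOf x else p * addOrderOf x := by
      intro u x
      rw [AddEquiv.addOrderOf_eq, addOrderOf_prod_of_coprime hp hpm]
    have hpf : (p * m).primeFactors = insert p m.primeFactors := by
      rw [Nat.primeFactors_mul hp.ne_zero hm0, hp.primeFactors, insert_eq]
    have hpnm : p ∉ m.primeFactors := fun hmem =>
      hp.coprime_iff_not_dvd.mp hpm (Nat.dvd_of_mem_primeFactors hmem)
    set b : Fin k → ZMod m → ℝ := fun i x => √(p * ∑ u with u ≠ 0, F i u x ^ 2) with hb
    set g : Finset (Fin k) → Fin k → ZMod m → ℝ := fun S i x =>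
      if i ∈ S then b i x else F i 0 x with hg
    have hg0 : ∀ S i x, 0 ≤ g S i x := by
      intro S i x
      simp only [hg, hb, hF]
      split_ifs
      · exact Real.sqrt_nonneg _
      · exact hf _ _
    -- On `S` the new functions absorb the nonzero `p`-components. This raises an order `d` to `p *
    -- d`, so the constant `A i` becomes `A i * w i`.
    have key : ∀ S : Finset (Fin k), ∑ x ∈ zeroSum (ZMod m) k, ∏ i, g S i (x i) ≤
        (∏ p ∈ m.primeFactors, (1 + subsetWeight w / p)) *
          ((∏ i ∈ S, w i) * ∏ i, A i) := by
      intro S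
      have h1 := ih hsq.of_mul_right (g S) (fun i => if i ∈ S then A i * w i else A i)
        (hg0 S) (fun i => by split_ifs <;> simp [hA, hw, mul_nonneg]) ?_
      · refine h1.trans_eq ?_
        congr 1
        have : ∀ i, (if i ∈ S then A i * w i else A i) = (if i ∈ S then w i else 1) * A i := by
          intro i; split_ifs <;> ring
        rw [prod_congr rfl fun i _ => this i, prod_mul_distrib]
        congr 1
        simp
      · intro i d hd
        have hd0 : d ≠ 0 := fun h => hm0 (by simpa [h] using hd)
        have hpd : p ∉ d.primeFactors := fun hmem =>
          hpnm (Nat.primeFactors_mono hd hm0 hmem)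
        by_cases hi : i ∈ S
        · simp only [hg, hi, if_true, hb]
          have h2 := h i (p * d) (Nat.mul_dvd_mul_left p hd)
          rw [Nat.primeFactors_mul hp.ne_zero hd0, hp.primeFactors, ← insert_eq,
            card_insert_of_notMem hpd] at h2
          have h3 : (A i * w i ^ (#d.primeFactors + 1)) ^ 2 =
              (A i * w i * w i ^ #d.primeFactors) ^ 2 := by ring
          rw [h3] at h2
          refine le_trans ?_ h2
          push_cast
          rw [mul_comm (p : ℝ) d, mul_assoc]
          refine mul_le_mul_of_nonneg_left ?_ (Nat.cast_nonneg d)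
          have h4 : ∀ x, √(p * ∑ u with u ≠ 0, F i u x ^ 2) ^ 2 =
              p * ∑ u with u ≠ 0, F i u x ^ 2 := fun x =>
            Real.sq_sqrt (mul_nonneg hp0.le (sum_nonneg fun u _ => sq_nonneg _))
          simp_rw [h4]
          rw [← mul_sum, sum_comm, ← sum_product']
          refine mul_le_mul_of_nonneg_left ?_ hp0.le
          have h5 := sum_map (({u : ZMod p | u ≠ 0} : Finset _) ×ˢ
            ({x : ZMod m | addOrderOf x = d} : Finset _)) e.symm.toEquiv.toEmbedding
              (fun z => f i z ^ 2)
          refine le_trans (le_of_eq h5.symm) ?_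
          refine sum_le_sum_of_subset_of_nonneg ?_ fun _ _ _ => sq_nonneg _
          intro z hz
          obtain ⟨⟨u, x⟩, hux, rfl⟩ := mem_map.mp hz
          simp only [mem_product, mem_filter, mem_univ, true_and] at hux ⊢
          have := hord u x
          rw [if_neg hux.1, hux.2] at this
          exact this
        · simp only [hg, hi, if_false]
          refine le_trans ?_ (h i d (hd.mul_left p))
          refine mul_le_mul_of_nonneg_left ?_ (Nat.cast_nonneg d)
          have h5 := sum_map (({0} : Finset (ZMod p)) ×ˢ
            ({x : ZMod m | addOrderOf x = d} : Finset _)) e.symm.toEquiv.toEmbedding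
              (fun z => f i z ^ 2)
          rw [sum_product, sum_singleton] at h5
          refine le_trans (le_of_eq h5.symm) ?_
          refine sum_le_sum_of_subset_of_nonneg ?_ fun _ _ _ => sq_nonneg _
          intro z hz
          obtain ⟨⟨u, x⟩, hux, rfl⟩ := mem_map.mp hz
          simp only [mem_product, mem_filter, mem_univ, true_and, mem_singleton] at hux ⊢
          have := hord u x
          rw [if_pos hux.1, hux.2] at this
          exact this
    have hstep : ∀ y ∈ zeroSum (ZMod m) k,
        ∑ u ∈ zeroSum (ZMod p) k, ∏ i, f i (e.symm (u i, y i)) ≤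
          ∏ i, g ∅ i (y i) + ∑ S : Finset (Fin k) with 2 ≤ #S, (1 / (p : ℝ)) *
            ∏ i, g S i (y i) := by
      intro y _
      have := sum_zeroSum_support_le (fun i u => F i u (y i)) (fun i u => hf _ _)
      rw [ZMod.card] at this
      simpa [hg, hb] using this
    refine (sum_le_sum hstep).trans ?_
    rw [sum_add_distrib, sum_comm]
    simp_rw [← mul_sum]
    rw [hpf, prod_insert hpnm]
    refine (add_le_add (key ∅) (mul_le_mul_of_nonneg_left (sum_le_sum fun S _ => key S)
      (by positivity))).trans_eq ?_
    rw [prod_empty, one_mul, ← mul_sum, ← sum_mul]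
    change _ + 1 / (p : ℝ) * (_ * (subsetWeight w * _)) = _
    ring

/-! ### Counting residue classes near zero. -/

section Counting

variable {q : ℕ} [NeZero q]

/-- The distance from `x / q` to the nearest integer. -/
noncomputable def fracDist (x : ZMod q) : ℝ := |(x.valMinAbs : ℝ)| / q

lemma fracDist_nonneg (x : ZMod q) : 0 ≤ fracDist x := by unfold fracDist; positivity

lemma fracDist_pos {x : ZMod q} (hx : x ≠ 0) : 0 < fracDist x := by
  unfold fracDist
  have h1 : (x.valMinAbs : ℝ) ≠ 0 := by
    exact_mod_cast fun h => hx ((ZMod.valMinAbs_eq_zero x).mp h)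
  have h2 : (0 : ℝ) < q := by exact_mod_cast NeZero.pos q
  positivity

lemma fracDist_le_half (x : ZMod q) : fracDist x ≤ 1 / 2 := by
  unfold fracDist
  have h2 : (0 : ℝ) < q := by exact_mod_cast NeZero.pos q
  rw [div_le_iff₀ h2]
  have h1 : x.valMinAbs.natAbs * 2 ≤ q := by have := ZMod.natAbs_valMinAbs_le x; omega
  have h3 : ((x.valMinAbs.natAbs : ℕ) : ℝ) * 2 ≤ q := by exact_mod_cast h1
  rw [Nat.cast_natAbs, Int.cast_abs] at h3
  linarith

lemma fracDist_add_le (x y : ZMod q) : fracDist (x + y) ≤ fracDist x + fracDist y := by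
  unfold fracDist
  rw [← add_div]
  gcongr
  have h1 : (x + y).valMinAbs.natAbs ≤ x.valMinAbs.natAbs + y.valMinAbs.natAbs :=
    (ZMod.natAbs_valMinAbs_add_le x y).trans (Int.natAbs_add_le _ _)
  have h3 : (((x + y).valMinAbs.natAbs : ℕ) : ℝ) ≤
    (x.valMinAbs.natAbs : ℕ) + (y.valMinAbs.natAbs : ℕ) := by exact_mod_cast h1
  simpa only [Nat.cast_natAbs, Int.cast_abs] using h3

lemma intCast_nsmul_eq_zero_iff {n m : ℕ} (hn : n ≠ 0) (hq : q = n * m) (a : ℤ) :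
    n • (a : ZMod q) = 0 ↔ (m : ℤ) ∣ a := by
  rw [nsmul_eq_mul]
  have : (n : ZMod q) * (a : ZMod q) = ((n * a : ℤ) : ZMod q) := by push_cast; ring
  rw [this, ZMod.intCast_zmod_eq_zero_iff_dvd, hq]
  push_cast
  exact mul_dvd_mul_iff_left (by exact_mod_cast hn)

/-- An element killed by `n = q / m` is `m` times an integer bounded by `n` times its distance. -/
lemma exists_valMinAbs_eq_mul {n m : ℕ} (hq : q = n * m) {x : ZMod q} (hx : n • x = 0) :
    ∃ a : ℤ, x.valMinAbs = m * a ∧ |(a : ℝ)| = fracDist x * n := by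
  have hn : n ≠ 0 := by rintro rfl; exact NeZero.ne q (by simpa using hq)
  have hm : m ≠ 0 := by rintro rfl; exact NeZero.ne q (by simpa using hq)
  have h1 : (m : ℤ) ∣ x.valMinAbs := by
    rw [← intCast_nsmul_eq_zero_iff hn hq, ZMod.coe_valMinAbs, hx]
  obtain ⟨a, ha⟩ := h1
  refine ⟨a, ha, ?_⟩
  unfold fracDist
  rw [ha]
  have h2 : (n : ℝ) ≠ 0 := by exact_mod_cast hn
  have h3 : (m : ℝ) ≠ 0 := by exact_mod_cast hm
  have h4 : (q : ℝ) = n * m := by exact_mod_cast hq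
  push_cast
  rw [h4, abs_mul, Nat.abs_cast]
  field_simp

/-- The fractions `x / q` of classes killed by `n` are spaced by `1 / n`. Leaving out zero removes
the usual `+ 1`. -/
lemma card_le_of_nsmul_eq_zero {n : ℕ} (hn : n ∣ q) {ρ : ℝ} (hρ : 0 ≤ ρ) (s : Finset (ZMod q))
    (h : ∀ x ∈ s, x ≠ 0 ∧ n • x = 0 ∧ fracDist x ≤ ρ) : (#s : ℝ) ≤ 2 * ρ * n := by
  obtain ⟨m, hq⟩ := hn
  have hm : (m : ℤ) ≠ 0 := by
    have : m ≠ 0 := by rintro rfl; exact NeZero.ne q (by simpa using hq)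
    exact_mod_cast this
  set R : ℕ := ⌊ρ * n⌋₊
  have hcard : #s ≤ #((Icc (-(R : ℤ)) R).erase 0) := by
    refine card_le_card_of_injOn (fun x => x.valMinAbs / m) ?_ ?_
    · intro x hx
      obtain ⟨h0, h1, h2⟩ := h x hx
      obtain ⟨a, ha, ha'⟩ := exists_valMinAbs_eq_mul hq h1
      have ha0 : a ≠ 0 := by
        rintro rfl
        exact h0 ((ZMod.valMinAbs_eq_zero x).mp (by simpa using ha))
      have h3 : a.natAbs ≤ R := by
        apply Nat.le_floor
        rw [Nat.cast_natAbs, Int.cast_abs, ha']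
        gcongr
      simp only [coe_erase, coe_Icc, Set.mem_sdiff, Set.mem_Icc, Set.mem_singleton_iff]
      rw [ha, Int.mul_ediv_cancel_left _ hm]
      exact ⟨⟨by omega, by omega⟩, ha0⟩
    · intro x hx y hy hxy
      obtain ⟨a, ha, -⟩ := exists_valMinAbs_eq_mul hq (h x hx).2.1
      obtain ⟨b, hb, -⟩ := exists_valMinAbs_eq_mul hq (h y hy).2.1
      simp only [ha, hb, Int.mul_ediv_cancel_left _ hm] at hxy
      exact ZMod.injective_valMinAbs (by rw [ha, hb, hxy])
  have h4 : #((Icc (-(R : ℤ)) R).erase 0) = 2 * R := by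
    rw [card_erase_of_mem (by simp), Int.card_Icc]
    omega
  have h5 : (R : ℝ) ≤ ρ * n := Nat.floor_le (by positivity)
  have h6 : (#s : ℝ) ≤ 2 * R := by
    rw [h4] at hcard
    exact_mod_cast hcard
  linarith

/-- The classes lie in one coset of the `n`-torsion, so again the spacing is `1 / n`; but the coset
may avoid zero, and the `+ 1` stays. -/
lemma card_le_of_nsmul_sub_eq_zero {n : ℕ} (hn : n ∣ q) {ρ : ℝ} (hρ : 0 ≤ ρ)
    (s : Finset (ZMod q)) (h : ∀ x ∈ s, fracDist x ≤ ρ)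
    (h' : ∀ x ∈ s, ∀ y ∈ s, n • (x - y) = 0) : (#s : ℝ) ≤ 2 * ρ * n + 1 := by
  obtain ⟨m, hq⟩ := hn
  have hn0 : n ≠ 0 := by rintro rfl; exact NeZero.ne q (by simpa using hq)
  have hm0 : m ≠ 0 := by rintro rfl; exact NeZero.ne q (by simpa using hq)
  have hm : (m : ℤ) ≠ 0 := by exact_mod_cast hm0
  rcases s.eq_empty_or_nonempty with rfl | hs
  · simp; positivity
  obtain ⟨x₀, hx₀, hmin⟩ := exists_min_image s (fun x => x.valMinAbs) hs
  have hdvd : ∀ x ∈ s, ∃ a : ℕ, x.valMinAbs = x₀.valMinAbs + m * a := by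
    intro x hx
    have h1 : (m : ℤ) ∣ x.valMinAbs - x₀.valMinAbs := by
      rw [← intCast_nsmul_eq_zero_iff hn0 hq]
      rw [Int.cast_sub, ZMod.coe_valMinAbs, ZMod.coe_valMinAbs, h' x hx x₀ hx₀]
    obtain ⟨a, ha⟩ := h1
    have ha0 : 0 ≤ a := by
      have h2 : 0 ≤ (m : ℤ) * a := by rw [← ha]; linarith [hmin x hx]
      exact nonneg_of_mul_nonneg_right h2 (by positivity)
    lift a to ℕ using ha0
    exact ⟨a, by linarith⟩
  set R : ℕ := ⌊2 * ρ * n⌋₊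
  have hcard : #s ≤ #(range (R + 1)) := by
    refine card_le_card_of_injOn (fun x => ((x.valMinAbs - x₀.valMinAbs) / m).toNat) ?_ ?_
    · intro x hx
      obtain ⟨a, ha⟩ := hdvd x hx
      simp only [coe_range, Set.mem_Iio]
      rw [ha, add_sub_cancel_left, Int.mul_ediv_cancel_left _ hm, Int.toNat_natCast,
        Nat.lt_succ_iff]
      apply Nat.le_floor
      have h1 := h x hx
      have h2 := h x₀ hx₀
      unfold fracDist at h1 h2
      have hq0 : (0 : ℝ) < q := by exact_mod_cast NeZero.pos q
      rw [div_le_iff₀ hq0] at h1 h2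
      have h3 : (x.valMinAbs : ℝ) = x₀.valMinAbs + m * a := by exact_mod_cast ha
      have h4 : (q : ℝ) = n * m := by exact_mod_cast hq
      have h5 := (abs_le.mp h1).2
      have h6 := (abs_le.mp h2).1
      have h7 : (m : ℝ) * a ≤ m * (2 * ρ * n) := by
        rw [h4] at h5 h6
        nlinarith
      exact le_of_mul_le_mul_left h7 (by exact_mod_cast Nat.pos_of_ne_zero hm0)
    · intro x hx y hy hxy
      obtain ⟨a, ha⟩ := hdvd x hx
      obtain ⟨b, hb⟩ := hdvd y hy
      simp only [ha, hb, add_sub_cancel_left, Int.mul_ediv_cancel_left _ hm,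
        Int.toNat_natCast] at hxy
      exact ZMod.injective_valMinAbs (by rw [ha, hb, hxy])
  have h5 : (R : ℝ) ≤ 2 * ρ * n := Nat.floor_le (by positivity)
  have h6 : (#s : ℝ) ≤ R + 1 := by
    rw [card_range] at hcard
    exact_mod_cast hcard
  linarith

end Counting

/-! ### Dyadic decomposition of the peak function. -/

section Scales

/-- The number of dyadic scales up to `h`. -/
noncomputable def scaleCount (h : ℝ) : ℕ := Nat.log 2 ⌊h⌋₊ + 1

lemma two_pow_le_of_lt_scaleCount {h : ℝ} (hh : 1 ≤ h) {i : ℕ} (hi : i < scaleCount h) :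
    (2 : ℝ) ^ i ≤ h := by
  have h0 : ⌊h⌋₊ ≠ 0 := by simpa [Nat.floor_eq_zero] using hh
  have h1 : 2 ^ i ≤ ⌊h⌋₊ :=
    (Nat.pow_le_pow_right two_pos (Nat.lt_succ_iff.mp hi)).trans (Nat.pow_log_le_self 2 h0)
  have h2 : ((2 ^ i : ℕ) : ℝ) ≤ h := (Nat.cast_le.mpr h1).trans (Nat.floor_le (by linarith))
  exact_mod_cast h2

variable {q : ℕ} [NeZero q]

/-- The majorant `min(h, 1 / (2 ‖x / q‖))` of a linear exponential sum. -/
noncomputable def peak (h : ℝ) (x : ZMod q) : ℝ := min h (1 / (2 * fracDist x))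

lemma peak_nonneg {h : ℝ} (hh : 0 ≤ h) (x : ZMod q) : 0 ≤ peak h x :=
  le_min hh (by have := fracDist_nonneg x; positivity)

/-- Take the least `i` satisfying the distance bound. Minimality bounds the distance below by `2 ^
(i - 1) / h`, and the factor `2` in `peak` absorbs the shift; for `i = 0` the trivial bound `h` is
used. -/
lemma exists_scale {h : ℝ} (hh : 1 ≤ h) {x : ZMod q} (hx : x ≠ 0) :
    ∃ i < scaleCount h, fracDist x ≤ 2 ^ i / h ∧ peak h x ≤ h / 2 ^ i := by
  have hd := fracDist_pos hx
  have hex : ∃ i, fracDist x ≤ 2 ^ i / h ∧ i < scaleCount h := by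
    refine ⟨Nat.log 2 ⌊h⌋₊, (fracDist_le_half x).trans ?_, Nat.lt_succ_self _⟩
    rw [le_div_iff₀ (by linarith)]
    have h1 : ⌊h⌋₊ + 1 ≤ 2 ^ (Nat.log 2 ⌊h⌋₊ + 1) := Nat.lt_pow_succ_log_self (by norm_num) _
    have h2 : ((⌊h⌋₊ + 1 : ℕ) : ℝ) ≤ ((2 ^ (Nat.log 2 ⌊h⌋₊ + 1) : ℕ) : ℝ) := Nat.cast_le.mpr h1
    have h3 := (Nat.lt_floor_add_one h).le
    push_cast at h2
    rw [pow_succ] at h2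
    linarith
  classical
  obtain ⟨h1, h2⟩ := Nat.find_spec hex
  refine ⟨Nat.find hex, h2, h1, ?_⟩
  rcases hi : Nat.find hex with _ | i
  · rw [pow_zero, div_one]; exact min_le_left _ _
  · have h3 := Nat.find_min hex (m := i) (by omega)
    rw [not_and_or] at h3
    have h4 : ¬ fracDist x ≤ 2 ^ i / h := h3.resolve_right (by omega)
    rw [not_le, div_lt_iff₀ (by linarith)] at h4
    refine (min_le_right _ _).trans ?_
    rw [div_le_div_iff₀ (by positivity) (by positivity), pow_succ]
    linarith

lemma peak_pow_le_sum {h : ℝ} (hh : 1 ≤ h) {x : ZMod q} (hx : x ≠ 0) (m : ℕ) :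
    peak h x ^ m ≤ ∑ i ∈ range (scaleCount h),
      (h / 2 ^ i) ^ m * if fracDist x ≤ 2 ^ i / h then 1 else 0 := by
  obtain ⟨i, hi, h1, h2⟩ := exists_scale hh hx
  refine le_trans ?_ (single_le_sum (fun j _ => ?_) (mem_range.mpr hi))
  · rw [if_pos h1, mul_one]
    exact pow_le_pow_left₀ (peak_nonneg (by linarith) x) h2 m
  · have : 0 ≤ h := by linarith
    split_ifs <;> positivity

/-- At scale `i` there are at most `2 * (2 ^ i / h) * d` classes of size `h / 2 ^ i`, so the squares
form a convergent geometric series. -/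
lemma sum_peak_sq_le {h : ℝ} (hh : 1 ≤ h) {d : ℕ} (hd : d ∣ q) (s : Finset (ZMod q))
    (hs : ∀ x ∈ s, x ≠ 0 ∧ d • x = 0) : ∑ x ∈ s, peak h x ^ 2 ≤ 4 * h * d := by
  refine (sum_le_sum fun x hx => peak_pow_le_sum hh (hs x hx).1 2).trans ?_
  rw [sum_comm]
  simp_rw [← mul_sum, sum_boole]
  have hh0 : (0 : ℝ) < h := by linarith
  have h1 : ∀ i, (#{x ∈ s | fracDist x ≤ 2 ^ i / h} : ℝ) ≤ 2 * (2 ^ i / h) * d := fun i =>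
    card_le_of_nsmul_eq_zero hd (by positivity) _ fun x hx => by
      rw [mem_filter] at hx
      exact ⟨(hs x hx.1).1, (hs x hx.1).2, hx.2⟩
  calc ∑ i ∈ range (scaleCount h), (h / 2 ^ i) ^ 2 * (#{x ∈ s | fracDist x ≤ 2 ^ i / h} : ℝ)
      ≤ ∑ i ∈ range (scaleCount h), (h / 2 ^ i) ^ 2 * (2 * (2 ^ i / h) * d) := by
        gcongr with i _; exact h1 i
    _ = 2 * h * d * ∑ i ∈ range (scaleCount h), (1 / 2 : ℝ) ^ i := by
        rw [mul_sum]
        refine sum_congr rfl fun i _ => ?_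
        rw [one_div, inv_pow]
        field_simp
    _ ≤ 2 * h * d * 2 := by
        gcongr
        exact sum_geometric_two_le _
    _ = 4 * h * d := by ring

lemma one_le_fracDist_mul {d : ℕ} (hd : d ∣ q) {x : ZMod q} (hx : x ≠ 0) (hdx : d • x = 0) :
    1 ≤ fracDist x * d := by
  obtain ⟨m, hm⟩ := hd
  obtain ⟨a, ha, ha'⟩ := exists_valMinAbs_eq_mul hm hdx
  rw [← ha']
  have : a ≠ 0 := by
    rintro rfl
    exact hx ((ZMod.valMinAbs_eq_zero x).mp (by simpa using ha))
  exact_mod_cast Int.one_le_abs this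

lemma inv_two_mul_fracDist_le {d : ℕ} (hd : d ∣ q) {x : ZMod q} (hx : x ≠ 0)
    (hdx : d • x = 0) : 1 / (2 * fracDist x) ≤ d := by
  have h1 := one_le_fracDist_mul hd hx hdx
  have h2 := fracDist_pos hx
  rw [div_le_iff₀ (by positivity)]
  linarith

end Scales

/-! ### Euler products and the ratio of `q` to its totient. -/

section TotientRatio

/-- The ratio `q / φ(q)`. -/
noncomputable def totientRatio (q : ℕ) : ℝ := (q : ℝ) / Nat.totient q

lemma one_le_totientRatio {q : ℕ} (hq : q ≠ 0) : 1 ≤ totientRatio q := by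
  unfold totientRatio
  rw [one_le_div (by exact_mod_cast Nat.totient_pos.mpr (Nat.pos_of_ne_zero hq))]
  exact_mod_cast Nat.totient_le q

lemma totientRatio_le_of_dvd {d q : ℕ} (hq : Squarefree q) (hd : d ∣ q) :
    totientRatio d ≤ totientRatio q := by
  obtain ⟨m, rfl⟩ := hd
  have hm : m ≠ 0 := by rintro rfl; simp at hq
  unfold totientRatio
  rw [Nat.totient_mul (Nat.coprime_of_squarefree_mul hq)]
  push_cast
  rw [mul_div_mul_comm]
  exact le_mul_of_one_le_right (by positivity) (one_le_totientRatio hm)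

lemma totientRatio_eq_prod {q : ℕ} (hq : q ≠ 0) :
    totientRatio q = ∏ p ∈ q.primeFactors, (1 - (p : ℝ)⁻¹)⁻¹ := by
  unfold totientRatio
  have h1 : (Nat.totient q : ℝ) = q * ∏ p ∈ q.primeFactors, (1 - (p : ℝ)⁻¹) := by
    have := Nat.totient_eq_mul_prod_factors q
    have h2 := congrArg (fun x : ℚ => (x : ℝ)) this
    push_cast at h2
    exact h2
  have h2 : (q : ℝ) ≠ 0 := by exact_mod_cast hq
  rw [h1, prod_inv_distrib, div_mul_eq_div_div, div_self h2, one_div]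

/-- Prime by prime, `1 + m / p ≤ (1 + 1 / p) ^ m ≤ (1 - 1 / p) ^ (-m)`. -/
lemma prod_one_add_le_totientRatio_pow {q : ℕ} (hq : q ≠ 0) (m : ℕ) :
    ∏ p ∈ q.primeFactors, (1 + (m : ℝ) / p) ≤ totientRatio q ^ m := by
  rw [totientRatio_eq_prod hq, ← prod_pow]
  refine prod_le_prod (fun p _ => by positivity) fun p hp => ?_
  have hp1 : (1 : ℝ) < p := by exact_mod_cast (Nat.prime_of_mem_primeFactors hp).one_lt
  have h1 : 1 + (m : ℝ) / p ≤ (1 + (p : ℝ)⁻¹) ^ m := by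
    have := one_add_mul_le_pow (a := (p : ℝ)⁻¹) (by have : (0 : ℝ) ≤ (p : ℝ)⁻¹ := by positivity
                                                    linarith) m
    rwa [div_eq_mul_inv]
  refine h1.trans (pow_le_pow_left₀ (by positivity) ?_ m)
  have h2 : (p : ℝ)⁻¹ < 1 := inv_lt_one_of_one_lt₀ hp1
  rw [le_inv_comm₀ (by positivity) (by linarith), ← one_div (1 + (p : ℝ)⁻¹),
    le_div_iff₀ (by positivity)]
  nlinarith [sq_nonneg (p : ℝ)⁻¹]

lemma sum_divisors_inv_le {q : ℕ} (hq : Squarefree q) :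
    ∑ d ∈ q.divisors, (d : ℝ)⁻¹ ≤ totientRatio q := by
  have h0 : q ≠ 0 := hq.ne_zero
  have h1 := prod_one_add_le_totientRatio_pow h0 1
  rw [pow_one] at h1
  refine le_trans (le_of_eq ?_) h1
  set F : ArithmeticFunction ℝ := ⟨fun d => (d : ℝ)⁻¹, by simp⟩ with hF
  have hF' : F.IsMultiplicative := by
    refine ⟨by simp [hF], fun {m n} _ => ?_⟩
    simp only [hF, ArithmeticFunction.coe_mk, Nat.cast_mul, mul_inv]
  rw [← show ∑ d ∈ q.divisors, F d = ∑ d ∈ q.divisors, (d : ℝ)⁻¹ from rfl,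
    ← hF'.prodPrimeFactors_one_add_of_squarefree hq]
  exact prod_congr rfl fun p _ => by simp [hF]

end TotientRatio

/-! ### Evaluating the exponents of the Euler products. -/

section SubsetWeight

lemma subsetWeight_eq {k : ℕ} (w : Fin k → ℝ) :
    subsetWeight w = ∏ i, (1 + w i) - 1 - ∑ i, w i := by
  classical
  rw [prod_one_add, powerset_univ, subsetWeight,
    ← sum_filter_add_sum_filter_not univ (fun S : Finset (Fin k) => 2 ≤ #S)]
  have h : ∑ S : Finset (Fin k) with ¬ 2 ≤ #S, ∏ i ∈ S, w i = 1 + ∑ i, w i := by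
    have h1 : (univ.filter fun S : Finset (Fin k) => ¬ 2 ≤ #S) =
        insert ∅ (univ.image fun i => {i}) := by
      ext S
      simp only [mem_filter, mem_univ, true_and, mem_insert, mem_image]
      constructor
      · intro hS
        rcases Nat.lt_or_ge (#S) 1 with h | h
        · left; exact card_eq_zero.mp (by omega)
        · right
          obtain ⟨a, rfl⟩ := card_eq_one.mp (show #S = 1 by omega)
          exact ⟨a, rfl⟩
      · rintro (rfl | ⟨a, rfl⟩) <;> simp
    rw [h1, sum_insert, sum_image]
    · simp
    · intro a _ b _ hab
      simpa using hab
    · simp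
  rw [h]
  ring

/-- The exponent of the Euler product for `k` factors of weight one. -/
lemma exists_subsetWeight_one (k : ℕ) :
    ∃ m : ℕ, m + k + 1 = 2 ^ k ∧ subsetWeight (fun _ : Fin k => (1 : ℝ)) = m := by
  obtain ⟨m, hm⟩ := Nat.exists_eq_add_of_le (Nat.lt_two_pow_self (n := k))
  refine ⟨m, by omega, ?_⟩
  rw [subsetWeight_eq]
  have : (2 : ℝ) ^ k = k.succ + m := by exact_mod_cast hm
  simp only [prod_const, card_univ, Fintype.card_fin, sum_const, nsmul_eq_mul, mul_one]
  norm_num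
  rw [this]
  push_cast
  ring

/-- The exponent of the Euler product for one factor of weight three and `k - 2` of weight one. -/
lemma exists_subsetWeight_cons_three (n : ℕ) :
    ∃ m : ℕ, m + n + 4 = 2 ^ (n + 2) ∧
      subsetWeight (Fin.cons 3 (fun _ : Fin n => (1 : ℝ)) : Fin (n + 1) → ℝ) = m := by
  obtain ⟨m, hm, -⟩ := exists_subsetWeight_one n
  refine ⟨4 * m + 3 * n, by rw [pow_add]; omega, ?_⟩
  rw [subsetWeight_eq]
  have : (2 : ℝ) ^ n = m + n + 1 := by exact_mod_cast hm.symm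
  simp only [Fin.prod_univ_succ, Fin.sum_univ_succ, Fin.cons_zero, Fin.cons_succ, prod_const,
    card_univ, Fintype.card_fin, sum_const, nsmul_eq_mul, mul_one]
  norm_num
  rw [this]
  ring

end SubsetWeight

/-! ### Mean squares of the majorant over elements of given order. -/

section Majorant

variable {q : ℕ} [NeZero q]

/-- The weight `min(h, 1 / (2 ‖x / q‖)) / φ(d)` of a nonzero residue class of order `d`. -/
noncomputable def majorant (h : ℝ) (x : ZMod q) : ℝ :=
  if x = 0 then 0 else peak h x / Nat.totient (addOrderOf x)

lemma majorant_nonneg {h : ℝ} (hh : 0 ≤ h) (x : ZMod q) : 0 ≤ majorant h x := by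
  unfold majorant
  split_ifs
  · exact le_rfl
  · exact div_nonneg (peak_nonneg hh x) (Nat.cast_nonneg _)

@[simp] lemma majorant_zero (h : ℝ) : majorant h (0 : ZMod q) = 0 := by simp [majorant]

lemma addOrderOf_dvd_modulus (x : ZMod q) : addOrderOf x ∣ q := by
  rw [addOrderOf_dvd_iff_nsmul_eq_zero]; simp

lemma majorant_le_totientRatio (hq : Squarefree q) (h : ℝ) (x : ZMod q) :
    majorant h x ≤ totientRatio q := by
  unfold majorant
  split_ifs with hx
  · exact (one_le_totientRatio (NeZero.ne q)).trans' zero_le_one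
  · refine le_trans ?_ (totientRatio_le_of_dvd hq (addOrderOf_dvd_modulus x))
    unfold totientRatio
    gcongr
    exact (min_le_right _ _).trans
      (inv_two_mul_fracDist_le (addOrderOf_dvd_modulus x) hx (addOrderOf_nsmul_eq_zero x))

/-- A nonzero class killed by `d` is at distance at least `1 / d` from zero, so `h` may be lowered
to `min h d`. The minimum is what makes small orders cheap. -/
lemma order_mul_sum_majorant_sq_le (hq : Squarefree q) {h : ℝ} (hh : 1 ≤ h) {d : ℕ}
    (hd : d ∣ q) :
    d * ∑ x : ZMod q with addOrderOf x = d, majorant h x ^ 2 ≤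
      4 * min h d * totientRatio q ^ 2 := by
  have hd0 : 0 < d := Nat.pos_of_ne_zero fun h0 => NeZero.ne q (by simpa [h0] using hd)
  have hd1 : (1 : ℝ) ≤ d := by exact_mod_cast hd0
  have hH : 1 ≤ min h d := le_min hh hd1
  rcases eq_or_ne d 1 with rfl | hd1'
  · rw [sum_eq_zero]
    · rw [mul_zero]; positivity
    · intro x hx
      simp only [mem_filter, mem_univ, true_and, AddMonoid.addOrderOf_eq_one_iff] at hx
      simp [hx]
  have hx0 : ∀ x : ZMod q, addOrderOf x = d → x ≠ 0 := by
    rintro x hx rfl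
    exact hd1' (by simpa using hx.symm)
  have h1 : ∀ x ∈ ({x : ZMod q | addOrderOf x = d} : Finset _),
      majorant h x ^ 2 ≤ peak (min h d) x ^ 2 / (Nat.totient d : ℝ) ^ 2 := by
    intro x hx
    simp only [mem_filter, mem_univ, true_and] at hx
    rw [majorant, if_neg (hx0 x hx), hx, div_pow]
    gcongr
    · exact peak_nonneg (by linarith) x
    · refine le_min (le_min (min_le_left _ _) ?_) (min_le_right _ _)
      refine (min_le_right _ _).trans (inv_two_mul_fracDist_le hd (hx0 x hx) ?_)
      rw [← hx]; exact addOrderOf_nsmul_eq_zero x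
  have h2 := sum_peak_sq_le (q := q) hH hd {x : ZMod q | addOrderOf x = d} (by
    intro x hx
    simp only [mem_filter, mem_univ, true_and] at hx
    exact ⟨hx0 x hx, by rw [← hx]; exact addOrderOf_nsmul_eq_zero x⟩)
  have h3 := totientRatio_le_of_dvd hq hd
  have hφ : (0 : ℝ) < Nat.totient d := by exact_mod_cast Nat.totient_pos.mpr hd0
  calc d * ∑ x : ZMod q with addOrderOf x = d, majorant h x ^ 2
      ≤ d * ((4 * min h d * d) / (Nat.totient d : ℝ) ^ 2) := by
        refine mul_le_mul_of_nonneg_left ((sum_le_sum h1).trans ?_) (by positivity)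
        rw [← sum_div]
        gcongr
    _ = 4 * min h d * totientRatio d ^ 2 := by
        unfold totientRatio
        field_simp
    _ ≤ 4 * min h d * totientRatio q ^ 2 := by
        have : 0 ≤ totientRatio d := by unfold totientRatio; positivity
        gcongr

end Majorant

/-! ### Moments of the number of representations as a sum of a near pair. -/

section PairCount

variable {q : ℕ} [NeZero q]

/-- Two residue classes near zero, of orders `r₁ s t` and `r₂ s t`, with a nonzero sum of order
`r₁ r₂ s`. -/
structure IsNearPair (r₁ r₂ s t : ℕ) (ρ σ : ℝ) (x z : ZMod q) : Prop where
  left_ne : x ≠ 0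
  right_ne : z ≠ 0
  add_ne : x + z ≠ 0
  order_left : addOrderOf x = r₁ * s * t
  order_right : addOrderOf z = r₂ * s * t
  order_add : addOrderOf (x + z) = r₁ * r₂ * s
  dist_left : fracDist x ≤ ρ
  dist_right : fracDist z ≤ σ

lemma IsNearPair.symm {r₁ r₂ s t : ℕ} {ρ σ : ℝ} {x z : ZMod q}
    (h : IsNearPair r₁ r₂ s t ρ σ x z) : IsNearPair r₂ r₁ s t σ ρ z x :=
  ⟨h.right_ne, h.left_ne, by rw [add_comm]; exact h.add_ne, h.order_right, h.order_left,
    by rw [add_comm, h.order_add]; ring, h.dist_right, h.dist_left⟩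

open Classical in
/-- The number of representations of `y` as a sum of a near pair. -/
noncomputable def pairCount (r₁ r₂ s t : ℕ) (ρ σ : ℝ) (y : ZMod q) : ℕ :=
  #{x : ZMod q | IsNearPair r₁ r₂ s t ρ σ x (y - x)}

lemma pairCount_symm (r₁ r₂ s t : ℕ) (ρ σ : ℝ) (y : ZMod q) :
    pairCount r₁ r₂ s t ρ σ y = pairCount r₂ r₁ s t σ ρ y := by
  classical
  unfold pairCount
  refine card_nbij' (fun x => y - x) (fun x => y - x) ?_ ?_ ?_ ?_
  · intro x hx
    simp only [coe_filter, mem_univ, true_and, Set.mem_ofPred_eq] at hx ⊢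
    simpa using hx.symm
  · intro x hx
    simp only [coe_filter, mem_univ, true_and, Set.mem_ofPred_eq] at hx ⊢
    simpa using hx.symm
  · intro x _; simp
  · intro x _; simp

variable {r₁ r₂ s t : ℕ} {ρ σ : ℝ}

/-- Two left entries differ by a class killed by both `r₁ s t` and `r₂ s t`, hence by their gcd `s
t`. -/
lemma pairCount_le (hr : r₁.Coprime r₂) (hd : r₁ * r₂ * s * t ∣ q) (hρ : 0 ≤ ρ) (y : ZMod q) :
    (pairCount r₁ r₂ s t ρ σ y : ℝ) ≤ 2 * ρ * (s * t : ℕ) + 1 := by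
  classical
  refine card_le_of_nsmul_sub_eq_zero ((Dvd.intro_left (r₁ * r₂) (by ring)).trans hd) hρ _ ?_ ?_
  · intro x hx
    simp only [mem_filter, mem_univ, true_and] at hx
    exact hx.dist_left
  · intro x hx z hz
    simp only [mem_filter, mem_univ, true_and] at hx hz
    have h1 : (r₁ * s * t) • (x - z) = 0 := by
      rw [nsmul_sub, ← hx.order_left, addOrderOf_nsmul_eq_zero, hx.order_left, ← hz.order_left,
        addOrderOf_nsmul_eq_zero, sub_zero]
    have h2 : (r₂ * s * t) • (x - z) = 0 := by
      have : x - z = (y - z) - (y - x) := by ring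
      rw [this, nsmul_sub, ← hx.order_right, addOrderOf_nsmul_eq_zero, hx.order_right,
        ← hz.order_right, addOrderOf_nsmul_eq_zero, sub_zero]
    have h3 := gcd_nsmul_eq_zero.mpr ⟨h1, h2⟩
    rwa [mul_assoc, mul_assoc, Nat.gcd_mul_right, hr.gcd_eq_one, one_mul] at h3

lemma fracDist_le_of_pairCount_ne_zero {y : ZMod q} (hy : pairCount r₁ r₂ s t ρ σ y ≠ 0) :
    y ≠ 0 ∧ addOrderOf y = r₁ * r₂ * s ∧ fracDist y ≤ ρ + σ := by
  classical
  obtain ⟨x, hx⟩ := card_pos.mp (Nat.pos_of_ne_zero hy)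
  simp only [mem_filter, mem_univ, true_and] at hx
  have h1 := hx.add_ne
  have h2 := hx.order_add
  have h3 := fracDist_add_le x (y - x)
  rw [add_sub_cancel] at h1 h2 h3
  exact ⟨h1, h2, h3.trans (add_le_add hx.dist_left hx.dist_right)⟩

lemma card_pairCount_support_le (hd : r₁ * r₂ * s * t ∣ q) (hρ : 0 ≤ ρ) (hσ : 0 ≤ σ) :
    (#{y : ZMod q | pairCount r₁ r₂ s t ρ σ y ≠ 0} : ℝ) ≤ 2 * (ρ + σ) * (r₁ * r₂ * s : ℕ) := by
  refine card_le_of_nsmul_eq_zero ((Dvd.intro _ rfl).trans hd) (by positivity) _ ?_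
  intro y hy
  simp only [mem_filter, mem_univ, true_and] at hy
  obtain ⟨h1, h2, h3⟩ := fracDist_le_of_pairCount_ne_zero hy
  exact ⟨h1, by rw [← h2]; exact addOrderOf_nsmul_eq_zero y, h3⟩

/-- For a fixed left entry, two right entries differ by a class killed by `r₂ s t` and by `r₁ r₂ s`,
hence by `r₂ s`, because `t` is coprime to `r₁`. -/
lemma sum_pairCount_le (ht : t.Coprime r₁) (hd : r₁ * r₂ * s * t ∣ q) (hρ : 0 ≤ ρ)
    (hσ : 0 ≤ σ) :
    ∑ y : ZMod q, (pairCount r₁ r₂ s t ρ σ y : ℝ) ≤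
      2 * ρ * (r₁ * s * t : ℕ) * (2 * σ * (r₂ * s : ℕ) + 1) := by
  classical
  have h1 : ∑ y : ZMod q, (pairCount r₁ r₂ s t ρ σ y : ℝ) =
      ∑ x : ZMod q, (#{z : ZMod q | IsNearPair r₁ r₂ s t ρ σ x z} : ℝ) := by
    simp only [pairCount, card_filter]
    push_cast
    rw [sum_comm]
    refine sum_congr rfl fun x _ => ?_
    exact (Equiv.subRight x).sum_comp
      (fun z => if IsNearPair r₁ r₂ s t ρ σ x z then (1 : ℝ) else 0)
  rw [h1]
  set X : Finset (ZMod q) := {x | x ≠ 0 ∧ addOrderOf x = r₁ * s * t ∧ fracDist x ≤ ρ}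
  have h2 : ∑ x : ZMod q, (#{z : ZMod q | IsNearPair r₁ r₂ s t ρ σ x z} : ℝ) =
      ∑ x ∈ X, (#{z : ZMod q | IsNearPair r₁ r₂ s t ρ σ x z} : ℝ) := by
    symm
    refine sum_subset (subset_univ _) fun x _ hx => ?_
    rw [Nat.cast_eq_zero, card_eq_zero, filter_eq_empty_iff]
    intro z _ hz
    exact hx (by simp only [X, mem_filter, mem_univ, true_and]
                 exact ⟨hz.left_ne, hz.order_left, hz.dist_left⟩)
  rw [h2]
  have hX : (#X : ℝ) ≤ 2 * ρ * (r₁ * s * t : ℕ) := by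
    refine card_le_of_nsmul_eq_zero ((Dvd.intro r₂ (by ring)).trans hd) hρ _ fun x hx => ?_
    simp only [X, mem_filter, mem_univ, true_and] at hx
    exact ⟨hx.1, by rw [← hx.2.1]; exact addOrderOf_nsmul_eq_zero x, hx.2.2⟩
  have hf : ∀ x, (#{z : ZMod q | IsNearPair r₁ r₂ s t ρ σ x z} : ℝ) ≤
      2 * σ * (r₂ * s : ℕ) + 1 := by
    intro x
    refine card_le_of_nsmul_sub_eq_zero ((Dvd.intro (r₁ * t) (by ring)).trans hd) hσ _ ?_ ?_
    · intro z hz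
      simp only [mem_filter, mem_univ, true_and] at hz
      exact hz.dist_right
    · intro z hz z' hz'
      simp only [mem_filter, mem_univ, true_and] at hz hz'
      have h3 : (r₂ * s * t) • (z - z') = 0 := by
        rw [nsmul_sub, ← hz.order_right, addOrderOf_nsmul_eq_zero, hz.order_right,
          ← hz'.order_right, addOrderOf_nsmul_eq_zero, sub_zero]
      have h4 : (r₂ * s * r₁) • (z - z') = 0 := by
        have h5 : z - z' = (x + z) - (x + z') := by ring
        have h6 : r₂ * s * r₁ = r₁ * r₂ * s := by ring
        rw [h5, h6, nsmul_sub, ← hz.order_add, addOrderOf_nsmul_eq_zero, hz.order_add,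
          ← hz'.order_add, addOrderOf_nsmul_eq_zero, sub_zero]
      have h5 := gcd_nsmul_eq_zero.mpr ⟨h3, h4⟩
      rwa [Nat.gcd_mul_left, ht.gcd_eq_one, mul_one] at h5
  refine (sum_le_card_nsmul X _ _ fun x _ => hf x).trans ?_
  rw [nsmul_eq_mul]
  gcongr

/-- The second moment is at most a pointwise bound times either its square and the size of the
support, or the first moment. Assuming `a ≤ b` makes the pointwise bound use the narrower window. -/
lemma sum_pairCount_sq_le_aux {h a b T : ℝ} (hh : 1 ≤ h) (ha : 1 ≤ a) (hab : a ≤ b)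
    (hr : r₁.Coprime r₂) (ht₁ : t.Coprime r₁) (ht₂ : t.Coprime r₂)
    (hd : r₁ * r₂ * s * t ∣ q) (hT : 0 ≤ T) (hTd : T ≤ (s * t : ℕ)) (hTh : T ≤ h)
    (hbig : h * T < (r₁ * s * t : ℕ) * s ∨ h * T < (r₂ * s * t : ℕ) * s) :
    (∑ y : ZMod q, (pairCount r₁ r₂ s t (a / h) (b / h) y : ℝ) ^ 2) * (h ^ 2 * T) ≤
      36 * (a * b) ^ 2 * (r₁ * r₂ * s : ℕ) * (s * t : ℕ) ^ 2 := by
  have hb : 1 ≤ b := ha.trans hab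
  have hh0 : 0 < h := by linarith
  set c : ZMod q → ℝ := fun y => (pairCount r₁ r₂ s t (a / h) (b / h) y : ℝ) with hc
  have hc0 : ∀ y, 0 ≤ c y := fun y => Nat.cast_nonneg _
  have hcle : ∀ y, c y ≤ 2 * (a / h) * (s * t : ℕ) + 1 := fun y =>
    pairCount_le hr hd (by positivity) y
  set d : ℝ := ((s * t : ℕ) : ℝ) with hdd
  set q₀ : ℝ := ((r₁ * r₂ * s : ℕ) : ℝ) with hq₀
  have hd0 : 0 ≤ d := Nat.cast_nonneg _
  have hq₀0 : 0 ≤ q₀ := Nat.cast_nonneg _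
  -- This decides which term of `hcle` dominates. If it is the linear one, the support count
  -- suffices and `T ≤ h` gives the gain; otherwise the counts are at most `3` and the first moment
  -- is used.
  rcases le_or_gt h (a * d) with hcase | hcase
  · have h1 : ∀ y, c y ≤ 3 * a * d / h := by
      intro y
      refine (hcle y).trans ?_
      rw [le_div_iff₀ hh0]
      have : (2 * (a / h) * d + 1) * h = 2 * a * d + h := by field_simp
      rw [this]
      linarith
    have h2 : ∑ y, c y ^ 2 ≤ 2 * (a / h + b / h) * q₀ * (3 * a * d / h) ^ 2 := by
      have h3 : ∑ y, c y ^ 2 =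
          ∑ y : ZMod q with pairCount r₁ r₂ s t (a / h) (b / h) y ≠ 0, c y ^ 2 := by
        rw [sum_filter]
        refine sum_congr rfl fun y _ => ?_
        split_ifs with h4
        · rfl
        · rw [not_not] at h4
          simp [hc, h4]
      rw [h3]
      refine (sum_le_card_nsmul _ _ ((3 * a * d / h) ^ 2) fun y _ =>
        pow_le_pow_left₀ (hc0 y) (h1 y) 2).trans ?_
      rw [nsmul_eq_mul]
      gcongr
      exact card_pairCount_support_le hd (by positivity) (by positivity)
    calc (∑ y, c y ^ 2) * (h ^ 2 * T)
        ≤ 2 * (a / h + b / h) * q₀ * (3 * a * d / h) ^ 2 * (h ^ 2 * T) := by gcongr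
      _ = 18 * (a + b) * (T / h) * (a ^ 2 * q₀ * d ^ 2) := by field_simp; ring
      _ ≤ 18 * (b + b) * 1 * (a ^ 2 * q₀ * d ^ 2) := by
          gcongr
          rw [div_le_one hh0]; exact hTh
      _ = 36 * (b * (a ^ 2 * q₀ * d ^ 2)) := by ring
      _ ≤ 36 * (b ^ 2 * (a ^ 2 * q₀ * d ^ 2)) := by
          gcongr
          nlinarith
      _ = 36 * (a * b) ^ 2 * q₀ * d ^ 2 := by ring
  · have h1 : ∀ y, c y ≤ 3 := by
      intro y
      refine (hcle y).trans ?_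
      have : 2 * (a / h) * d = 2 * (a * d / h) := by ring
      rw [this]
      have : a * d / h ≤ 1 := by rw [div_le_one hh0]; exact hcase.le
      linarith
    have h2 : ∑ y, c y ^ 2 ≤ 3 * ∑ y, c y := by
      rw [mul_sum]
      refine sum_le_sum fun y _ => ?_
      rw [sq]
      exact mul_le_mul_of_nonneg_right (h1 y) (hc0 y)
    have hab1 : 1 ≤ a * b := by nlinarith
    have hmain : 12 * (a * b * d * q₀) * T ≤ 12 * (a * b) ^ 2 * q₀ * d ^ 2 := by
      have : a * b * (d * q₀) * T ≤ (a * b) ^ 2 * (d * q₀) * d := by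
        gcongr
        nlinarith
      nlinarith
    have hpos : 0 ≤ (a * b) ^ 2 * q₀ * d ^ 2 := by positivity
    -- The `+ 1` in the first moment is the only danger. Summing on the outside over the entry that
    -- `hbig` does not mention makes the product of the two orders and `s` equal to `q₀ * d ^ 2`.
    rcases hbig with hbig | hbig
    · have h3 : ∑ y, c y ≤ 2 * (b / h) * (r₂ * s * t : ℕ) * (2 * (a / h) * (r₁ * s : ℕ) + 1) := by
        simp only [hc, pairCount_symm r₁ r₂]
        refine sum_pairCount_le ht₂ ?_ (by positivity) (by positivity)
        rwa [mul_comm r₂ r₁]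
      have h4 : 6 * b * (r₂ * s * t : ℕ) * (h * T) ≤ 6 * (a * b) ^ 2 * q₀ * d ^ 2 := by
        have h5 : (r₂ * s * t : ℕ) * ((r₁ * s * t : ℕ) * s : ℝ) = q₀ * d ^ 2 := by
          simp only [hq₀, hdd]; push_cast; ring
        calc 6 * b * (r₂ * s * t : ℕ) * (h * T)
            ≤ 6 * b * (r₂ * s * t : ℕ) * ((r₁ * s * t : ℕ) * s) := by gcongr
          _ = 6 * b * (q₀ * d ^ 2) := by rw [← h5]; ring
          _ ≤ 6 * (a * b) ^ 2 * (q₀ * d ^ 2) := by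
              gcongr
              nlinarith
          _ = _ := by ring
      calc (∑ y, c y ^ 2) * (h ^ 2 * T)
          ≤ (3 * (2 * (b / h) * (r₂ * s * t : ℕ) * (2 * (a / h) * (r₁ * s : ℕ) + 1))) *
            (h ^ 2 * T) := by gcongr; linarith
        _ = 12 * (a * b * d * q₀) * T + 6 * b * (r₂ * s * t : ℕ) * (h * T) := by
            simp only [hq₀, hdd]; push_cast; field_simp; ring
        _ ≤ 36 * (a * b) ^ 2 * q₀ * d ^ 2 := by linarith
    · have h3 : ∑ y, c y ≤ 2 * (a / h) * (r₁ * s * t : ℕ) * (2 * (b / h) * (r₂ * s : ℕ) + 1) :=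
        sum_pairCount_le ht₁ hd (by positivity) (by positivity)
      have h4 : 6 * a * (r₁ * s * t : ℕ) * (h * T) ≤ 6 * (a * b) ^ 2 * q₀ * d ^ 2 := by
        have h5 : (r₁ * s * t : ℕ) * ((r₂ * s * t : ℕ) * s : ℝ) = q₀ * d ^ 2 := by
          simp only [hq₀, hdd]; push_cast; ring
        calc 6 * a * (r₁ * s * t : ℕ) * (h * T)
            ≤ 6 * a * (r₁ * s * t : ℕ) * ((r₂ * s * t : ℕ) * s) := by gcongr
          _ = 6 * a * (q₀ * d ^ 2) := by rw [← h5]; ring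
          _ ≤ 6 * (a * b) ^ 2 * (q₀ * d ^ 2) := by
              gcongr
              nlinarith
          _ = _ := by ring
      calc (∑ y, c y ^ 2) * (h ^ 2 * T)
          ≤ (3 * (2 * (a / h) * (r₁ * s * t : ℕ) * (2 * (b / h) * (r₂ * s : ℕ) + 1))) *
            (h ^ 2 * T) := by gcongr; linarith
        _ = 12 * (a * b * d * q₀) * T + 6 * a * (r₁ * s * t : ℕ) * (h * T) := by
            simp only [hq₀, hdd]; push_cast; field_simp; ring
        _ ≤ 36 * (a * b) ^ 2 * q₀ * d ^ 2 := by linarith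

lemma sum_pairCount_sq_le {h a b T : ℝ} (hh : 1 ≤ h) (ha : 1 ≤ a) (hb : 1 ≤ b)
    (hr : r₁.Coprime r₂) (ht₁ : t.Coprime r₁) (ht₂ : t.Coprime r₂)
    (hd : r₁ * r₂ * s * t ∣ q) (hT : 0 ≤ T) (hTd : T ≤ (s * t : ℕ)) (hTh : T ≤ h)
    (hbig : h * T < (r₁ * s * t : ℕ) * s ∨ h * T < (r₂ * s * t : ℕ) * s) :
    (∑ y : ZMod q, (pairCount r₁ r₂ s t (a / h) (b / h) y : ℝ) ^ 2) * (h ^ 2 * T) ≤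
      36 * (a * b) ^ 2 * (r₁ * r₂ * s : ℕ) * (s * t : ℕ) ^ 2 := by
  rcases le_total a b with hab | hab
  · exact sum_pairCount_sq_le_aux hh ha hab hr ht₁ ht₂ hd hT hTd hTh hbig
  · simp only [pairCount_symm r₁ r₂]
    rw [mul_comm a b, mul_comm r₁ r₂]
    exact sum_pairCount_sq_le_aux hh hb hab hr.symm ht₂ ht₁ (by rwa [mul_comm r₂ r₁]) hT hTd hTh
      hbig.symm

end PairCount

/-! ### Integer coordinates of near pairs, and summation over the cofactor. -/

section DivisorSwitching

variable {q : ℕ} [NeZero q]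

/-- The nonzero integers of absolute value at most `A`. -/
noncomputable def punctured (A : ℕ) : Finset ℤ := (Icc (-(A : ℤ)) A).erase 0

lemma mem_punctured {A : ℕ} {u : ℤ} : u ∈ punctured A ↔ u ≠ 0 ∧ |u| ≤ A := by
  simp only [punctured, mem_erase, mem_Icc, abs_le]

/-- Here `x + z` is `m * (r₂ u + r₁ v)` modulo `q`. Being killed by `r₁ r₂ s = q / (t m)` forces `t
∣ r₂ u + r₁ v`. -/
lemma IsNearPair.exists_coordinates {r₁ r₂ s t m : ℕ} (hq : q = r₁ * r₂ * s * t * m) {ρ σ : ℝ}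
    {x z : ZMod q} (h : IsNearPair r₁ r₂ s t ρ σ x z) :
    ∃ u v : ℤ, x = ((r₂ * m : ℕ) : ZMod q) * u ∧ z = ((r₁ * m : ℕ) : ZMod q) * v ∧
      u ≠ 0 ∧ v ≠ 0 ∧ |(u : ℝ)| ≤ ρ * (r₁ * s * t : ℕ) ∧ |(v : ℝ)| ≤ σ * (r₂ * s * t : ℕ) ∧
      (t : ℤ) ∣ r₂ * u + r₁ * v ∧ (r₂ * u + r₁ * v : ℤ) ≠ 0 := by
  have hq0 : q ≠ 0 := NeZero.ne q
  obtain ⟨u, hu, hu'⟩ := exists_valMinAbs_eq_mul (n := r₁ * s * t) (m := r₂ * m)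
    (hq.trans (by ring)) (x := x) (by rw [← h.order_left]; exact addOrderOf_nsmul_eq_zero x)
  obtain ⟨v, hv, hv'⟩ := exists_valMinAbs_eq_mul (n := r₂ * s * t) (m := r₁ * m)
    (hq.trans (by ring)) (x := z) (by rw [← h.order_right]; exact addOrderOf_nsmul_eq_zero z)
  have hx : x = ((r₂ * m : ℕ) : ZMod q) * u := by
    rw [← ZMod.coe_valMinAbs x, hu]; push_cast; ring
  have hz : z = ((r₁ * m : ℕ) : ZMod q) * v := by
    rw [← ZMod.coe_valMinAbs z, hv]; push_cast; ring
  have hxz : x + z = ((m * (r₂ * u + r₁ * v) : ℤ) : ZMod q) := by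
    rw [hx, hz]; push_cast; ring
  have hm0 : m ≠ 0 := by rintro rfl; exact hq0 (by simpa using hq)
  refine ⟨u, v, hx, hz, ?_, ?_, ?_, ?_, ?_, ?_⟩
  · rintro rfl; exact h.left_ne (by simpa using hx)
  · rintro rfl; exact h.right_ne (by simpa using hz)
  · rw [hu']; gcongr; exact h.dist_left
  · rw [hv']; gcongr; exact h.dist_right
  · have h1 : (r₁ * r₂ * s) • ((m * (r₂ * u + r₁ * v) : ℤ) : ZMod q) = 0 := by
      rw [← hxz, ← h.order_add]; exact addOrderOf_nsmul_eq_zero _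
    rw [intCast_nsmul_eq_zero_iff (m := t * m) ?_ (hq.trans (by ring))] at h1
    · push_cast at h1
      rw [mul_comm (t : ℤ)] at h1
      exact (mul_dvd_mul_iff_left (by exact_mod_cast hm0)).mp h1
    · intro h0; exact hq0 (by rw [hq, h0]; simp)
  · intro h0
    apply h.add_ne
    rw [hxz, h0]
    simp

/-- The size bounds on the coordinates make each weight at most `1 / |u|` or `1 / |v|`. For fixed
`(u, v)` every admissible `t` divides the same nonzero integer `r₂ u + r₁ v`, so at most `B` of them
occur; the order of summation is exchanged to exploit this. -/
lemma sum_weighted_pairCount_le {r₁ r₂ s : ℕ} {h a b : ℝ} (hh : 1 ≤ h) (ha : 1 ≤ a) (hb : 1 ≤ b)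
    (hah : a ≤ h) (hbh : b ≤ h) (A : ℕ) (B : ℝ)
    (hB : ∀ N : ℕ, N ≠ 0 → N ≤ 2 * A ^ 2 → (#N.divisors : ℝ) ≤ B) (S : Finset ℕ)
    (hS : ∀ t ∈ S, r₁ * r₂ * s * t ∣ q ∧ r₁ * s * t ≤ A ∧ r₂ * s * t ≤ A) :
    ∑ t ∈ S, h / (a * (r₁ * s * t : ℕ)) * (h / (b * (r₂ * s * t : ℕ))) *
        ∑ y : ZMod q, (pairCount r₁ r₂ s t (a / h) (b / h) y : ℝ) ≤
      B * (∑ u ∈ punctured A, 1 / |(u : ℝ)|) ^ 2 := by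
  classical
  have hh0 : 0 < h := by linarith
  have hq0 : q ≠ 0 := NeZero.ne q
  set box := punctured A ×ˢ punctured A
  set good : ℕ → ℤ × ℤ → Prop := fun t p =>
    (t : ℤ) ∣ r₂ * p.1 + r₁ * p.2 ∧ (r₂ * p.1 + r₁ * p.2 : ℤ) ≠ 0 with hgood
  set F : ℕ → ℤ × ℤ → ℝ := fun t p =>
    if good t p then 1 / |(p.1 : ℝ)| * (1 / |(p.2 : ℝ)|) else 0 with hF
  have hF0 : ∀ t p, 0 ≤ F t p := by
    intro t p
    simp only [hF]
    split_ifs <;> positivity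
  have hterm : ∀ t ∈ S, h / (a * (r₁ * s * t : ℕ)) * (h / (b * (r₂ * s * t : ℕ))) *
        ∑ y : ZMod q, (pairCount r₁ r₂ s t (a / h) (b / h) y : ℝ) ≤ ∑ p ∈ box, F t p := by
    intro t ht
    obtain ⟨⟨m, hm⟩, hA1, hA2⟩ := hS t ht
    have hprod : r₁ * r₂ * s * t ≠ 0 := fun h0 => hq0 (by rw [hm, h0, zero_mul])
    have h1 : (0 : ℝ) < (r₁ * s * t : ℕ) := by
      have : r₁ * s * t ≠ 0 := fun h0 => hprod (by linear_combination r₂ * h0)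
      exact_mod_cast Nat.pos_of_ne_zero this
    have h2 : (0 : ℝ) < (r₂ * s * t : ℕ) := by
      have : r₂ * s * t ≠ 0 := fun h0 => hprod (by linear_combination r₁ * h0)
      exact_mod_cast Nat.pos_of_ne_zero this
    set P : Finset (ZMod q × ZMod q) :=
      {p | IsNearPair r₁ r₂ s t (a / h) (b / h) p.1 p.2} with hP
    have hcount : ∑ y : ZMod q, (pairCount r₁ r₂ s t (a / h) (b / h) y : ℝ) = #P := by
      simp only [pairCount, card_filter, hP]
      push_cast
      rw [sum_comm, Fintype.sum_prod_type]
      refine sum_congr rfl fun x _ => ?_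
      exact (Equiv.subRight x).sum_comp
        (fun z => if IsNearPair r₁ r₂ s t (a / h) (b / h) x z then (1 : ℝ) else 0)
    have hex : ∀ p : ZMod q × ZMod q, ∃ w : ℤ × ℤ, p ∈ P →
        p.1 = ((r₂ * m : ℕ) : ZMod q) * w.1 ∧ p.2 = ((r₁ * m : ℕ) : ZMod q) * w.2 ∧
        w.1 ≠ 0 ∧ w.2 ≠ 0 ∧ |(w.1 : ℝ)| ≤ a / h * (r₁ * s * t : ℕ) ∧
        |(w.2 : ℝ)| ≤ b / h * (r₂ * s * t : ℕ) ∧ good t w := by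
      intro p
      by_cases hp : p ∈ P
      · obtain ⟨u, v, h3, h4, h5, h6, h7, h8, h9, h10⟩ :=
          ((mem_filter.mp hp).2).exists_coordinates hm
        exact ⟨(u, v), fun _ => ⟨h3, h4, h5, h6, h7, h8, h9, h10⟩⟩
      · exact ⟨0, fun h => absurd h hp⟩
    choose w hw using hex
    have hinj : Set.InjOn w P := by
      intro p hp p' hp' hpp
      have h3 := hw p hp
      have h4 := hw p' hp'
      ext
      · rw [h3.1, h4.1, hpp]
      · rw [h3.2.1, h4.2.1, hpp]
    rw [hcount, mul_comm, ← nsmul_eq_mul]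
    have h5 : #P • (h / (a * (r₁ * s * t : ℕ)) * (h / (b * (r₂ * s * t : ℕ)))) ≤
        ∑ p ∈ P, F t (w p) := by
      refine card_nsmul_le_sum P _ _ fun p hp => ?_
      obtain ⟨-, -, h5, h6, h7, h8, h9⟩ := hw p hp
      simp only [hF, if_pos h9]
      have h5' : 0 < |((w p).1 : ℝ)| := abs_pos.mpr (by exact_mod_cast h5)
      have h6' : 0 < |((w p).2 : ℝ)| := abs_pos.mpr (by exact_mod_cast h6)
      gcongr ?_ * ?_
      · rw [div_le_div_iff₀ (by positivity) h5']
        have : a / h * (r₁ * s * t : ℕ) * h = a * (r₁ * s * t : ℕ) := by field_simp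
        nlinarith
      · rw [div_le_div_iff₀ (by positivity) h6']
        have : b / h * (r₂ * s * t : ℕ) * h = b * (r₂ * s * t : ℕ) := by field_simp
        nlinarith
    refine h5.trans ?_
    rw [← sum_image hinj]
    refine sum_le_sum_of_subset_of_nonneg ?_ fun _ _ _ => hF0 _ _
    intro w' hw'
    obtain ⟨p, hp, rfl⟩ := mem_image.mp hw'
    obtain ⟨-, -, h5, h6, h7, h8, -⟩ := hw p hp
    have hle : ∀ {e : ℝ} {n : ℕ} {v : ℤ}, e ≤ h → n ≤ A → |(v : ℝ)| ≤ e / h * n → |v| ≤ A := by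
      intro e n v he hn hv
      have h9 : |(v : ℝ)| ≤ A := by
        refine hv.trans ?_
        have h10 : e / h ≤ 1 := by rw [div_le_one hh0]; exact he
        have h11 : (n : ℝ) ≤ A := by exact_mod_cast hn
        have h12 : (0 : ℝ) ≤ n := Nat.cast_nonneg n
        nlinarith
      exact_mod_cast h9
    rw [mem_product, mem_punctured, mem_punctured]
    exact ⟨⟨h5, hle hah hA1 h7⟩, ⟨h6, hle hbh hA2 h8⟩⟩
  refine (sum_le_sum hterm).trans ?_
  rw [sum_comm]
  have hbox : ∀ p ∈ box, ∑ t ∈ S, F t p ≤ B * (1 / |(p.1 : ℝ)| * (1 / |(p.2 : ℝ)|)) := by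
    intro p hp
    rw [mem_product, mem_punctured, mem_punctured] at hp
    have h1 : ∑ t ∈ S, F t p = (#{t ∈ S | good t p} : ℝ) * (1 / |(p.1 : ℝ)| * (1 / |(p.2 : ℝ)|)) := by
      rw [← sum_filter, sum_const, nsmul_eq_mul]
    rw [h1]
    refine mul_le_mul_of_nonneg_right ?_ (by positivity)
    rcases ({t ∈ S | good t p}).eq_empty_or_nonempty with h2 | ⟨t, ht⟩
    · rw [h2]
      simp only [card_empty, Nat.cast_zero]
      -- Nonnegativity of `B` comes from `N = 1`, which is allowed because `A` is positive.
      exact (Nat.cast_nonneg _).trans (hB 1 one_ne_zero (by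
        have : 0 < A := by
          have h3 := hp.1.2
          have h4 := Int.one_le_abs hp.1.1
          omega
        nlinarith))
    · rw [mem_filter] at ht
      obtain ⟨hm, hA1, hA2⟩ := hS t ht.1
      have hprod : r₁ * r₂ * s * t ≠ 0 := fun h0 => hq0 (by simpa [h0] using hm)
      have hst : 0 < s * t := Nat.pos_of_ne_zero fun h0 => hprod (by
        rw [mul_assoc, h0, mul_zero])
      have hr1 : r₁ ≤ A := (Nat.le_mul_of_pos_right r₁ hst).trans (by rw [← mul_assoc]; exact hA1)
      have hr2 : r₂ ≤ A := (Nat.le_mul_of_pos_right r₂ hst).trans (by rw [← mul_assoc]; exact hA2)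
      set N : ℤ := r₂ * p.1 + r₁ * p.2 with hN
      refine le_trans ?_ (hB N.natAbs (Int.natAbs_ne_zero.mpr ht.2.2) ?_)
      · rw [Nat.cast_le]
        refine card_le_card fun t' ht' => ?_
        rw [mem_filter] at ht'
        rw [Nat.mem_divisors]
        exact ⟨Int.natCast_dvd.mp ht'.2.1, Int.natAbs_ne_zero.mpr ht'.2.2⟩
      · have h3 : |N| ≤ 2 * (A : ℤ) ^ 2 := by
          refine (abs_add_le _ _).trans ?_
          rw [abs_mul, abs_mul, Nat.abs_cast, Nat.abs_cast]
          have h4 : (r₂ : ℤ) * |p.1| ≤ A * A := by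
            gcongr
            · exact hp.1.2
          have h5 : (r₁ : ℤ) * |p.2| ≤ A * A := by
            gcongr
            · exact hp.2.2
          nlinarith
        zify
        exact h3
  refine (sum_le_sum hbox).trans_eq ?_
  rw [← mul_sum, sum_product, sq, sum_mul_sum]

lemma sum_punctured_le (A : ℕ) :
    ∑ u ∈ punctured A, 1 / |(u : ℝ)| ≤ 2 * (1 + Real.log A) := by
  have h1 : punctured A = (Icc 1 A).image (fun n : ℕ => (n : ℤ)) ∪
      (Icc 1 A).image (fun n : ℕ => -(n : ℤ)) := by
    ext u
    rw [mem_punctured, mem_union, mem_image, mem_image]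
    constructor
    · rintro ⟨h0, h1⟩
      rcases le_total 0 u with h | h
      · left
        exact ⟨u.natAbs, by rw [mem_Icc]; rw [abs_of_nonneg h] at h1; omega, by omega⟩
      · right
        exact ⟨u.natAbs, by rw [mem_Icc]; rw [abs_of_nonpos h] at h1; omega, by omega⟩
    · rintro (⟨n, hn, rfl⟩ | ⟨n, hn, rfl⟩) <;> rw [mem_Icc] at hn
      · refine ⟨by omega, ?_⟩
        rw [Nat.abs_cast]; exact_mod_cast hn.2
      · refine ⟨by omega, ?_⟩
        rw [abs_neg, Nat.abs_cast]; exact_mod_cast hn.2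
  have h2 : ∑ n ∈ Icc 1 A, 1 / (n : ℝ) ≤ 1 + Real.log A := by
    have := harmonic_le_one_add_log A
    rw [harmonic_eq_sum_Icc] at this
    push_cast at this
    simpa [one_div] using this
  rw [h1]
  rw [sum_union, sum_image, sum_image]
  · simp only [Int.cast_neg, abs_neg, Int.cast_natCast, Nat.abs_cast]
    linarith
  · intro a _ b _ hab
    simpa using hab
  · intro a _ b _ hab
    simpa using hab
  · rw [disjoint_left]
    intro u hu hu'
    obtain ⟨a, ha, rfl⟩ := mem_image.mp hu
    obtain ⟨b, hb, hab⟩ := mem_image.mp hu'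
    rw [mem_Icc] at ha hb
    omega

end DivisorSwitching

/-! ### The divisor function is smaller than any power. -/

section DivisorBound

lemma succ_le_mul_rpow {ε : ℝ} (hε : 0 < ε) {p : ℕ} (hp : 2 ≤ p) (e : ℕ) :
    (e : ℝ) + 1 ≤ (1 + 1 / (ε * Real.log 2)) * ((p : ℝ) ^ e) ^ ε := by
  have hl : 0 < Real.log 2 := Real.log_pos (by norm_num)
  have h1 : 1 + e * (ε * Real.log 2) ≤ ((p : ℝ) ^ e) ^ ε := by
    have h2 : ((2 : ℝ) ^ e) ^ ε ≤ ((p : ℝ) ^ e) ^ ε := by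
      gcongr
      exact_mod_cast hp
    refine le_trans ?_ h2
    rw [Real.rpow_def_of_pos (by positivity), Real.log_pow]
    have := Real.add_one_le_exp (e * Real.log 2 * ε)
    linarith
  have hpos : 0 < ε * Real.log 2 := by positivity
  calc (e : ℝ) + 1 ≤ (1 + 1 / (ε * Real.log 2)) * (1 + e * (ε * Real.log 2)) := by
        have h3 : (1 + 1 / (ε * Real.log 2)) * (1 + e * (ε * Real.log 2)) =
          1 + e + e * (ε * Real.log 2) + 1 / (ε * Real.log 2) := by field_simp; ring
        rw [h3]
        have : 0 ≤ e * (ε * Real.log 2) := by positivity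
        have : 0 ≤ 1 / (ε * Real.log 2) := by positivity
        linarith
    _ ≤ _ := by gcongr

lemma succ_le_rpow {ε : ℝ} (hε : 0 < ε) {p : ℕ} (hp : (2 : ℝ) ^ (1 / ε) ≤ p) (e : ℕ) :
    (e : ℝ) + 1 ≤ ((p : ℝ) ^ e) ^ ε := by
  have h1 : (2 : ℝ) ≤ (p : ℝ) ^ ε := by
    calc (2 : ℝ) = ((2 : ℝ) ^ (1 / ε)) ^ ε := by
          rw [← Real.rpow_mul (by norm_num), one_div_mul_cancel hε.ne', Real.rpow_one]
      _ ≤ _ := by gcongr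
  have h2 : ((p : ℝ) ^ e) ^ ε = ((p : ℝ) ^ ε) ^ e := by
    rw [← Real.rpow_natCast, ← Real.rpow_mul (by positivity), mul_comm, Real.rpow_mul (by positivity),
      Real.rpow_natCast]
  rw [h2]
  have h3 : (e : ℝ) + 1 ≤ 2 ^ e := by exact_mod_cast Nat.lt_two_pow_self (n := e)
  exact h3.trans (by gcongr)

/-- The divisor bound. -/
theorem exists_card_divisors_le {ε : ℝ} (hε : 0 < ε) :
    ∃ C : ℝ, 0 < C ∧ ∀ n : ℕ, n ≠ 0 → (#n.divisors : ℝ) ≤ C * (n : ℝ) ^ ε := by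
  set c : ℝ := 1 + 1 / (ε * Real.log 2) with hc
  have hc1 : 1 ≤ c := by
    have : 0 < Real.log 2 := Real.log_pos (by norm_num)
    rw [hc]
    have : 0 ≤ 1 / (ε * Real.log 2) := by positivity
    linarith
  -- Primes from `2 ^ (1 / ε)` on satisfy `e + 1 ≤ 2 ^ e ≤ p ^ (e ε)` without a constant. At most
  -- `K` primes are smaller, and each costs a factor `c`.
  set K : ℕ := ⌈(2 : ℝ) ^ (1 / ε)⌉₊ with hK
  refine ⟨c ^ K, by positivity, fun n hn => ?_⟩
  rw [Nat.card_divisors hn]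
  have hn' : (n : ℝ) ^ ε = ∏ p ∈ n.primeFactors, ((p : ℝ) ^ n.factorization p) ^ ε := by
    conv_lhs => rw [← Nat.prod_factorization_pow_eq_self hn]
    rw [Finsupp.prod, Nat.support_factorization]
    push_cast
    rw [Real.finsetProd_rpow]
    intro p _; positivity
  push_cast
  have h1 : ∀ p ∈ n.primeFactors, (n.factorization p : ℝ) + 1 ≤
      (if p < K then c else 1) * ((p : ℝ) ^ n.factorization p) ^ ε := by
    intro p hp
    split_ifs with h
    · exact succ_le_mul_rpow hε (Nat.prime_of_mem_primeFactors hp).two_le _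
    · rw [one_mul]
      exact succ_le_rpow hε (Nat.ceil_le.mp (not_lt.mp h)) _
  refine (prod_le_prod (fun p _ => by positivity) h1).trans ?_
  rw [prod_mul_distrib, ← hn']
  gcongr
  rw [prod_ite, prod_const, prod_const_one, mul_one]
  apply pow_le_pow_right₀ hc1
  calc #{p ∈ n.primeFactors | p < K} ≤ #(range K) :=
        card_le_card fun p hp => mem_range.mpr (mem_filter.mp hp).2
    _ = K := card_range K

end DivisorBound

/-! ### Minkowski's inequality, and `ℓ²` against `ℓ¹`. -/

section Euclidean

lemma sqrt_sum_sq_sum_le {α ι : Type*} (s : Finset α) (I : Finset ι) (g : ι → α → ℝ) :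
    √(∑ y ∈ s, (∑ i ∈ I, g i y) ^ 2) ≤ ∑ i ∈ I, √(∑ y ∈ s, g i y ^ 2) := by
  have h1 : ∀ f : α → ℝ, √(∑ y ∈ s, f y ^ 2) =
      ‖(WithLp.toLp 2 (fun y : s => f y) : EuclideanSpace ℝ s)‖ := by
    intro f
    rw [EuclideanSpace.norm_eq]
    congr 1
    rw [← sum_coe_sort]
    simp
  rw [h1, sum_congr rfl fun i _ => h1 (g i)]
  refine le_trans (le_of_eq ?_) (norm_sum_le _ _)
  congr 1
  ext y
  simp

lemma sqrt_sum_sq_le_sum {α : Type*} (s : Finset α) (f : α → ℝ) (hf : ∀ y ∈ s, 0 ≤ f y) :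
    √(∑ y ∈ s, f y ^ 2) ≤ ∑ y ∈ s, f y := by
  apply Real.sqrt_le_iff.mpr ⟨sum_nonneg hf, ?_⟩
  rw [sq, sum_mul]
  refine sum_le_sum fun y hy => ?_
  rw [sq]
  exact mul_le_mul_of_nonneg_left (single_le_sum hf hy) (hf y hy)

end Euclidean

/-! ### The orders of two classes and of their sum. -/

section Parametrization

/-- With `g = gcd a b`, write `a = r₁ g` and `b = r₂ g`. By squarefreeness `r₁`, `r₂`, `g` are
pairwise coprime. A prime of `r₁` does not divide `b`, so it must divide `c`, and likewise for `r₂`;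
only the part `s = gcd c g` is free. -/
lemma exists_squarefree_parametrization {q a b c : ℕ} (hq : Squarefree q) (ha : a ∣ q)
    (hb : b ∣ q) (hc : c ∣ Nat.lcm a b) (ha' : a ∣ Nat.lcm b c) (hb' : b ∣ Nat.lcm a c) :
    ∃ r₁ r₂ s t : ℕ, a = r₁ * s * t ∧ b = r₂ * s * t ∧ c = r₁ * r₂ * s ∧ Nat.gcd a b = s * t ∧
      r₁ * r₂ * s * t ∣ q := by
  have ha0 : a ≠ 0 := fun h => hq.ne_zero (by simpa [h] using ha)
  have hg0 : 0 < Nat.gcd a b := Nat.gcd_pos_of_pos_left _ (Nat.pos_of_ne_zero ha0)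
  obtain ⟨r₁, r₂, hr, h1, h2⟩ := Nat.exists_coprime a b
  set g := Nat.gcd a b with hg
  have hlcm : Nat.lcm a b = r₁ * r₂ * g := by
    have h3 : g * Nat.lcm a b = a * b := Nat.gcd_mul_lcm a b
    apply Nat.eq_of_mul_eq_mul_left hg0
    rw [h3]
    conv_lhs => rw [h1, h2]
    ring
  have hsq : Squarefree (r₁ * r₂ * g) := by
    rw [← hlcm]
    exact hq.squarefree_of_dvd (Nat.lcm_dvd ha hb)
  have hr1g : r₁.Coprime g := by
    refine Nat.coprime_of_squarefree_mul (hsq.squarefree_of_dvd ⟨r₂, by ring⟩)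
  have hr2g : r₂.Coprime g := by
    refine Nat.coprime_of_squarefree_mul (hsq.squarefree_of_dvd ⟨r₁, by ring⟩)
  have hr1c : r₁ ∣ c := by
    have h3 : r₁ ∣ b * c := (Dvd.intro _ h1.symm).trans (ha'.trans (Nat.lcm_dvd_mul b c))
    have h4 : r₁.Coprime b := by rw [h2]; exact Nat.Coprime.mul_right hr hr1g
    exact h4.dvd_of_dvd_mul_left h3
  have hr2c : r₂ ∣ c := by
    have h3 : r₂ ∣ a * c := (Dvd.intro _ h2.symm).trans (hb'.trans (Nat.lcm_dvd_mul a c))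
    have h4 : r₂.Coprime a := by rw [h1]; exact Nat.Coprime.mul_right hr.symm hr2g
    exact h4.dvd_of_dvd_mul_left h3
  set s := Nat.gcd c g with hs
  obtain ⟨t, ht⟩ : s ∣ g := Nat.gcd_dvd_right c g
  have hcs : c = r₁ * r₂ * s := by
    have h3 : Nat.gcd c (r₁ * r₂ * g) = Nat.gcd c (r₁ * r₂) * Nat.gcd c g :=
      Nat.Coprime.gcd_mul c (Nat.Coprime.mul_left hr1g hr2g)
    rw [Nat.gcd_eq_left (hlcm ▸ hc), Nat.gcd_eq_right (hr.mul_dvd_of_dvd_of_dvd hr1c hr2c)] at h3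
    exact h3
  refine ⟨r₁, r₂, s, t, ?_, ?_, hcs, ht, ?_⟩
  · rw [mul_assoc, ← ht]; exact h1
  · rw [mul_assoc, ← ht]; exact h2
  · rw [mul_assoc, ← ht, ← hlcm]
    exact Nat.lcm_dvd ha hb

lemma addOrderOf_add_dvd_lcm' {q : ℕ} (x z : ZMod q) :
    addOrderOf (x + z) ∣ Nat.lcm (addOrderOf x) (addOrderOf z) := by
  rw [addOrderOf_dvd_iff_nsmul_eq_zero, nsmul_add,
    addOrderOf_dvd_iff_nsmul_eq_zero.mp (Nat.dvd_lcm_left _ _),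
    addOrderOf_dvd_iff_nsmul_eq_zero.mp (Nat.dvd_lcm_right _ _), add_zero]

lemma exists_order_parametrization {q : ℕ} (hq : Squarefree q) (x z : ZMod q) :
    ∃ r₁ r₂ s t : ℕ, addOrderOf x = r₁ * s * t ∧ addOrderOf z = r₂ * s * t ∧
      addOrderOf (x + z) = r₁ * r₂ * s ∧ Nat.gcd (addOrderOf x) (addOrderOf z) = s * t ∧
      r₁ * r₂ * s * t ∣ q := by
  have : NeZero q := ⟨hq.ne_zero⟩
  refine exists_squarefree_parametrization hq (addOrderOf_dvd_modulus x) (addOrderOf_dvd_modulus z)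
    (addOrderOf_add_dvd_lcm' x z) ?_ ?_
  · have := addOrderOf_add_dvd_lcm' (-z) (x + z)
    simpa using this
  · have := addOrderOf_add_dvd_lcm' (-x) (x + z)
    simpa using this

end Parametrization

/-! ### The convolution of two majorants and its decomposition. -/

section Merged

variable {q : ℕ} [NeZero q]

/-- The convolution of two majorants over pairs whose orders have a large common divisor, away
from zero. -/
noncomputable def mergedMajorant (D h : ℝ) (y : ZMod q) : ℝ :=
  if y = 0 then 0 else ∑ x : ZMod q,
    if D ≤ (Nat.gcd (addOrderOf x) (addOrderOf (y - x)) : ℕ) then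
      majorant h x * majorant h (y - x) else 0

lemma mergedMajorant_nonneg {D h : ℝ} (hh : 0 ≤ h) (y : ZMod q) : 0 ≤ mergedMajorant D h y := by
  unfold mergedMajorant
  split_ifs
  · exact le_rfl
  · refine sum_nonneg fun x _ => ?_
    split_ifs
    · exact mul_nonneg (majorant_nonneg hh _) (majorant_nonneg hh _)
    · exact le_rfl

/-- The contribution of near pairs of given orders, at scales `a` and `b`. -/
noncomputable def pairTerm (h a b : ℝ) (r₁ r₂ s t : ℕ) (y : ZMod q) : ℝ :=
  h / a * (h / b) / (Nat.totient (r₁ * s * t) * Nat.totient (r₂ * s * t)) *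
    pairCount r₁ r₂ s t (a / h) (b / h) y

open Classical in
/-- The divisors `t` of `q` coprime to `q₀` with `s t ≥ D`. -/
noncomputable def cofactors (q : ℕ) (D : ℝ) (q₀ s : ℕ) : Finset ℕ :=
  {t ∈ q.divisors | q₀ * t ∣ q ∧ D ≤ (s * t : ℕ)}

/-- Each summand `x` is sorted by the dyadic scales of `x` and `y - x` and by the parametrization of
the three orders. All terms on the right are nonnegative, so the one belonging to `x` is enough. -/
lemma mergedMajorant_le_sum (hq : Squarefree q) {D h : ℝ} (hh : 1 ≤ h) (y : ZMod q) :
    mergedMajorant D h y ≤ ∑ i ∈ range (scaleCount h), ∑ j ∈ range (scaleCount h),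
      ∑ r ∈ Nat.finMulAntidiag 3 (addOrderOf y), ∑ t ∈ cofactors q D (addOrderOf y) (r 2),
        pairTerm h (2 ^ i) (2 ^ j) (r 0) (r 1) (r 2) t y := by
  classical
  have hh0 : 0 < h := by linarith
  set coef : ℕ → ℕ → (Fin 3 → ℕ) → ℕ → ℝ := fun i j r t => h / 2 ^ i * (h / 2 ^ j) /
    (Nat.totient (r 0 * r 2 * t) * Nat.totient (r 1 * r 2 * t)) with hcoef
  have hcoef0 : ∀ i j r t, 0 ≤ coef i j r t := by
    intro i j r t; simp only [hcoef]; positivity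
  set ind : ℕ → ℕ → (Fin 3 → ℕ) → ℕ → ZMod q → ℝ := fun i j r t x =>
    if IsNearPair (r 0) (r 1) (r 2) t (2 ^ i / h) (2 ^ j / h) x (y - x) then coef i j r t else 0
    with hind
  have hind0 : ∀ i j r t x, 0 ≤ ind i j r t x := by
    intro i j r t x; simp only [hind]; split_ifs
    · exact hcoef0 _ _ _ _
    · exact le_rfl
  have hterm : ∀ i j (r : Fin 3 → ℕ) t,
      pairTerm h (2 ^ i) (2 ^ j) (r 0) (r 1) (r 2) t y = ∑ x, ind i j r t x := by
    intro i j r t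
    simp only [pairTerm, pairCount, card_filter, hind, hcoef]
    push_cast
    rw [mul_sum]
    refine sum_congr rfl fun x _ => ?_
    split_ifs <;> simp
  rw [mergedMajorant]
  simp_rw [hterm]
  split_ifs with hy
  · exact sum_nonneg fun i _ => sum_nonneg fun j _ => sum_nonneg fun r _ => sum_nonneg fun t _ =>
      sum_nonneg fun x _ => hind0 _ _ _ _ _
  have hswap : ∑ i ∈ range (scaleCount h), ∑ j ∈ range (scaleCount h),
      ∑ r ∈ Nat.finMulAntidiag 3 (addOrderOf y), ∑ t ∈ cofactors q D (addOrderOf y) (r 2),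
        ∑ x, ind i j r t x = ∑ x, ∑ i ∈ range (scaleCount h), ∑ j ∈ range (scaleCount h),
      ∑ r ∈ Nat.finMulAntidiag 3 (addOrderOf y), ∑ t ∈ cofactors q D (addOrderOf y) (r 2),
        ind i j r t x := by
    simp_rw [sum_comm (γ := ZMod q)]
  rw [hswap]
  refine sum_le_sum fun x _ => ?_
  have hnn3 : ∀ i j, 0 ≤ ∑ r ∈ Nat.finMulAntidiag 3 (addOrderOf y),
      ∑ t ∈ cofactors q D (addOrderOf y) (r 2), ind i j r t x := fun i j =>
    sum_nonneg fun r _ => sum_nonneg fun t _ => hind0 _ _ _ _ _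
  have hrhs : 0 ≤ ∑ i ∈ range (scaleCount h), ∑ j ∈ range (scaleCount h),
      ∑ r ∈ Nat.finMulAntidiag 3 (addOrderOf y), ∑ t ∈ cofactors q D (addOrderOf y) (r 2),
        ind i j r t x := sum_nonneg fun i _ => sum_nonneg fun j _ => hnn3 i j
  split_ifs with hD
  swap
  · exact hrhs
  rcases eq_or_ne x 0 with hx | hx
  · rw [hx, majorant_zero, zero_mul]; rw [hx] at hrhs; exact hrhs
  rcases eq_or_ne (y - x) 0 with hz | hz
  · rw [hz, majorant_zero, mul_zero]; exact hrhs
  obtain ⟨r₁, r₂, s, t, h1, h2, h3, h4, h5⟩ := exists_order_parametrization hq x (y - x)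
  obtain ⟨i, hi, hi1, hi2⟩ := exists_scale hh hx
  obtain ⟨j, hj, hj1, hj2⟩ := exists_scale hh hz
  rw [add_sub_cancel] at h3
  refine le_trans ?_ (single_le_sum (fun i _ => sum_nonneg fun j _ => hnn3 i j) (mem_range.mpr hi))
  refine le_trans ?_ (single_le_sum (fun j _ => hnn3 i j) (mem_range.mpr hj))
  have hmem : ![r₁, r₂, s] ∈ Nat.finMulAntidiag 3 (addOrderOf y) := by
    rw [Nat.mem_finMulAntidiag]
    refine ⟨?_, (addOrderOf_pos y).ne'⟩
    simp [Fin.prod_univ_three, h3]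
  refine le_trans ?_ (single_le_sum (fun r _ => sum_nonneg fun t _ => hind0 i j r t x) hmem)
  have htmem : t ∈ cofactors q D (addOrderOf y) (![r₁, r₂, s] 2) := by
    rw [cofactors, mem_filter, Nat.mem_divisors]
    refine ⟨⟨(Dvd.intro_left _ rfl).trans h5, NeZero.ne q⟩, by rw [h3]; exact h5, ?_⟩
    rw [h4] at hD
    exact hD
  refine le_trans ?_ (single_le_sum (fun t _ => hind0 i j _ t x) htmem)
  have hpair : IsNearPair r₁ r₂ s t (2 ^ i / h) (2 ^ j / h) x (y - x) :=
    ⟨hx, hz, by rwa [add_sub_cancel], h1, h2, by rwa [add_sub_cancel], hi1, hj1⟩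
  simp only [hind, hcoef]
  rw [if_pos (by exact hpair), majorant, if_neg hx, majorant, if_neg hz, h1, h2, div_mul_div_comm]
  have := peak_nonneg hh0.le (y - x)
  exact div_le_div_of_nonneg_right (mul_le_mul hi2 hj2 this (by positivity)) (by positivity)

lemma pairTerm_nonneg {h a b : ℝ} (hh : 0 ≤ h) (ha : 0 ≤ a) (hb : 0 ≤ b) (r₁ r₂ s t : ℕ)
    (y : ZMod q) : 0 ≤ pairTerm h a b r₁ r₂ s t y := by
  unfold pairTerm; positivity

lemma coprime_of_mul_dvd (hq : Squarefree q) {r₁ r₂ s t : ℕ} (hd : r₁ * r₂ * s * t ∣ q) :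
    r₁.Coprime r₂ ∧ t.Coprime r₁ ∧ t.Coprime r₂ := by
  have h := hq.squarefree_of_dvd hd
  exact ⟨Nat.coprime_of_squarefree_mul (h.squarefree_of_dvd ⟨s * t, by ring⟩),
    Nat.coprime_of_squarefree_mul (h.squarefree_of_dvd ⟨r₂ * s, by ring⟩),
    Nat.coprime_of_squarefree_mul (h.squarefree_of_dvd ⟨r₁ * s, by ring⟩)⟩

lemma pos_of_mul_dvd {r₁ r₂ s t : ℕ} (hd : r₁ * r₂ * s * t ∣ q) :
    0 < r₁ ∧ 0 < r₂ ∧ 0 < s ∧ 0 < t := by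
  have h0 : r₁ * r₂ * s * t ≠ 0 := fun h => NeZero.ne q (by simpa [h] using hd)
  simp only [ne_eq, mul_eq_zero, not_or] at h0
  omega

/-- The mean square of a pair term with at least one large order. -/
lemma sqrt_order_mul_sum_pairTerm_sq_le (hq : Squarefree q) {r₁ r₂ s t : ℕ} {h a b Y : ℝ}
    (hh : 1 ≤ h) (ha : 1 ≤ a) (hb : 1 ≤ b) (hd : r₁ * r₂ * s * t ∣ q) (hY : 1 ≤ Y)
    (hTd : Y ^ 4 ≤ (s * t : ℕ)) (hTh : Y ^ 4 ≤ h)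
    (hbig : h * Y ^ 4 < (r₁ * s * t : ℕ) * s ∨ h * Y ^ 4 < (r₂ * s * t : ℕ) * s)
    (S : Finset (ZMod q)) :
    √((r₁ * r₂ * s : ℕ) * ∑ y ∈ S, pairTerm h a b r₁ r₂ s t y ^ 2) ≤
      6 * h * totientRatio q ^ 2 / Y ^ 2 * (t : ℝ)⁻¹ := by
  obtain ⟨hr, ht₁, ht₂⟩ := coprime_of_mul_dvd hq hd
  obtain ⟨hr1, hr2, hs, ht⟩ := pos_of_mul_dvd hd
  have hh0 : 0 < h := by linarith
  have hY0 : 0 < Y := by linarith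
  -- The threshold is `T = Y ^ 4`; after the square root it saves `Y ^ 2`. The factor `(t : ℝ)⁻¹`
  -- appears when totients are replaced by the orders themselves.
  have key := sum_pairCount_sq_le (q := q) hh ha hb hr ht₁ ht₂ hd (by positivity) hTd hTh hbig
  have hq1 : r₁ * s * t ∣ q := (Dvd.intro r₂ (by ring)).trans hd
  have hq2 : r₂ * s * t ∣ q := (Dvd.intro r₁ (by ring)).trans hd
  have hR1 := totientRatio_le_of_dvd hq hq1
  have hR2 := totientRatio_le_of_dvd hq hq2
  have hφ1 : (0 : ℝ) < Nat.totient (r₁ * s * t) := by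
    exact_mod_cast Nat.totient_pos.mpr (by positivity)
  have hφ2 : (0 : ℝ) < Nat.totient (r₂ * s * t) := by
    exact_mod_cast Nat.totient_pos.mpr (by positivity)
  have hRR : totientRatio (r₁ * s * t) * totientRatio (r₂ * s * t) ≤ totientRatio q ^ 2 := by
    have h1 : 0 ≤ totientRatio (r₁ * s * t) := by unfold totientRatio; positivity
    have h2 : 0 ≤ totientRatio (r₂ * s * t) := by unfold totientRatio; positivity
    rw [sq]
    gcongr
    exact h1.trans hR1
  have hQ0 : 0 ≤ totientRatio q := by unfold totientRatio; positivity
  rw [Real.sqrt_le_left (by positivity)]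
  set M₂ : ℝ := ∑ y : ZMod q, (pairCount r₁ r₂ s t (a / h) (b / h) y : ℝ) ^ 2
  set f₁ : ℝ := (Nat.totient (r₁ * s * t) : ℝ)
  set f₂ : ℝ := (Nat.totient (r₂ * s * t) : ℝ)
  have h1 : ∑ y ∈ S, pairTerm h a b r₁ r₂ s t y ^ 2 ≤ (h / a * (h / b) / (f₁ * f₂)) ^ 2 * M₂ := by
    rw [mul_sum]
    refine (sum_le_sum_of_subset_of_nonneg (subset_univ S) fun _ _ _ => sq_nonneg _).trans_eq ?_
    exact sum_congr rfl fun y _ => by rw [pairTerm, mul_pow]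
  have h2 : M₂ ≤ 36 * (a * b) ^ 2 * (r₁ * r₂ * s : ℕ) * (s * t : ℕ) ^ 2 / (h ^ 2 * Y ^ 4) := by
    rw [le_div_iff₀ (by positivity)]
    exact key
  have ht' : (0 : ℝ) < t := by exact_mod_cast ht
  calc ((r₁ * r₂ * s : ℕ) : ℝ) * ∑ y ∈ S, pairTerm h a b r₁ r₂ s t y ^ 2
      ≤ ((r₁ * r₂ * s : ℕ) : ℝ) * ((h / a * (h / b) / (f₁ * f₂)) ^ 2 *
        (36 * (a * b) ^ 2 * (r₁ * r₂ * s : ℕ) * (s * t : ℕ) ^ 2 / (h ^ 2 * Y ^ 4))) := by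
        gcongr
        exact h1.trans (by gcongr)
    _ = 36 * h ^ 2 / Y ^ 4 * (t : ℝ)⁻¹ ^ 2 *
        (totientRatio (r₁ * s * t) * totientRatio (r₂ * s * t)) ^ 2 := by
        unfold totientRatio
        push_cast
        field_simp
        rfl
    _ ≤ 36 * h ^ 2 / Y ^ 4 * (t : ℝ)⁻¹ ^ 2 * (totientRatio q ^ 2) ^ 2 := by
        have h1 : 0 ≤ totientRatio (r₁ * s * t) := by unfold totientRatio; positivity
        have h2 : 0 ≤ totientRatio (r₂ * s * t) := by unfold totientRatio; positivity
        gcongr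
    _ = (6 * h * totientRatio q ^ 2 / Y ^ 2 * (t : ℝ)⁻¹) ^ 2 := by
        field_simp
        ring

/-- The total mass of the pair terms with both orders small. -/
lemma sum_pairTerm_le (hq : Squarefree q) {r₁ r₂ s : ℕ} {h a b : ℝ} (hh : 1 ≤ h) (ha : 1 ≤ a)
    (hb : 1 ≤ b) (hah : a ≤ h) (hbh : b ≤ h) (A : ℕ) {B : ℝ}
    (hB0 : 0 ≤ B) (hB : ∀ N : ℕ, N ≠ 0 → N ≤ 2 * A ^ 2 → (#N.divisors : ℝ) ≤ B) (S : Finset ℕ)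
    (hS : ∀ t ∈ S, r₁ * r₂ * s * t ∣ q ∧ r₁ * s * t ≤ A ∧ r₂ * s * t ≤ A) :
    ∑ t ∈ S, ∑ y : ZMod q, pairTerm h a b r₁ r₂ s t y ≤
      totientRatio q ^ 2 * (B * (2 * (1 + Real.log A)) ^ 2) := by
  have hQ0 : 0 ≤ totientRatio q := by unfold totientRatio; positivity
  have h1 := sum_weighted_pairCount_le (q := q) hh ha hb hah hbh A B hB S hS
  have h2 : (∑ u ∈ punctured A, 1 / |(u : ℝ)|) ^ 2 ≤ (2 * (1 + Real.log A)) ^ 2 :=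
    pow_le_pow_left₀ (sum_nonneg fun _ _ => by positivity) (sum_punctured_le A) 2
  refine le_trans ?_ (mul_le_mul_of_nonneg_left (h1.trans (by gcongr)) (sq_nonneg _))
  rw [mul_sum]
  refine sum_le_sum fun t ht => ?_
  obtain ⟨hd, -, -⟩ := hS t ht
  obtain ⟨hr1, hr2, hs, ht⟩ := pos_of_mul_dvd hd
  have hR1 := totientRatio_le_of_dvd hq (show r₁ * s * t ∣ q from (Dvd.intro r₂ (by ring)).trans hd)
  have hR2 := totientRatio_le_of_dvd hq (show r₂ * s * t ∣ q from (Dvd.intro r₁ (by ring)).trans hd)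
  have hn1 : (0 : ℝ) < (r₁ * s * t : ℕ) := by exact_mod_cast (by positivity : 0 < r₁ * s * t)
  have hn2 : (0 : ℝ) < (r₂ * s * t : ℕ) := by exact_mod_cast (by positivity : 0 < r₂ * s * t)
  have hRR : totientRatio (r₁ * s * t) * totientRatio (r₂ * s * t) ≤ totientRatio q ^ 2 := by
    have h1 : 0 ≤ totientRatio (r₁ * s * t) := by unfold totientRatio; positivity
    have h2 : 0 ≤ totientRatio (r₂ * s * t) := by unfold totientRatio; positivity
    rw [sq]
    gcongr
  simp only [pairTerm]
  rw [← mul_sum, ← mul_assoc]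
  refine mul_le_mul_of_nonneg_right ?_ (sum_nonneg fun _ _ => Nat.cast_nonneg _)
  calc h / a * (h / b) / (Nat.totient (r₁ * s * t) * Nat.totient (r₂ * s * t))
      = totientRatio (r₁ * s * t) * totientRatio (r₂ * s * t) *
        (h / (a * (r₁ * s * t : ℕ)) * (h / (b * (r₂ * s * t : ℕ)))) := by
        unfold totientRatio
        field_simp
    _ ≤ _ := by gcongr

end Merged

/-! ### Mean square of the merged majorant. -/

section MergedNorm

variable {q : ℕ} [NeZero q]

/-- For fixed `r₁, r₂, s` and fixed scales, the sum of the pair terms over all cofactors. -/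
lemma sqrt_order_mul_sum_cofactors_sq_le (hq : Squarefree q) {h Y a b : ℝ} (hh : 1 ≤ h)
    (hY : 1 ≤ Y) (hTh : Y ^ 4 ≤ h) (ha : 1 ≤ a) (hb : 1 ≤ b) (hah : a ≤ h) (hbh : b ≤ h) {B : ℝ}
    (hB0 : 0 ≤ B)
    (hB : ∀ N : ℕ, N ≠ 0 → N ≤ 2 * ⌊h ^ 2⌋₊ ^ 2 → (#N.divisors : ℝ) ≤ B) {q₀ r₁ r₂ s : ℕ}
    (hq₀ : q₀ = r₁ * r₂ * s) (S : Finset (ZMod q)) :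
    √(q₀ * ∑ y ∈ S, (∑ t ∈ cofactors q (Y ^ 7) q₀ s, pairTerm h a b r₁ r₂ s t y) ^ 2) ≤
      h * totientRatio q ^ 3 / Y ^ 2 * (6 + B * (2 * (1 + Real.log ⌊h ^ 2⌋₊)) ^ 2) := by
  classical
  have hh0 : 0 < h := by linarith
  have hY0 : 0 < Y := by linarith
  have hQ1 : 1 ≤ totientRatio q := one_le_totientRatio (NeZero.ne q)
  have hQ0 : 0 ≤ totientRatio q := by linarith
  set T := cofactors q (Y ^ 7) q₀ s with hT
  have hTmem : ∀ t ∈ T, t ∈ q.divisors ∧ r₁ * r₂ * s * t ∣ q ∧ Y ^ 7 ≤ (s * t : ℕ) := by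
    intro t ht
    rw [hT, cofactors, mem_filter, hq₀] at ht
    exact ⟨ht.1, ht.2.1, ht.2.2⟩
  -- Cofactors that are not bad are bounded one by one in `ℓ²` and summed through `∑ 1 / t`. The bad
  -- ones are too many for this, and their total mass is bounded in `ℓ¹` instead.
  set bad : ℕ → Prop := fun t => (r₁ * s * t : ℕ) * (s : ℝ) ≤ h * Y ^ 4 ∧
    (r₂ * s * t : ℕ) * (s : ℝ) ≤ h * Y ^ 4 with hbad
  set g : ℕ → ZMod q → ℝ := fun t y => pairTerm h a b r₁ r₂ s t y with hg
  have hg0 : ∀ t y, 0 ≤ g t y := fun t y =>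
    pairTerm_nonneg hh0.le (by linarith) (by linarith) _ _ _ _ _
  have htri : √(q₀ * ∑ y ∈ S, (∑ t ∈ T, g t y) ^ 2) ≤
      ∑ t ∈ T with ¬ bad t, √(q₀ * ∑ y ∈ S, g t y ^ 2) +
        √(q₀ : ℝ) * ∑ t ∈ T with bad t, ∑ y : ZMod q, g t y := by
    have h1 : ∀ y, ∑ t ∈ T, g t y =
        ∑ i ∈ (univ : Finset Bool), if i then ∑ t ∈ T with bad t, g t y else
          ∑ t ∈ T with ¬ bad t, g t y := by
      intro y
      rw [← sum_filter_add_sum_filter_not T bad]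
      simp
    have h2 := sqrt_sum_sq_sum_le S (univ : Finset Bool) (fun i y =>
      if i then ∑ t ∈ T with bad t, g t y else ∑ t ∈ T with ¬ bad t, g t y)
    simp only [← h1, Fintype.sum_bool, if_true, Bool.false_eq_true, if_false] at h2
    rw [Real.sqrt_mul (Nat.cast_nonneg _)]
    simp_rw [Real.sqrt_mul (Nat.cast_nonneg q₀)]
    rw [← mul_sum, ← mul_add, add_comm]
    refine mul_le_mul_of_nonneg_left (h2.trans (add_le_add ?_ ?_)) (Real.sqrt_nonneg _)
    · refine (sqrt_sum_sq_le_sum S _ fun y _ => sum_nonneg fun t _ => hg0 t y).trans ?_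
      rw [sum_comm]
      exact sum_le_sum fun t _ =>
        sum_le_sum_of_subset_of_nonneg (subset_univ S) fun y _ _ => hg0 t y
    · exact sqrt_sum_sq_sum_le _ _ _
  refine htri.trans ?_
  have hgood : ∑ t ∈ T with ¬ bad t, √(q₀ * ∑ y ∈ S, g t y ^ 2) ≤
      6 * h * totientRatio q ^ 3 / Y ^ 2 := by
    calc ∑ t ∈ T with ¬ bad t, √(q₀ * ∑ y ∈ S, g t y ^ 2)
        ≤ ∑ t ∈ T with ¬ bad t, 6 * h * totientRatio q ^ 2 / Y ^ 2 * (t : ℝ)⁻¹ := by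
          refine sum_le_sum fun t ht => ?_
          obtain ⟨htT, hnb⟩ := mem_filter.mp ht
          obtain ⟨-, hd, hD⟩ := hTmem t htT
          rw [hq₀]
          refine sqrt_order_mul_sum_pairTerm_sq_le hq hh ha hb hd hY ?_ hTh ?_ S
          · exact (pow_le_pow_right₀ hY (by norm_num)).trans hD
          · simp only [hbad, not_and_or, not_le] at hnb
            exact hnb
      _ ≤ ∑ t ∈ q.divisors, 6 * h * totientRatio q ^ 2 / Y ^ 2 * (t : ℝ)⁻¹ := by
          refine sum_le_sum_of_subset_of_nonneg ?_ fun _ _ _ => by positivity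
          intro t ht
          exact (hTmem t (mem_filter.mp ht).1).1
      _ ≤ 6 * h * totientRatio q ^ 2 / Y ^ 2 * totientRatio q := by
          rw [← mul_sum]
          gcongr
          exact sum_divisors_inv_le hq
      _ = _ := by ring
  have hbad' : √(q₀ : ℝ) * ∑ t ∈ T with bad t, ∑ y : ZMod q, g t y ≤
      h / Y ^ 3 * (totientRatio q ^ 2 * (B * (2 * (1 + Real.log ⌊h ^ 2⌋₊)) ^ 2)) := by
    rcases (T.filter bad).eq_empty_or_nonempty with hemp | ⟨t₀, ht₀⟩
    · rw [hemp, sum_empty, mul_zero]; positivity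
    -- Multiplying the two bad inequalities gives `q₀ (s t₀) ^ 2 ≤ (h Y ^ 4) ^ 2`. With `s t₀ ≥ Y ^
    -- 7` this leaves `q₀ ≤ h ^ 2 / Y ^ 6`, which pays for passing to `ℓ¹`.
    have hq₀le : √(q₀ : ℝ) ≤ h / Y ^ 3 := by
      obtain ⟨htT, hb1, hb2⟩ := mem_filter.mp ht₀
      obtain ⟨-, hd, hD⟩ := hTmem t₀ htT
      obtain ⟨-, -, hs, -⟩ := pos_of_mul_dvd hd
      have hs1 : (1 : ℝ) ≤ s := by exact_mod_cast hs
      rw [Real.sqrt_le_left (by positivity), div_pow, le_div_iff₀ (by positivity)]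
      have h1 : (q₀ : ℝ) * (s * t₀ : ℕ) ^ 2 ≤ (h * Y ^ 4) ^ 2 := by
        have h2 : (q₀ : ℝ) * (s * t₀ : ℕ) ^ 2 * s =
            (r₁ * s * t₀ : ℕ) * (s : ℝ) * ((r₂ * s * t₀ : ℕ) * (s : ℝ)) := by
          rw [hq₀]; push_cast; ring
        have h3 : (q₀ : ℝ) * (s * t₀ : ℕ) ^ 2 ≤ (q₀ : ℝ) * (s * t₀ : ℕ) ^ 2 * s :=
          le_mul_of_one_le_right (by positivity) hs1
        refine h3.trans ?_
        rw [h2, sq]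
        gcongr
      have h4 : (q₀ : ℝ) * (Y ^ 7) ^ 2 ≤ (h * Y ^ 4) ^ 2 := by
        refine le_trans ?_ h1
        gcongr
      have h5 : (q₀ : ℝ) * (Y ^ 3) ^ 2 * Y ^ 8 ≤ h ^ 2 * Y ^ 8 := by linarith
      exact le_of_mul_le_mul_right h5 (by positivity)
    refine mul_le_mul hq₀le ?_ (sum_nonneg fun t _ => sum_nonneg fun y _ => hg0 t y) (by positivity)
    refine sum_pairTerm_le hq hh ha hb hah hbh ⌊h ^ 2⌋₊ hB0 hB _ fun t ht => ?_
    obtain ⟨htT, hb1, hb2⟩ := mem_filter.mp ht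
    obtain ⟨-, hd, -⟩ := hTmem t htT
    obtain ⟨-, -, hs, -⟩ := pos_of_mul_dvd hd
    have hs1 : (1 : ℝ) ≤ s := by exact_mod_cast hs
    have hle : ∀ n : ℕ, (n : ℝ) * s ≤ h * Y ^ 4 → n ≤ ⌊h ^ 2⌋₊ := by
      intro n hn
      apply Nat.le_floor
      have h1 : (n : ℝ) ≤ n * s := le_mul_of_one_le_right (Nat.cast_nonneg n) hs1
      nlinarith
    exact ⟨hd, hle _ hb1, hle _ hb2⟩
  refine (add_le_add hgood hbad').trans ?_
  have h1 : h / Y ^ 3 * (totientRatio q ^ 2 * (B * (2 * (1 + Real.log ⌊h ^ 2⌋₊)) ^ 2)) ≤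
      h / Y ^ 2 * (totientRatio q ^ 3 * (B * (2 * (1 + Real.log ⌊h ^ 2⌋₊)) ^ 2)) := by
    have h2 : Y ^ 2 ≤ Y ^ 3 := pow_le_pow_right₀ hY (by norm_num)
    have h3 : totientRatio q ^ 2 ≤ totientRatio q ^ 3 := pow_le_pow_right₀ hQ1 (by norm_num)
    gcongr
  refine (add_le_add_right h1 _).trans_eq ?_
  ring

/-- The mean square of the merged majorant over elements of given order. -/
lemma order_mul_sum_mergedMajorant_sq_le (hq : Squarefree q) {h Y : ℝ} (hh : 1 ≤ h)
    (hY : 1 ≤ Y) (hTh : Y ^ 4 ≤ h) {B : ℝ} (hB0 : 0 ≤ B)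
    (hB : ∀ N : ℕ, N ≠ 0 → N ≤ 2 * ⌊h ^ 2⌋₊ ^ 2 → (#N.divisors : ℝ) ≤ B) {d : ℕ} (hd : d ∣ q) :
    d * ∑ y : ZMod q with addOrderOf y = d, mergedMajorant (Y ^ 7) h y ^ 2 ≤
      (scaleCount h ^ 2 * (h * totientRatio q ^ 3 / Y ^ 2 *
        (6 + B * (2 * (1 + Real.log ⌊h ^ 2⌋₊)) ^ 2)) * 3 ^ #d.primeFactors) ^ 2 := by
  classical
  have hh0 : 0 < h := by linarith
  have hd0 : 0 ≤ (d : ℝ) := Nat.cast_nonneg d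
  set S : Finset (ZMod q) := {y | addOrderOf y = d} with hS
  set J := scaleCount h
  set E : ℝ := h * totientRatio q ^ 3 / Y ^ 2 * (6 + B * (2 * (1 + Real.log ⌊h ^ 2⌋₊)) ^ 2)
  set G : ℕ × ℕ × (Fin 3 → ℕ) → ZMod q → ℝ := fun p y =>
    ∑ t ∈ cofactors q (Y ^ 7) d (p.2.2 2),
      pairTerm h (2 ^ p.1) (2 ^ p.2.1) (p.2.2 0) (p.2.2 1) (p.2.2 2) t y with hG
  set I := range J ×ˢ range J ×ˢ Nat.finMulAntidiag 3 d with hI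
  have h1 : ∑ y ∈ S, mergedMajorant (Y ^ 7) h y ^ 2 ≤ ∑ y ∈ S, (∑ p ∈ I, G p y) ^ 2 := by
    refine sum_le_sum fun y hy => pow_le_pow_left₀ (mergedMajorant_nonneg hh0.le y) ?_ 2
    refine (mergedMajorant_le_sum hq hh y).trans_eq ?_
    rw [hS, mem_filter] at hy
    rw [hy.2, hI, sum_product]
    refine sum_congr rfl fun i _ => ?_
    rw [sum_product]
  have h2 : √(d * ∑ y ∈ S, (∑ p ∈ I, G p y) ^ 2) ≤ ∑ p ∈ I, E := by
    rw [Real.sqrt_mul hd0]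
    refine (mul_le_mul_of_nonneg_left (sqrt_sum_sq_sum_le S I G) (Real.sqrt_nonneg _)).trans ?_
    rw [mul_sum]
    refine sum_le_sum fun p hp => ?_
    rw [← Real.sqrt_mul hd0]
    rw [hI, mem_product, mem_product, mem_range, mem_range, Nat.mem_finMulAntidiag] at hp
    refine sqrt_order_mul_sum_cofactors_sq_le hq hh hY hTh (one_le_pow₀ one_le_two)
      (one_le_pow₀ one_le_two) (two_pow_le_of_lt_scaleCount hh hp.1)
      (two_pow_le_of_lt_scaleCount hh hp.2.1) hB0 hB ?_ S
    rw [← hp.2.2.1, Fin.prod_univ_three]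
  -- A squarefree `d` has `3 ^ ω(d)` factorizations `r₁ r₂ s`; hence the weight three of the merged
  -- variable.
  have h3 : ∑ p ∈ I, E = J ^ 2 * E * 3 ^ #d.primeFactors := by
    rw [sum_const, hI, card_product, card_product, card_range,
      Nat.card_finMulAntidiag_of_squarefree (hq.squarefree_of_dvd hd),
      ArithmeticFunction.cardDistinctFactors_apply, nsmul_eq_mul, Nat.primeFactors,
      List.card_toFinset]
    push_cast
    ring
  rw [h3] at h2
  refine (mul_le_mul_of_nonneg_left h1 hd0).trans ?_
  have hnn : 0 ≤ J ^ 2 * E * 3 ^ #d.primeFactors := (Real.sqrt_nonneg _).trans h2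
  exact (Real.sqrt_le_left hnn).mp h2

end MergedNorm

/-! ### Bounds for absolute sums over zero-sum tuples. -/

section AbsoluteBounds

variable {q : ℕ} [NeZero q]

lemma totientRatio_nonneg (q : ℕ) : 0 ≤ totientRatio q := by unfold totientRatio; positivity

lemma sum_zeroSum_prod_le (hq : Squarefree q) {k : ℕ} (f : Fin k → ZMod q → ℝ) (A : Fin k → ℝ)
    (hf : ∀ i x, 0 ≤ f i x) (hA : ∀ i, 0 ≤ A i)
    (h : ∀ i, ∀ d, d ∣ q → d * ∑ x with addOrderOf x = d, f i x ^ 2 ≤ A i ^ 2) {m : ℕ}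
    (hm : m + k + 1 = 2 ^ k) :
    ∑ x ∈ zeroSum (ZMod q) k, ∏ i, f i (x i) ≤ totientRatio q ^ m * ∏ i, A i := by
  obtain ⟨m', hm', hw⟩ := exists_subsetWeight_one k
  obtain rfl : m = m' := by omega
  refine (sum_zeroSum_le_of_order (w := fun _ => 1) (fun _ => zero_le_one) q hq f A hf hA
    (by simpa using h)).trans ?_
  rw [hw]
  exact mul_le_mul_of_nonneg_right (prod_one_add_le_totientRatio_pow (NeZero.ne q) m)
    (prod_nonneg fun i _ => hA i)

lemma order_mul_sum_majorant_sq_le' (hq : Squarefree q) {h : ℝ} (hh : 1 ≤ h) {d : ℕ}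
    (hd : d ∣ q) :
    d * ∑ x : ZMod q with addOrderOf x = d, majorant h x ^ 2 ≤ (2 * √h * totientRatio q) ^ 2 := by
  refine (order_mul_sum_majorant_sq_le hq hh hd).trans ?_
  rw [mul_pow, mul_pow, Real.sq_sqrt (by linarith)]
  have := min_le_left h (d : ℝ)
  gcongr
  norm_num

/-- The exponent `2 ^ k - 1` is `2 ^ k - k - 1` from the Euler product plus one from each of the `k`
mean squares. -/
lemma sum_zeroSum_majorant_le (hq : Squarefree q) {h : ℝ} (hh : 1 ≤ h) (k : ℕ) :
    ∑ x ∈ zeroSum (ZMod q) k, ∏ i, majorant h (x i) ≤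
      2 ^ k * √h ^ k * totientRatio q ^ (2 ^ k - 1) := by
  obtain ⟨m, hm, -⟩ := exists_subsetWeight_one k
  refine (sum_zeroSum_prod_le hq (fun _ => majorant h) (fun _ => 2 * √h * totientRatio q)
    (fun _ => majorant_nonneg (by linarith))
    (fun _ => by have := totientRatio_nonneg q; positivity)
    (fun _ d hd => order_mul_sum_majorant_sq_le' hq hh hd) hm).trans_eq ?_
  rw [prod_const, card_univ, Fintype.card_fin, show 2 ^ k - 1 = m + k by omega, pow_add]
  ring

/-- Truncating the factor `i₀` to orders `d ≤ h / Y ^ 2` divides its mean square bound by `Y ^ 2`,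
because that bound involves `min h d`. -/
lemma sum_zeroSum_small_order_le (hq : Squarefree q) {h Y : ℝ} (hh : 1 ≤ h) (hY : 0 < Y) {k : ℕ}
    (i₀ : Fin k) :
    ∑ x ∈ zeroSum (ZMod q) k, (if (addOrderOf (x i₀) : ℝ) ≤ h / Y ^ 2 then
      ∏ i, majorant h (x i) else 0) ≤
      2 ^ k * √h ^ k / Y * totientRatio q ^ (2 ^ k - 1) := by
  obtain ⟨m, hm, -⟩ := exists_subsetWeight_one k
  have hh0 : 0 ≤ h := by linarith
  have hQ := totientRatio_nonneg q
  set f : Fin k → ZMod q → ℝ := fun i x =>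
    if i = i₀ then (if (addOrderOf x : ℝ) ≤ h / Y ^ 2 then majorant h x else 0) else majorant h x
    with hf
  have h1 := sum_zeroSum_prod_le hq f
    (fun i => (2 * √h * totientRatio q) * if i = i₀ then Y⁻¹ else 1) ?_ ?_ ?_ hm
  · refine (le_of_eq ?_).trans (h1.trans_eq ?_)
    · refine sum_congr rfl fun x _ => ?_
      split_ifs with hx
      · refine prod_congr rfl fun i _ => ?_
        simp only [hf]
        split_ifs with hi h2
        · rfl
        · subst hi; exact absurd hx h2
        · rfl
      · symm
        apply prod_eq_zero (mem_univ i₀)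
        simp [hf, hx]
    · rw [prod_mul_distrib, prod_const, card_univ, Fintype.card_fin,
        prod_ite_eq' univ i₀ (fun _ => Y⁻¹), if_pos (mem_univ _),
        show 2 ^ k - 1 = m + k by omega, pow_add]
      ring
  · intro i x
    have := majorant_nonneg hh0 x
    simp only [hf]
    split_ifs <;> simp [this]
  · intro i
    split_ifs <;> positivity
  · intro i d hd
    simp only [hf]
    split_ifs with hi
    · rcases le_or_gt (d : ℝ) (h / Y ^ 2) with hdY | hdY
      · have h2 : d * ∑ x : ZMod q with addOrderOf x = d,
            (if (addOrderOf x : ℝ) ≤ h / Y ^ 2 then majorant h x else 0) ^ 2 ≤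
            d * ∑ x : ZMod q with addOrderOf x = d, majorant h x ^ 2 := by
          gcongr with x hx
          · split_ifs
            · exact majorant_nonneg hh0 x
            · exact le_rfl
          · split_ifs
            · exact le_rfl
            · exact majorant_nonneg hh0 x
        refine h2.trans ((order_mul_sum_majorant_sq_le hq hh hd).trans ?_)
        have h3 : min h d ≤ h / Y ^ 2 := (min_le_right _ _).trans hdY
        have h4 : (2 * √h * totientRatio q * Y⁻¹) ^ 2 = 4 * (h / Y ^ 2) * totientRatio q ^ 2 := by
          rw [mul_pow, mul_pow, mul_pow, Real.sq_sqrt hh0]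
          field_simp
          ring
        rw [h4]
        gcongr
      · rw [sum_eq_zero]
        · rw [mul_zero]; positivity
        · intro x hx
          rw [mem_filter] at hx
          rw [hx.2, if_neg (not_le.mpr hdY)]
          norm_num
    · rw [mul_one]
      exact order_mul_sum_majorant_sq_le' hq hh hd

lemma sum_zeroSum_add_two {n : ℕ} (Φ : (Fin (n + 2) → ZMod q) → ℝ) :
    ∑ x ∈ zeroSum (ZMod q) (n + 2), Φ x = ∑ x' : Fin n → ZMod q, ∑ a : ZMod q,
      Φ (Fin.cons (-∑ i, x' i - a) (Fin.cons a x')) := by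
  rw [sum_zeroSum_succ, sum_univ_cons]
  refine sum_congr rfl fun x' _ => sum_congr rfl fun a _ => ?_
  rw [Fin.sum_univ_succ]
  simp only [Fin.cons_zero, Fin.cons_succ, neg_add_rev]
  rw [sub_eq_add_neg]

/-- Merging the two entries leaves a zero-sum tuple of length `n + 1` whose first factor has weight
three. Its mean square saves `Y ^ 2` before logarithms, and these cost at most `E * Y`. The
exponents `2 ^ (n + 2) - n - 4`, `3` and `n` add up to the one for length `n + 2`. -/
lemma sum_zeroSum_merged_le (hq : Squarefree q) {h Y : ℝ} (hh : 1 ≤ h)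
    (hY : 1 ≤ Y) (hTh : Y ^ 4 ≤ h) {B E : ℝ} (hB0 : 0 ≤ B)
    (hB : ∀ N : ℕ, N ≠ 0 → N ≤ 2 * ⌊h ^ 2⌋₊ ^ 2 → (#N.divisors : ℝ) ≤ B)
    (hE : scaleCount h ^ 2 * (6 + B * (2 * (1 + Real.log ⌊h ^ 2⌋₊)) ^ 2) ≤ E * Y)
    {n : ℕ} (j : Fin (n + 1)) :
    ∑ x ∈ zeroSum (ZMod q) (n + 2),
      (if Y ^ 7 ≤ (Nat.gcd (addOrderOf (x 0)) (addOrderOf (x j.succ)) : ℕ) ∧ x 0 + x j.succ ≠ 0 then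
        ∏ i, majorant h (x i) else 0) ≤
      E * 2 ^ n * √h ^ (n + 2) / Y * totientRatio q ^ (2 ^ (n + 2) - 1) := by
  have hh0 : 0 < h := by linarith
  have hY0 : 0 < Y := by linarith
  have hQ := totientRatio_nonneg q
  obtain ⟨e, he0, he1⟩ := exists_perm_zero_one (i := (0 : Fin (n + 2))) (j := j.succ)
    (Fin.succ_ne_zero j).symm
  obtain ⟨m, hm, hw⟩ := exists_subsetWeight_cons_three n
  have h1 : ∑ x ∈ zeroSum (ZMod q) (n + 2),
      (if Y ^ 7 ≤ (Nat.gcd (addOrderOf (x 0)) (addOrderOf (x j.succ)) : ℕ) ∧ x 0 + x j.succ ≠ 0 then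
        ∏ i, majorant h (x i) else 0) =
      ∑ z ∈ zeroSum (ZMod q) (n + 1), ∏ i,
        (Fin.cons (mergedMajorant (Y ^ 7) h) (fun _ => majorant h) :
          Fin (n + 1) → ZMod q → ℝ) i (z i) := by
    rw [sum_zeroSum_perm e.symm]
    have hes0 : e.symm 0 = 0 := by rw [Equiv.symm_apply_eq, he0]
    have hes1 : e.symm j.succ = 1 := by rw [Equiv.symm_apply_eq, he1]
    simp only [Function.comp_apply, hes0, hes1]
    have h2 : ∀ x : Fin (n + 2) → ZMod q, ∏ i, majorant h (x (e.symm i)) =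
        ∏ i, majorant h (x i) := fun x => Equiv.prod_comp e.symm (fun i => majorant h (x i))
    simp only [h2]
    rw [sum_zeroSum_add_two, sum_zeroSum_succ]
    refine sum_congr rfl fun x' _ => ?_
    simp only [Fin.prod_univ_succ, Fin.cons_zero, Fin.cons_succ, Fin.cons_one, sub_add_cancel]
    rw [mergedMajorant]
    by_cases hy : -∑ i, x' i = 0
    · rw [if_pos hy, zero_mul]
      exact sum_eq_zero fun a _ => if_neg fun h => h.2 hy
    · rw [if_neg hy, sum_mul]
      refine sum_congr rfl fun a _ => ?_
      rw [Nat.gcd_comm]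
      by_cases h3 : Y ^ 7 ≤ (Nat.gcd (addOrderOf a) (addOrderOf (-∑ i, x' i - a)) : ℕ)
      · rw [if_pos ⟨h3, hy⟩, if_pos h3]; ring
      · rw [if_neg (fun h => h3 h.1), if_neg h3, zero_mul]
  rw [h1]
  set E₀ : ℝ := scaleCount h ^ 2 * (h * totientRatio q ^ 3 / Y ^ 2 *
        (6 + B * (2 * (1 + Real.log ⌊h ^ 2⌋₊)) ^ 2)) with hE₀
  have hE₀0 : 0 ≤ E₀ := by positivity
  refine (sum_zeroSum_le_of_order (w := Fin.cons 3 (fun _ => 1)) ?_ q hq _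
    (Fin.cons E₀ (fun _ => 2 * √h * totientRatio q)) ?_ ?_ ?_).trans ?_
  · intro i
    refine Fin.cases ?_ (fun i => ?_) i <;> simp
  · intro i x
    refine Fin.cases ?_ (fun i => ?_) i
    · exact mergedMajorant_nonneg hh0.le x
    · exact majorant_nonneg hh0.le x
  · intro i
    refine Fin.cases ?_ (fun i => ?_) i
    · exact hE₀0
    · simp only [Fin.cons_succ]; positivity
  · intro i d hd
    refine Fin.cases ?_ (fun i => ?_) i
    · simp only [Fin.cons_zero]
      exact order_mul_sum_mergedMajorant_sq_le hq hh hY hTh hB0 hB hd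
    · simp only [Fin.cons_succ, one_pow, mul_one]
      exact order_mul_sum_majorant_sq_le' hq hh hd
  · rw [hw]
    simp only [Fin.prod_univ_succ, Fin.cons_zero, Fin.cons_succ, prod_const, card_univ,
      Fintype.card_fin]
    have h2 : E₀ ≤ E * (h * totientRatio q ^ 3 / Y) := by
      calc E₀ = scaleCount h ^ 2 * (6 + B * (2 * (1 + Real.log ⌊h ^ 2⌋₊)) ^ 2) *
            (h * totientRatio q ^ 3 / Y ^ 2) := by rw [hE₀]; ring
        _ ≤ E * Y * (h * totientRatio q ^ 3 / Y ^ 2) := by gcongr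
        _ = _ := by field_simp
    calc (∏ p ∈ q.primeFactors, (1 + (m : ℝ) / p)) * (E₀ * (2 * √h * totientRatio q) ^ n)
        ≤ totientRatio q ^ m *
          (E * (h * totientRatio q ^ 3 / Y) * (2 * √h * totientRatio q) ^ n) := by
          gcongr
          exact prod_one_add_le_totientRatio_pow (NeZero.ne q) m
      _ = E * 2 ^ n * √h ^ (n + 2) / Y * totientRatio q ^ (2 ^ (n + 2) - 1) := by
          rw [show 2 ^ (n + 2) - 1 = m + 3 + n by omega, pow_add _ (m + 3), pow_add _ m,
            pow_add (√h), Real.sq_sqrt hh0.le]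
          ring

/-- Since `x 0` is minus the sum of the other entries, its order divides the product of theirs, and
then also the product of the gcds. -/
lemma addOrderOf_zero_dvd_prod_gcd {n : ℕ} {x : Fin (n + 1) → ZMod q} (hx : ∑ i, x i = 0) :
    addOrderOf (x 0) ∣ ∏ j : Fin n, Nat.gcd (addOrderOf (x 0)) (addOrderOf (x j.succ)) := by
  have h1 : ∀ (s : Finset (Fin n)) (N : ℕ) (f : Fin n → ℕ), N ∣ ∏ j ∈ s, f j →
      N ∣ ∏ j ∈ s, Nat.gcd N (f j) := by
    classical
    intro s N f
    have h2 : Nat.gcd N (∏ j ∈ s, f j) ∣ ∏ j ∈ s, Nat.gcd N (f j) := by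
      induction s using Finset.induction_on with
      | empty => simp
      | insert a s ha ih =>
        rw [prod_insert ha, prod_insert ha]
        exact (Nat.gcd_mul_right_dvd_mul_gcd N _ _).trans (mul_dvd_mul_left _ ih)
    intro h
    rwa [Nat.gcd_eq_left h] at h2
  apply h1
  rw [addOrderOf_dvd_iff_nsmul_eq_zero]
  rw [Fin.sum_univ_succ] at hx
  rw [eq_neg_of_add_eq_zero_left hx, smul_neg, smul_sum, neg_eq_zero]
  refine sum_eq_zero fun j _ => ?_
  rw [← addOrderOf_dvd_iff_nsmul_eq_zero]
  exact dvd_prod_of_mem _ (mem_univ j)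

open Classical in
/-- Tuples without a cancelling pair. -/
lemma sum_zeroSum_noncancelling_le (hq : Squarefree q) {h Y : ℝ} (hh : 1 ≤ h)
    (hY : 1 ≤ Y) {n : ℕ} (hYh : Y ^ (7 * (n + 2)) = h) {B E : ℝ} (hB0 : 0 ≤ B)
    (hB : ∀ N : ℕ, N ≠ 0 → N ≤ 2 * ⌊h ^ 2⌋₊ ^ 2 → (#N.divisors : ℝ) ≤ B)
    (hE : scaleCount h ^ 2 * (6 + B * (2 * (1 + Real.log ⌊h ^ 2⌋₊)) ^ 2) ≤ E * Y) :
    ∑ x ∈ zeroSum (ZMod q) (n + 2), (if ∀ i j, i ≠ j → x i + x j ≠ 0 then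
        ∏ i, majorant h (x i) else 0) ≤
      ((n + 2) * 2 ^ (n + 2) + (n + 1) * (E * 2 ^ n)) * √h ^ (n + 2) / Y *
        totientRatio q ^ (2 ^ (n + 2) - 1) := by
  have hh0 : 0 < h := by linarith
  have hY0 : 0 < Y := by linarith
  have hTh : Y ^ 4 ≤ h := by
    rw [← hYh]
    exact pow_le_pow_right₀ hY (by omega)
  have hpt : ∀ x ∈ zeroSum (ZMod q) (n + 2), (if ∀ i j, i ≠ j → x i + x j ≠ 0 then
        ∏ i, majorant h (x i) else 0) ≤
      ∑ i₀, (if (addOrderOf (x i₀) : ℝ) ≤ h / Y ^ 2 then ∏ i, majorant h (x i) else 0) +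
      ∑ j : Fin (n + 1), (if Y ^ 7 ≤ (Nat.gcd (addOrderOf (x 0)) (addOrderOf (x j.succ)) : ℕ) ∧
        x 0 + x j.succ ≠ 0 then ∏ i, majorant h (x i) else 0) := by
    intro x hx
    have hP : 0 ≤ ∏ i, majorant h (x i) := prod_nonneg fun i _ => majorant_nonneg hh0.le _
    have hnn1 : ∀ i₀ : Fin (n + 2), i₀ ∈ univ → 0 ≤ (if (addOrderOf (x i₀) : ℝ) ≤ h / Y ^ 2 then
        ∏ i, majorant h (x i) else 0) := fun i₀ _ => by split_ifs <;> simp [hP]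
    have hnn2 : ∀ j : Fin (n + 1), j ∈ univ →
        0 ≤ (if Y ^ 7 ≤ (Nat.gcd (addOrderOf (x 0)) (addOrderOf (x j.succ)) : ℕ) ∧
        x 0 + x j.succ ≠ 0 then ∏ i, majorant h (x i) else 0) := fun j _ => by
      split_ifs <;> simp [hP]
    split_ifs with hnc
    swap
    · exact add_nonneg (sum_nonneg hnn1) (sum_nonneg hnn2)
    by_cases h1 : (addOrderOf (x 0) : ℝ) ≤ h / Y ^ 2
    · have h2 := single_le_sum hnn1 (mem_univ 0)
      rw [if_pos h1] at h2
      exact h2.trans (le_add_of_nonneg_right (sum_nonneg hnn2))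
    -- If all gcds were below `Y ^ 7`, the order of `x 0` would be at most `Y ^ (7 * (n + 1))`,
    -- which is at most `h / Y ^ 2` because `Y ^ (7 * (n + 2)) = h`.
    · have h2 : ∃ j : Fin (n + 1),
          Y ^ 7 ≤ (Nat.gcd (addOrderOf (x 0)) (addOrderOf (x j.succ)) : ℕ) := by
        by_contra! h2
        apply h1
        have h3 := Nat.le_of_dvd (prod_pos fun j _ =>
          Nat.gcd_pos_of_pos_left _ (addOrderOf_pos (x 0)))
          (addOrderOf_zero_dvd_prod_gcd (mem_zeroSum.mp hx))
        have h4 : (addOrderOf (x 0) : ℝ) ≤ (Y ^ 7) ^ (n + 1) := by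
          refine (Nat.cast_le.mpr h3).trans ?_
          push_cast
          refine (prod_le_prod (fun j _ => Nat.cast_nonneg _) fun j _ => (h2 j).le).trans_eq ?_
          simp
        rw [le_div_iff₀ (by positivity)]
        calc (addOrderOf (x 0) : ℝ) * Y ^ 2 ≤ (Y ^ 7) ^ (n + 1) * Y ^ 2 := by gcongr
          _ = Y ^ (7 * (n + 1) + 2) := by rw [← pow_mul, ← pow_add]
          _ ≤ Y ^ (7 * (n + 2)) := pow_le_pow_right₀ hY (by omega)
          _ = h := hYh
      obtain ⟨j, hj⟩ := h2
      have h3 := single_le_sum hnn2 (mem_univ j)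
      rw [if_pos ⟨hj, hnc 0 j.succ (Fin.succ_ne_zero j).symm⟩] at h3
      exact h3.trans (le_add_of_nonneg_left (sum_nonneg hnn1))
  refine (sum_le_sum hpt).trans ?_
  rw [sum_add_distrib, sum_comm, sum_comm (t := (univ : Finset (Fin (n + 1))))]
  refine (add_le_add (sum_le_sum fun i₀ _ => sum_zeroSum_small_order_le hq hh hY0 i₀)
    (sum_le_sum fun j _ => sum_zeroSum_merged_le hq hh hY hTh hB0 hB hE j)).trans_eq ?_
  simp only [sum_const, card_univ, Fintype.card_fin, nsmul_eq_mul]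
  push_cast
  ring

end AbsoluteBounds

/-! ### Absorbing logarithms and divisor functions. -/

section Logarithms

lemma scaleCount_le {h ε : ℝ} (hh : 1 ≤ h) (hε : 0 < ε) :
    (scaleCount h : ℝ) ≤ (1 + 1 / (ε * Real.log 2)) * h ^ ε := by
  have hl : 0 < Real.log 2 := Real.log_pos (by norm_num)
  have h1 : (2 : ℝ) ^ (Nat.log 2 ⌊h⌋₊) ≤ h :=
    two_pow_le_of_lt_scaleCount hh (Nat.lt_succ_self _)
  have h2 := Real.log_le_log (by positivity) h1
  rw [Real.log_pow] at h2
  have h3 := Real.log_le_rpow_div (by linarith : (0 : ℝ) ≤ h) hε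
  have h4 : (Nat.log 2 ⌊h⌋₊ : ℝ) ≤ 1 / (ε * Real.log 2) * h ^ ε := by
    rw [← le_div_iff₀ hl] at h2
    refine h2.trans ?_
    rw [div_le_iff₀ hl]
    refine h3.trans_eq ?_
    field_simp
  have h5 : 1 ≤ h ^ ε := Real.one_le_rpow hh hε.le
  unfold scaleCount
  push_cast
  linarith

lemma log_floor_sq_le {h ε : ℝ} (hh : 1 ≤ h) (hε : 0 < ε) :
    2 * (1 + Real.log ⌊h ^ 2⌋₊) ≤ (2 + 4 / ε) * h ^ ε := by
  have h1 : (1 : ℝ) ≤ ⌊h ^ 2⌋₊ := by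
    exact_mod_cast Nat.le_floor (by push_cast; exact one_le_pow₀ hh)
  have h2 : Real.log ⌊h ^ 2⌋₊ ≤ 2 * Real.log h := by
    have := Real.log_le_log (by linarith) (Nat.floor_le (by positivity : 0 ≤ h ^ 2))
    rwa [Real.log_pow] at this
  have h3 := Real.log_le_rpow_div (by linarith : (0 : ℝ) ≤ h) hε
  have h5 : 1 ≤ h ^ ε := Real.one_le_rpow hh hε.le
  have h6 : (2 + 4 / ε) * h ^ ε = 2 * h ^ ε + 4 * (h ^ ε / ε) := by ring
  rw [h6]
  linarith

/-- Logarithms and divisor functions are dominated by any power of `h`. -/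
lemma exists_divisor_log_bound {δ : ℝ} (hδ : 0 < δ) :
    ∃ E : ℝ, 0 ≤ E ∧ ∀ h : ℝ, 1 ≤ h → ∃ B : ℝ, 0 ≤ B ∧
      (∀ N : ℕ, N ≠ 0 → N ≤ 2 * ⌊h ^ 2⌋₊ ^ 2 → (#N.divisors : ℝ) ≤ B) ∧
      scaleCount h ^ 2 * (6 + B * (2 * (1 + Real.log ⌊h ^ 2⌋₊)) ^ 2) ≤ E * h ^ δ := by
  -- Eight powers of `h ^ ε` are spent: two on the scales, four on the divisor bound (since `N ≤ 2 *
  -- h ^ 4`) and two on the squared logarithm.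
  set ε : ℝ := δ / 8 with hεd
  have hε : 0 < ε := by positivity
  obtain ⟨C, hC, hdiv⟩ := exists_card_divisors_le hε
  set c₁ : ℝ := 1 + 1 / (ε * Real.log 2) with hc₁
  set c₂ : ℝ := 2 + 4 / ε with hc₂
  have hl : 0 < Real.log 2 := Real.log_pos (by norm_num)
  refine ⟨c₁ ^ 2 * (6 + C * 2 ^ ε * c₂ ^ 2), by positivity, fun h hh => ?_⟩
  have hh0 : 0 ≤ h := by linarith
  set u : ℝ := h ^ ε with hu
  have hu1 : 1 ≤ u := Real.one_le_rpow hh hε.le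
  refine ⟨C * 2 ^ ε * u ^ 4, by positivity, ?_, ?_⟩
  · intro N hN hNle
    refine (hdiv N hN).trans ?_
    rw [mul_assoc]
    refine mul_le_mul_of_nonneg_left ?_ hC.le
    have h1 : (N : ℝ) ≤ 2 * h ^ 4 := by
      have h2 : (N : ℝ) ≤ 2 * (⌊h ^ 2⌋₊ : ℝ) ^ 2 := by exact_mod_cast hNle
      have h3 := Nat.floor_le (by positivity : 0 ≤ h ^ 2)
      calc (N : ℝ) ≤ 2 * (⌊h ^ 2⌋₊ : ℝ) ^ 2 := h2
        _ ≤ 2 * (h ^ 2) ^ 2 := by gcongr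
        _ = 2 * h ^ 4 := by ring
    calc (N : ℝ) ^ ε ≤ (2 * h ^ 4) ^ ε := by gcongr
      _ = 2 ^ ε * u ^ 4 := by
        rw [Real.mul_rpow (by norm_num) (by positivity), hu, ← Real.rpow_natCast,
          ← Real.rpow_natCast, ← Real.rpow_mul hh0, ← Real.rpow_mul hh0, mul_comm ε]
  · have h1 := scaleCount_le hh hε
    have h2 := log_floor_sq_le hh hε
    have h3 : 0 ≤ 2 * (1 + Real.log ⌊h ^ 2⌋₊) := by
      have : 0 ≤ Real.log (⌊h ^ 2⌋₊ : ℝ) := Real.log_natCast_nonneg _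
      positivity
    have h4 : h ^ δ = u ^ 8 := by
      rw [hu, ← Real.rpow_natCast, ← Real.rpow_mul hh0]
      congr 1
      rw [hεd]; push_cast; ring
    rw [h4]
    calc (scaleCount h : ℝ) ^ 2 *
          (6 + C * 2 ^ ε * u ^ 4 * (2 * (1 + Real.log ⌊h ^ 2⌋₊)) ^ 2)
        ≤ (c₁ * u) ^ 2 * (6 + C * 2 ^ ε * u ^ 4 * (c₂ * u) ^ 2) := by gcongr
      _ ≤ (c₁ * u) ^ 2 * (6 * u ^ 6 + C * 2 ^ ε * u ^ 4 * (c₂ * u) ^ 2) := by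
          have : 1 ≤ u ^ 6 := one_le_pow₀ hu1
          gcongr
          linarith
      _ = c₁ ^ 2 * (6 + C * 2 ^ ε * c₂ ^ 2) * u ^ 8 := by ring

end Logarithms

/-! ### Tuples whose entries cancel in pairs. -/

section Pairable

/-- A tuple whose entries cancel in pairs. -/
def IsPairable {G : Type*} [AddCommGroup G] {n : ℕ} (x : Fin n → G) : Prop :=
  ∃ τ : Fin n → Fin n, ∀ i, τ (τ i) = i ∧ τ i ≠ i ∧ x i + x (τ i) = 0

lemma IsPairable.comp_perm {G : Type*} [AddCommGroup G] {n : ℕ} {x : Fin n → G}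
    (h : IsPairable x) (e : Equiv.Perm (Fin n)) : IsPairable (x ∘ e) := by
  obtain ⟨τ, hτ⟩ := h
  refine ⟨fun i => e.symm (τ (e i)), fun i => ?_⟩
  obtain ⟨h1, h2, h3⟩ := hτ (e i)
  refine ⟨by simp [h1], ?_, by simpa using h3⟩
  intro h
  rw [Equiv.symm_apply_eq] at h
  exact h2 h

lemma isPairable_comp_perm_iff {G : Type*} [AddCommGroup G] {n : ℕ} {x : Fin n → G}
    (e : Equiv.Perm (Fin n)) : IsPairable (x ∘ e) ↔ IsPairable x := by
  refine ⟨fun h => ?_, fun h => h.comp_perm e⟩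
  have := h.comp_perm e.symm
  rwa [Function.comp_assoc, Equiv.self_comp_symm] at this

lemma IsPairable.cons_cons {G : Type*} [AddCommGroup G] {n : ℕ} {x : Fin n → G}
    (h : IsPairable x) {a b : G} (hab : a + b = 0) :
    IsPairable (Fin.cons a (Fin.cons b x) : Fin (n + 2) → G) := by
  obtain ⟨τ, hτ⟩ := h
  refine ⟨Fin.cons 1 (Fin.cons 0 fun i => (τ i).succ.succ), fun i => ?_⟩
  refine Fin.cases ?_ (fun i => Fin.cases ?_ (fun i => ?_) i) i
  · simpa using hab
  · rw [Fin.succ_zero_eq_one]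
    simpa using (add_comm b a).trans hab
  · obtain ⟨h1, h2, h3⟩ := hτ i
    simp only [Fin.cons_succ, ne_eq, Fin.succ_inj]
    exact ⟨by rw [h1], h2, h3⟩

end Pairable

/-! ### Removing cancelling pairs, and the bound for unpaired tuples. -/

section PairRemoval

variable {q : ℕ} [NeZero q]

open Classical in
lemma sum_zeroSum_cancelling {n : ℕ} (Φ : (Fin (n + 2) → ZMod q) → ℝ) :
    ∑ x ∈ zeroSum (ZMod q) (n + 2), (if x 0 + x 1 = 0 then Φ x else 0) =
      ∑ x' ∈ zeroSum (ZMod q) n, ∑ a : ZMod q, Φ (Fin.cons (-a) (Fin.cons a x')) := by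
  rw [sum_zeroSum_add_two, zeroSum, sum_filter]
  refine sum_congr rfl fun x' _ => ?_
  by_cases h : ∑ i, x' i = 0
  · simp [h]
  · rw [if_neg h]
    refine sum_eq_zero fun a _ => if_neg ?_
    simpa using h

/-- This is the general bound for zero-sum tuples of length two; it is the cost of one cancelling
pair. -/
lemma sum_majorant_neg_mul_le (hq : Squarefree q) {h : ℝ} (hh : 1 ≤ h) :
    ∑ a : ZMod q, majorant h (-a) * majorant h a ≤ 4 * h * totientRatio q ^ 3 := by
  have h1 := sum_zeroSum_majorant_le hq hh 2
  rw [sum_zeroSum_succ, sum_univ_cons] at h1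
  simp only [univ_unique, sum_singleton, Fin.prod_univ_succ, Fin.cons_zero, Fin.cons_succ] at h1
  rw [Real.sq_sqrt (by linarith)] at h1
  norm_num at h1 ⊢
  exact h1

open Classical in
/-- Tuples with a cancelling pair whose elements occur, up to sign, a third time. -/
lemma sum_zeroSum_repeated_le (hq : Squarefree q) {h : ℝ} (hh : 1 ≤ h) {n : ℕ} {i j l : Fin (n + 2)}
    (hij : i ≠ j) (hli : l ≠ i) (hlj : l ≠ j) :
    ∑ x ∈ zeroSum (ZMod q) (n + 2), (if x i + x j = 0 ∧ x j = x l then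
        ∏ i, majorant h (x i) else 0) ≤
      2 ^ n * √h ^ n * totientRatio q ^ (2 ^ n + 1) := by
  have hh0 : 0 ≤ h := by linarith
  have hQ := totientRatio_nonneg q
  obtain ⟨e, rfl, rfl⟩ := exists_perm_zero_one hij
  obtain ⟨l, rfl⟩ := e.surjective l
  obtain ⟨l, rfl⟩ := Fin.exists_succ_eq.mpr fun h : l = 0 => hli (by rw [h])
  obtain ⟨l, rfl⟩ := Fin.exists_succ_eq.mpr fun h : l = 0 => hlj (by rw [h]; rfl)
  rw [sum_zeroSum_perm e.symm]
  have h2 : ∀ x : Fin (n + 2) → ZMod q, ∏ i, majorant h (x (e.symm i)) =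
      ∏ i, majorant h (x i) := fun x => Equiv.prod_comp e.symm (fun i => majorant h (x i))
  simp only [Function.comp_apply, Equiv.symm_apply_apply, h2]
  have h3 : ∀ x : Fin (n + 2) → ZMod q, (if x 0 + x 1 = 0 ∧ x 1 = x l.succ.succ then
      ∏ i, majorant h (x i) else 0) = if x 0 + x 1 = 0 then
      (if x 1 = x l.succ.succ then ∏ i, majorant h (x i) else 0) else 0 := fun x => by
    rw [ite_and]
  simp only [h3]
  rw [sum_zeroSum_cancelling]
  simp only [Fin.prod_univ_succ, Fin.cons_zero, Fin.cons_succ, Fin.cons_one]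
  have h4 : ∀ x' ∈ zeroSum (ZMod q) n, ∑ a : ZMod q, (if a = x' l then
      majorant h (-a) * (majorant h a * ∏ i, majorant h (x' i)) else 0) ≤
      totientRatio q ^ 2 * ∏ i, majorant h (x' i) := by
    intro x' _
    -- The third occurrence fixes `a`, so no sum over `a` remains to produce a factor `h`; two
    -- pointwise bounds suffice.
    rw [sum_ite_eq' univ (x' l), if_pos (mem_univ _), ← mul_assoc]
    refine mul_le_mul_of_nonneg_right ?_ (prod_nonneg fun i _ => majorant_nonneg hh0 _)
    rw [sq]
    exact mul_le_mul (majorant_le_totientRatio hq h _) (majorant_le_totientRatio hq h _)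
      (majorant_nonneg hh0 _) hQ
  refine (sum_le_sum h4).trans ?_
  rw [← mul_sum]
  refine (mul_le_mul_of_nonneg_left (sum_zeroSum_majorant_le hq hh n) (by positivity)).trans_eq ?_
  have h5 : 2 ^ n + 1 = 2 + (2 ^ n - 1) := by have := Nat.one_le_two_pow (n := n); omega
  rw [h5, pow_add]
  ring

open Classical in
/-- The absolute sum over tuples that do not cancel in pairs. -/
noncomputable def unpairedSum (q : ℕ) [NeZero q] (h : ℝ) (k : ℕ) : ℝ :=
  ∑ x ∈ zeroSum (ZMod q) k, if IsPairable x then 0 else ∏ i, majorant h (x i)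

lemma unpairedSum_zero (h : ℝ) : unpairedSum q h 0 = 0 := by
  unfold unpairedSum
  exact sum_eq_zero fun x _ => if_pos ⟨id, fun i => i.elim0⟩

lemma unpairedSum_one (h : ℝ) : unpairedSum q h 1 = 0 := by
  unfold unpairedSum
  refine sum_eq_zero fun x hx => ?_
  have : x 0 = 0 := by simpa using hx
  simp [this]

-- Deleting a cancelling pair from a tuple that is not pairable leaves one that is not pairable
-- either, since the pair could be put back. The square of `n + 2` counts the positions of the pair.
open Classical in
lemma unpairedSum_add_two_le (hq : Squarefree q) {h : ℝ} (hh : 1 ≤ h) (n : ℕ) :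
    unpairedSum q h (n + 2) ≤ (n + 2) ^ 2 * (4 * h * totientRatio q ^ 3 * unpairedSum q h n) +
      ∑ x ∈ zeroSum (ZMod q) (n + 2), (if ∀ i j, i ≠ j → x i + x j ≠ 0 then
        ∏ i, majorant h (x i) else 0) := by
  have hh0 : 0 ≤ h := by linarith
  have hP : ∀ {m : ℕ} (x : Fin m → ZMod q), 0 ≤ ∏ i, majorant h (x i) := fun x =>
    prod_nonneg fun i _ => majorant_nonneg hh0 _
  set W : Fin (n + 2) × Fin (n + 2) → (Fin (n + 2) → ZMod q) → ℝ := fun p x =>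
    if p.1 ≠ p.2 ∧ x p.1 + x p.2 = 0 ∧ ¬ IsPairable x then ∏ i, majorant h (x i) else 0 with hW
  have hW0 : ∀ p x, 0 ≤ W p x := by
    intro p x; simp only [hW]; split_ifs
    · exact hP x
    · exact le_rfl
  have hpt : ∀ x ∈ zeroSum (ZMod q) (n + 2),
      (if IsPairable x then 0 else ∏ i, majorant h (x i)) ≤ ∑ p, W p x +
      (if ∀ i j, i ≠ j → x i + x j ≠ 0 then ∏ i, majorant h (x i) else 0) := by
    intro x _
    split_ifs with h1 h2 h2
    · exact add_nonneg (sum_nonneg fun p _ => hW0 p x) (hP x)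
    · exact add_nonneg (sum_nonneg fun p _ => hW0 p x) le_rfl
    · exact le_add_of_nonneg_left (sum_nonneg fun p _ => hW0 p x)
    · push Not at h2
      obtain ⟨i, j, hij, h3⟩ := h2
      rw [add_zero]
      refine le_trans (le_of_eq ?_) (single_le_sum (fun p _ => hW0 p x) (mem_univ (i, j)))
      simp only [hW]
      rw [if_pos ⟨hij, h3, h1⟩]
  rw [unpairedSum]
  refine (sum_le_sum hpt).trans ?_
  rw [sum_add_distrib, sum_comm]
  refine add_le_add_left ?_ _
  have hb : ∀ p : Fin (n + 2) × Fin (n + 2), ∑ x ∈ zeroSum (ZMod q) (n + 2), W p x ≤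
      4 * h * totientRatio q ^ 3 * unpairedSum q h n := by
    rintro ⟨i, j⟩
    have hU : 0 ≤ unpairedSum q h n := sum_nonneg fun x _ => by
      split_ifs
      · exact le_rfl
      · exact hP x
    by_cases hij : i = j
    · simp only [hW, hij, ne_eq, not_true, false_and, if_false, sum_const_zero]
      have := totientRatio_nonneg q
      positivity
    obtain ⟨e, rfl, rfl⟩ := exists_perm_zero_one hij
    rw [sum_zeroSum_perm e.symm]
    have h2 : ∀ x : Fin (n + 2) → ZMod q, ∏ i, majorant h (x (e.symm i)) =
        ∏ i, majorant h (x i) := fun x => Equiv.prod_comp e.symm (fun i => majorant h (x i))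
    simp only [hW, isPairable_comp_perm_iff, Function.comp_apply, Equiv.symm_apply_apply, h2]
    have h3 : ∀ x : Fin (n + 2) → ZMod q,
        (if e 0 ≠ e 1 ∧ x 0 + x 1 = 0 ∧ ¬ IsPairable x then ∏ i, majorant h (x i) else 0) =
        if x 0 + x 1 = 0 then (if IsPairable x then 0 else ∏ i, majorant h (x i)) else 0 := by
      intro x
      split_ifs <;> simp_all
    simp only [h3]
    rw [sum_zeroSum_cancelling, unpairedSum, mul_sum]
    refine sum_le_sum fun x' _ => ?_
    by_cases hx' : IsPairable x'
    · rw [if_pos hx', mul_zero]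
      refine (sum_eq_zero fun a _ => if_pos (hx'.cons_cons (by simp))).le
    · rw [if_neg hx']
      refine le_trans ?_ (mul_le_mul_of_nonneg_right (sum_majorant_neg_mul_le hq hh) (hP x'))
      rw [sum_mul]
      refine sum_le_sum fun a _ => ?_
      have h4 : ∏ i, majorant h ((Fin.cons (-a) (Fin.cons a x') : Fin (n + 2) → ZMod q) i) =
          majorant h (-a) * majorant h a * ∏ i, majorant h (x' i) := by
        simp only [Fin.prod_univ_succ, Fin.cons_zero, Fin.cons_succ]
        ring
      rw [h4]
      split_ifs
      · have := majorant_nonneg hh0 a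
        have := majorant_nonneg hh0 (-a)
        have := hP x'
        positivity
      · exact le_rfl
  refine (sum_le_sum fun p _ => hb p).trans_eq ?_
  rw [sum_const, card_univ, Fintype.card_prod, Fintype.card_fin, nsmul_eq_mul]
  push_cast
  ring

/-- Tuples that do not cancel in pairs contribute less than the trivial bound by a power of `h`. -/
theorem exists_unpairedSum_le (k : ℕ) :
    ∃ C : ℝ, 0 ≤ C ∧ ∀ (q : ℕ) [NeZero q] (h : ℝ), Squarefree q → 1 ≤ h →
      unpairedSum q h k ≤
        C * (√h ^ k / h ^ (1 / (7 * (k : ℝ))) * totientRatio q ^ (2 ^ k - 1)) := by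
  induction k using Nat.twoStepInduction with
  | zero => exact ⟨0, le_rfl, fun q _ h _ _ => by rw [unpairedSum_zero, zero_mul]⟩
  | one => exact ⟨0, le_rfl, fun q _ h _ _ => by rw [unpairedSum_one, zero_mul]⟩
  | more n ih _ =>
    obtain ⟨C, hC, ih⟩ := ih
    have hδ : (0 : ℝ) < 1 / (7 * ((n + 2 : ℕ) : ℝ)) := by positivity
    obtain ⟨E, hE, hlog⟩ := exists_divisor_log_bound hδ
    refine ⟨(n + 2) ^ 2 * 4 * C + ((n + 2) * 2 ^ (n + 2) + (n + 1) * (E * 2 ^ n)),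
      by positivity, fun q _ h hq hh => ?_⟩
    obtain ⟨B, hB0, hB, hBE⟩ := hlog h hh
    have hh0 : 0 < h := by linarith
    set Y : ℝ := h ^ (1 / (7 * ((n + 2 : ℕ) : ℝ))) with hYdef
    have hY1 : 1 ≤ Y := Real.one_le_rpow hh hδ.le
    have hYh : Y ^ (7 * (n + 2)) = h := by
      rw [hYdef, ← Real.rpow_natCast, ← Real.rpow_mul hh0.le]
      push_cast
      rw [one_div_mul_cancel (by positivity), Real.rpow_one]
    have hQ1 : 1 ≤ totientRatio q := one_le_totientRatio hq.ne_zero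
    have hQ0 : 0 ≤ totientRatio q := by linarith
    have h1 := unpairedSum_add_two_le hq hh n
    have h2 := sum_zeroSum_noncancelling_le hq hh hY1 hYh hB0 hB hBE
    have h3 : h * totientRatio q ^ 3 * unpairedSum q h n ≤
        C * (√h ^ (n + 2) / Y * totientRatio q ^ (2 ^ (n + 2) - 1)) := by
      -- For `n = 0` the exponent `1 / (7 * n)` has the default value zero and cannot be compared
      -- with that of `Y`, but the unpaired sum is then empty of terms.
      rcases Nat.eq_zero_or_pos n with rfl | hn
      · rw [unpairedSum_zero, mul_zero]; positivity
      · have h4 := ih q h hq hh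
        have hYn : Y ≤ h ^ (1 / (7 * (n : ℝ))) := by
          apply Real.rpow_le_rpow_of_exponent_le hh
          have : (0 : ℝ) < n := by exact_mod_cast hn
          gcongr
          simp
        have hexp : 3 + (2 ^ n - 1) ≤ 2 ^ (n + 2) - 1 := by
          have := Nat.one_le_two_pow (n := n)
          rw [pow_add]; omega
        calc h * totientRatio q ^ 3 * unpairedSum q h n
            ≤ h * totientRatio q ^ 3 *
              (C * (√h ^ n / h ^ (1 / (7 * (n : ℝ))) * totientRatio q ^ (2 ^ n - 1))) := by gcongr
          _ = C * (√h ^ (n + 2) / h ^ (1 / (7 * (n : ℝ))) *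
                totientRatio q ^ (3 + (2 ^ n - 1))) := by
              rw [pow_add (√h), Real.sq_sqrt hh0.le, pow_add (totientRatio q)]; ring
          _ ≤ _ := by
              gcongr
    calc unpairedSum q h (n + 2)
        ≤ (n + 2) ^ 2 * (4 * (C * (√h ^ (n + 2) / Y * totientRatio q ^ (2 ^ (n + 2) - 1)))) +
          ((n + 2) * 2 ^ (n + 2) + (n + 1) * (E * 2 ^ n)) * √h ^ (n + 2) / Y *
            totientRatio q ^ (2 ^ (n + 2) - 1) := by
          refine h1.trans (add_le_add (mul_le_mul_of_nonneg_left ?_ (by positivity)) h2)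
          linarith
      _ = _ := by ring

end PairRemoval

/-! ### Fractions with denominator dividing `q` as residue classes. -/

section ResidueClasses

variable {q : ℕ} [NeZero q]

lemma addOrderOf_div_mul {d a : ℕ} (hd : d ∣ q) (hd1 : 1 < d) (ha : a ≤ d)
    (had : a.Coprime d) :
    addOrderOf ((q / d * a : ℕ) : ZMod q) = d ∧ ((q / d * a : ℕ) : ZMod q).val = q / d * a ∧
      ((q / d * a : ℕ) : ZMod q) ≠ 0 := by
  have hq0 : q ≠ 0 := NeZero.ne q
  obtain ⟨m, hm⟩ := hd
  have hd0 : 0 < d := by omega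
  have hm0 : 0 < m := Nat.pos_of_ne_zero fun h => hq0 (by rw [hm, h, mul_zero])
  have hqd : q / d = m := by rw [hm, Nat.mul_div_cancel_left _ hd0]
  rw [hqd]
  have ha' : a < d := lt_of_le_of_ne ha fun h => by
    rw [h, Nat.coprime_self] at had
    omega
  have hlt : m * a < q := by
    rw [hm, mul_comm d]
    exact Nat.mul_lt_mul_of_pos_left ha' hm0
  have h1 : addOrderOf ((m * a : ℕ) : ZMod q) = d := by
    rw [ZMod.addOrderOf_coe _ hq0]
    have h2 : q.gcd (m * a) = m := by
      conv_lhs => rw [hm, mul_comm d m]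
      rw [Nat.gcd_mul_left, had.symm.gcd_eq_one, mul_one]
    rw [h2]
    conv_lhs => rw [hm]
    exact Nat.mul_div_cancel _ hm0
  refine ⟨h1, ZMod.val_cast_of_lt hlt, ?_⟩
  intro h
  rw [h, addOrderOf_zero] at h1
  omega

lemma numerator_spec {x : ZMod q} (hx : x ≠ 0) :
    1 < addOrderOf x ∧ 1 ≤ x.val / (q / addOrderOf x) ∧
      x.val / (q / addOrderOf x) ≤ addOrderOf x ∧
      (x.val / (q / addOrderOf x)).Coprime (addOrderOf x) ∧
      q / addOrderOf x * (x.val / (q / addOrderOf x)) = x.val := by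
  have hq0 : q ≠ 0 := NeZero.ne q
  set d := addOrderOf x with hd
  have hd0 : 0 < d := addOrderOf_pos x
  have hd1 : d ≠ 1 := by rwa [hd, ne_eq, AddMonoid.addOrderOf_eq_one_iff]
  have h1 : d = q / q.gcd x.val := by
    have := ZMod.addOrderOf_coe x.val hq0
    rwa [ZMod.natCast_zmod_val] at this
  set g := q.gcd x.val with hg
  have hgq : g ∣ q := Nat.gcd_dvd_left _ _
  have hgx : g ∣ x.val := Nat.gcd_dvd_right _ _
  have hg0 : 0 < g := Nat.gcd_pos_of_pos_left _ (Nat.pos_of_ne_zero hq0)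
  have h2 : q / d = g := by rw [h1]; exact Nat.div_div_self hgq hq0
  have hv0 : x.val ≠ 0 := by rwa [ne_eq, ZMod.val_eq_zero]
  rw [h2]
  refine ⟨by omega, ?_, ?_, ?_, Nat.mul_div_cancel' hgx⟩
  · exact Nat.div_pos (Nat.le_of_dvd (Nat.pos_of_ne_zero hv0) hgx) hg0
  · rw [h1]; exact Nat.div_le_div_right (ZMod.val_lt x).le
  · rw [h1]; exact (Nat.coprime_div_gcd_div_gcd hg0).symm

lemma exists_int_sum_div_iff {k : ℕ} (d a : Fin k → ℕ) (hd : ∀ i, d i ∣ q) :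
    (∃ z : ℤ, ∑ i, (a i : ℚ) / (d i : ℚ) = (z : ℚ)) ↔
      ∑ i, ((q / d i * a i : ℕ) : ZMod q) = 0 := by
  have hq0 : (q : ℚ) ≠ 0 := by exact_mod_cast NeZero.ne q
  have h1 : ∑ i, (a i : ℚ) / (d i : ℚ) = ((∑ i, q / d i * a i : ℕ) : ℚ) / q := by
    push_cast
    rw [sum_div]
    refine sum_congr rfl fun i _ => ?_
    have hdi : (d i : ℚ) ≠ 0 := by
      have : d i ≠ 0 := fun h => NeZero.ne q (by simpa [h] using hd i)
      exact_mod_cast this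
    rw [Nat.cast_div (hd i) hdi]
    field_simp
  rw [← Nat.cast_sum, ZMod.natCast_eq_zero_iff, h1]
  constructor
  · rintro ⟨z, hz⟩
    rw [div_eq_iff hq0] at hz
    have h2 : ((∑ i, q / d i * a i : ℕ) : ℤ) = z * q := by
      apply Int.cast_injective (α := ℚ)
      rw [Int.cast_natCast, hz]
      push_cast
      rfl
    exact Int.natCast_dvd_natCast.mp ⟨z, by rw [h2, mul_comm]⟩
  · rintro ⟨m, hm⟩
    refine ⟨m, ?_⟩
    rw [hm]
    push_cast
    field_simp

end ResidueClasses

/-! ### The sum `V_k` as a sum over zero-sum tuples. -/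

section Weights

variable {q : ℕ} [NeZero q]

/-- The weight `μ(d) / φ(d) · E_{r,c}(x / q)` of a nonzero residue class `x` of order `d`. -/
noncomputable def apWeight (h : ℝ) {r : ℕ} (c : ZMod r) (x : ZMod q) : ℂ :=
  if x = 0 then 0 else
    ((ArithmeticFunction.moebius (addOrderOf x) : ℤ) : ℂ) / ((addOrderOf x).totient : ℕ) *
      apExpSum r h c ((x.val : ℝ) / q)

/-- The fraction `a / d` corresponds to `x = (q / d) a`, of order exactly `d`, and integrality of
the sum of fractions becomes `∑ x i = 0`. Coprimality of `d` to `r` is automatic. -/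
lemma apV_eq_sum_zeroSum {k r : ℕ} (hr : r.Coprime q) (h : ℝ) (c : Fin k → ZMod r) :
    apV k q h r c = ∑ x ∈ zeroSum (ZMod q) k, ∏ i, apWeight h (c i) (x i) := by
  classical
  have hq0 : q ≠ 0 := NeZero.ne q
  have h1 : ∑ x ∈ zeroSum (ZMod q) k, ∏ i, apWeight h (c i) (x i) =
      ∑ x ∈ zeroSum (ZMod q) k with ∀ i, x i ≠ 0, ∏ i, apWeight h (c i) (x i) := by
    rw [sum_filter]
    refine sum_congr rfl fun x _ => ?_
    split_ifs with hx
    · rfl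
    · push Not at hx
      obtain ⟨i, hi⟩ := hx
      exact prod_eq_zero (mem_univ i) (by simp [apWeight, hi])
  rw [h1, apV]
  simp_rw [mul_sum]
  rw [sum_sigma']
  have hmem : ∀ z : (_ : Fin k → ℕ) × (Fin k → ℕ),
      z ∈ (apModuli k q r).sigma (fun d => apNumerators d) →
      (∀ i, z.1 i ∣ q ∧ 1 < z.1 i ∧ 1 ≤ z.2 i ∧ z.2 i ≤ z.1 i ∧ (z.2 i).Coprime (z.1 i)) ∧
      ∃ n : ℤ, ∑ i, (z.2 i : ℚ) / (z.1 i : ℚ) = (n : ℚ) := by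
    rintro ⟨d, a⟩ hz
    simp only [mem_sigma, apModuli, apNumerators, Fintype.mem_piFinset, mem_filter,
      Nat.mem_divisors, mem_Icc] at hz
    exact ⟨fun i => ⟨(hz.1 i).1.1, (hz.1 i).2.1, (hz.2.1 i).1.1, (hz.2.1 i).1.2, (hz.2.1 i).2⟩,
      hz.2.2⟩
  refine sum_bij' (fun z _ i => ((q / z.1 i * z.2 i : ℕ) : ZMod q))
    (fun x _ => ⟨fun i => addOrderOf (x i), fun i => (x i).val / (q / addOrderOf (x i))⟩)
    ?_ ?_ ?_ ?_ ?_
  · intro z hz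
    obtain ⟨h2, h3⟩ := hmem z hz
    rw [mem_filter, mem_zeroSum]
    refine ⟨(exists_int_sum_div_iff z.1 z.2 fun i => (h2 i).1).mp h3, fun i => ?_⟩
    obtain ⟨h4, h5, h6, h7, h8⟩ := h2 i
    exact (addOrderOf_div_mul h4 h5 h7 h8).2.2
  · intro x hx
    rw [mem_filter, mem_zeroSum] at hx
    simp only [mem_sigma, apModuli, apNumerators, Fintype.mem_piFinset, mem_filter,
      Nat.mem_divisors, mem_Icc]
    refine ⟨fun i => ?_, fun i => ?_, ?_⟩
    · have h2 := addOrderOf_dvd_modulus (x i)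
      exact ⟨⟨h2, hq0⟩, (numerator_spec (hx.2 i)).1, (hr.coprime_dvd_right h2).symm⟩
    · obtain ⟨-, h3, h4, h5, -⟩ := numerator_spec (hx.2 i)
      exact ⟨⟨h3, h4⟩, h5⟩
    · rw [exists_int_sum_div_iff (q := q) _ _ fun i => addOrderOf_dvd_modulus (x i)]
      refine Eq.trans (sum_congr rfl fun i _ => ?_) hx.1
      rw [(numerator_spec (hx.2 i)).2.2.2.2, ZMod.natCast_zmod_val]
  · intro z hz
    obtain ⟨h2, -⟩ := hmem z hz
    obtain ⟨d, a⟩ := z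
    have h9 : ∀ i, addOrderOf ((q / d i * a i : ℕ) : ZMod q) = d i := fun i => by
      obtain ⟨h4, h5, h6, h7, h8⟩ := h2 i
      exact (addOrderOf_div_mul h4 h5 h7 h8).1
    have h10 : ∀ i, ((q / d i * a i : ℕ) : ZMod q).val / (q / d i) = a i := fun i => by
      obtain ⟨h4, h5, h6, h7, h8⟩ := h2 i
      rw [(addOrderOf_div_mul h4 h5 h7 h8).2.1]
      exact Nat.mul_div_cancel_left _
        (Nat.div_pos (Nat.le_of_dvd (Nat.pos_of_ne_zero hq0) h4) (by dsimp only at h5; omega))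
    simp only [h9, h10]
  · intro x hx
    rw [mem_filter] at hx
    funext i
    simp only
    rw [(numerator_spec (hx.2 i)).2.2.2.2, ZMod.natCast_zmod_val]
  · intro z hz
    obtain ⟨h2, -⟩ := hmem z hz
    rw [← prod_mul_distrib]
    refine prod_congr rfl fun i _ => ?_
    obtain ⟨h4, h5, h6, h7, h8⟩ := h2 i
    obtain ⟨h9, h10, h11⟩ := addOrderOf_div_mul h4 h5 h7 h8
    rw [apWeight, if_neg h11, h9, h10]
    congr 2
    have hd0 : (z.1 i : ℝ) ≠ 0 := by
      have : z.1 i ≠ 0 := by omega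
      exact_mod_cast this
    have hq0' : (q : ℝ) ≠ 0 := by exact_mod_cast hq0
    push_cast
    rw [Nat.cast_div h4 hd0]
    field_simp

end Weights

/-! ### The exponential sum over a progression. -/

section ExponentialSum

lemma norm_apExpSum_le (r : ℕ) {h : ℝ} (hh : 0 ≤ h) (c : ZMod r) (α : ℝ) :
    ‖apExpSum r h c α‖ ≤ h := by
  unfold apExpSum
  refine (norm_sum_le _ _).trans ?_
  have h1 : ∀ m : ℕ, ‖Complex.exp (2 * (Real.pi : ℂ) * Complex.I * ((m : ℂ) * (α : ℂ)))‖ = 1 := by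
    intro m
    rw [show 2 * (Real.pi : ℂ) * Complex.I * ((m : ℂ) * (α : ℂ)) =
      ((2 * Real.pi * (m * α) : ℝ) : ℂ) * Complex.I by push_cast; ring,
      Complex.norm_exp_ofReal_mul_I]
  simp only [h1, sum_const, nsmul_eq_mul, mul_one]
  refine le_trans ?_ (Nat.floor_le hh)
  have h2 := card_filter_le (Icc 1 ⌊h⌋₊) (fun m : ℕ => (m : ZMod r) = c)
  rw [Nat.card_Icc, Nat.add_sub_cancel] at h2
  exact_mod_cast h2

/-- A progression modulo `r` and its translate by `r` differ in at most one element on each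
side. -/
lemma norm_mul_apExpSum_le {r : ℕ} (hr : 1 ≤ r) (h : ℝ) (c : ZMod r) (α : ℝ) :
    ‖(Complex.exp (2 * (Real.pi : ℂ) * Complex.I * ((r : ℂ) * (α : ℂ))) - 1) *
      apExpSum r h c α‖ ≤ 2 := by
  classical
  set e : ℕ → ℂ := fun m => Complex.exp (2 * (Real.pi : ℂ) * Complex.I * ((m : ℂ) * (α : ℂ)))
    with he
  have h1 : ∀ m : ℕ, ‖e m‖ = 1 := by
    intro m
    simp only [he]
    rw [show 2 * (Real.pi : ℂ) * Complex.I * ((m : ℂ) * (α : ℂ)) =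
      ((2 * Real.pi * (m * α) : ℝ) : ℂ) * Complex.I by push_cast; ring,
      Complex.norm_exp_ofReal_mul_I]
  set S := (Icc 1 ⌊h⌋₊).filter (fun m : ℕ => (m : ZMod r) = c) with hS
  set S' := S.image (fun m => m + r) with hS'
  have h2 : (e r - 1) * ∑ m ∈ S, e m = ∑ m ∈ S' \ S, e m - ∑ m ∈ S \ S', e m := by
    rw [sum_sdiff_sub_sum_sdiff, hS', sum_image (fun a _ b _ hab => by simpa using hab), sub_mul,
      one_mul, mul_sum]
    congr 1
    refine sum_congr rfl fun m _ => ?_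
    simp only [he]
    rw [← Complex.exp_add]
    congr 1
    push_cast
    ring
  have hcong : ∀ a b : ℕ, (a : ZMod r) = c → (b : ZMod r) = c → a ≤ b → b < a + r → a = b := by
    intro a b ha hb hab hba
    have h3 : (a : ZMod r) = b := ha.trans hb.symm
    rw [ZMod.natCast_eq_natCast_iff] at h3
    have h4 := (Nat.modEq_iff_dvd' hab).mp h3
    rcases Nat.eq_zero_or_pos (b - a) with h5 | h5
    · omega
    · have := Nat.le_of_dvd h5 h4
      omega
  have hcard1 : #(S' \ S) ≤ 1 := by
    have hmem : ∀ a ∈ S' \ S, ⌊h⌋₊ < a ∧ a ≤ ⌊h⌋₊ + r ∧ (a : ZMod r) = c := by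
      intro a ha
      rw [mem_sdiff, hS', mem_image] at ha
      obtain ⟨⟨m, hm, rfl⟩, hn⟩ := ha
      rw [hS, mem_filter, mem_Icc] at hm hn
      have h3 : ((m + r : ℕ) : ZMod r) = c := by push_cast; simp [hm.2]
      refine ⟨?_, by omega, h3⟩
      by_contra h4
      exact hn ⟨⟨by omega, by omega⟩, h3⟩
    refine card_le_one.mpr fun a ha b hb => ?_
    obtain ⟨h3, h4, h5⟩ := hmem a ha
    obtain ⟨h6, h7, h8⟩ := hmem b hb
    rcases le_total a b with hab | hab
    · exact hcong a b h5 h8 hab (by omega)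
    · exact (hcong b a h8 h5 hab (by omega)).symm
  have hcard2 : #(S \ S') ≤ 1 := by
    have hmem : ∀ a ∈ S \ S', 1 ≤ a ∧ a ≤ r ∧ (a : ZMod r) = c := by
      intro a ha
      rw [mem_sdiff] at ha
      obtain ⟨hm, hn⟩ := ha
      have hm' := hm
      rw [hS, mem_filter, mem_Icc] at hm
      refine ⟨hm.1.1, ?_, hm.2⟩
      by_contra h4
      apply hn
      rw [hS', mem_image]
      refine ⟨a - r, ?_, by omega⟩
      rw [hS, mem_filter, mem_Icc]
      refine ⟨⟨by omega, by omega⟩, ?_⟩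
      rw [Nat.cast_sub (by omega), hm.2]
      simp
    refine card_le_one.mpr fun a ha b hb => ?_
    obtain ⟨h3, h4, h5⟩ := hmem a ha
    obtain ⟨h6, h7, h8⟩ := hmem b hb
    rcases le_total a b with hab | hab
    · exact hcong a b h5 h8 hab (by omega)
    · exact (hcong b a h8 h5 hab (by omega)).symm
  have hle : ∀ U : Finset ℕ, #U ≤ 1 → ‖∑ m ∈ U, e m‖ ≤ 1 := by
    intro U hU
    refine (norm_sum_le _ _).trans ?_
    simp only [h1, sum_const, nsmul_eq_mul, mul_one]
    exact_mod_cast hU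
  change ‖(e r - 1) * ∑ m ∈ S, e m‖ ≤ 2
  rw [h2]
  refine (norm_sub_le _ _).trans ?_
  linarith [hle _ hcard1, hle _ hcard2]

variable {q : ℕ} [NeZero q]

/-- The product with `e(r α) - 1` has norm at most two, and `|e(θ) - 1| = 2 |sin π θ| ≥ 4 |θ|` for
`|θ| ≤ 1 / 2`. The quotient is the `1 / (2 ‖r α‖)` in `peak`. -/
lemma norm_apExpSum_le_peak {r : ℕ} (hr : 1 ≤ r) {h : ℝ} (hh : 0 ≤ h) (c : ZMod r) {x : ZMod q}
    (hx : (r : ZMod q) * x ≠ 0) :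
    ‖apExpSum r h c ((x.val : ℝ) / q)‖ ≤ peak h ((r : ZMod q) * x) := by
  refine le_min (norm_apExpSum_le r hh c _) ?_
  have hq0 : (q : ℝ) ≠ 0 := by exact_mod_cast NeZero.ne q
  have hd := fracDist_pos hx
  set v : ℤ := ((r : ZMod q) * x).valMinAbs with hv
  have h1 : ∃ n : ℤ, (r : ℤ) * x.val = v + q * n := by
    have h2 : (((r : ℤ) * x.val - v : ℤ) : ZMod q) = 0 := by
      push_cast
      rw [ZMod.natCast_zmod_val, hv, ZMod.coe_valMinAbs, sub_self]
    rw [ZMod.intCast_zmod_eq_zero_iff_dvd] at h2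
    obtain ⟨n, hn⟩ := h2
    exact ⟨n, by linarith⟩
  obtain ⟨n, hn⟩ := h1
  set θ : ℝ := (v : ℝ) / q with hθ
  have hz : Complex.exp (2 * (Real.pi : ℂ) * Complex.I * ((r : ℂ) * (((x.val : ℝ) / q : ℝ) : ℂ))) =
      Complex.exp (Complex.I * ((2 * Real.pi * θ : ℝ) : ℂ)) := by
    rw [Complex.exp_eq_exp_iff_exists_int]
    refine ⟨n, ?_⟩
    have h3 : (r : ℂ) * x.val = v + q * n := by exact_mod_cast hn
    have hq0' : (q : ℂ) ≠ 0 := by exact_mod_cast NeZero.ne q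
    rw [hθ]
    push_cast
    field_simp
    linear_combination 1 * h3
  have hθabs : |θ| = fracDist ((r : ZMod q) * x) := by
    rw [hθ, abs_div, Nat.abs_cast]
    rfl
  have hnorm : 4 * fracDist ((r : ZMod q) * x) ≤ ‖Complex.exp (2 * (Real.pi : ℂ) * Complex.I *
      ((r : ℂ) * (((x.val : ℝ) / q : ℝ) : ℂ))) - 1‖ := by
    rw [hz, Complex.norm_exp_I_mul_ofReal_sub_one]
    have h4 : |Real.pi * θ| ≤ Real.pi / 2 := by
      rw [abs_mul, abs_of_pos Real.pi_pos, hθabs]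
      have := fracDist_le_half ((r : ZMod q) * x)
      nlinarith [Real.pi_pos]
    have h5 := Real.mul_abs_le_abs_sin h4
    rw [show 2 * Real.pi * θ / 2 = Real.pi * θ by ring, Real.norm_eq_abs, abs_mul,
      abs_of_pos (by norm_num : (0 : ℝ) < 2)]
    rw [abs_mul, abs_of_pos Real.pi_pos, hθabs] at h5
    have h6 : 2 / Real.pi * (Real.pi * fracDist ((r : ZMod q) * x)) =
        2 * fracDist ((r : ZMod q) * x) := by
      field_simp
    linarith
  have h7 := norm_mul_apExpSum_le hr h c ((x.val : ℝ) / q)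
  rw [norm_mul] at h7
  rw [le_div_iff₀ (by positivity)]
  have h8 := mul_le_mul_of_nonneg_right hnorm (norm_nonneg (apExpSum r h c ((x.val : ℝ) / q)))
  linarith

/-- Multiplication by the unit `r` preserves orders, so the totient in the weight is also that of `r
* x`. -/
lemma norm_apWeight_le {r : ℕ} (hr : 1 ≤ r) (hrq : r.Coprime q) {h : ℝ} (hh : 0 ≤ h)
    (c : ZMod r) (x : ZMod q) : ‖apWeight h c x‖ ≤ majorant h ((r : ZMod q) * x) := by
  unfold apWeight
  split_ifs with hx
  · rw [norm_zero]; exact majorant_nonneg hh _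
  have hu : IsUnit (r : ZMod q) := (ZMod.isUnit_iff_coprime r q).mpr hrq
  have hrx : (r : ZMod q) * x ≠ 0 := by rwa [ne_eq, hu.mul_right_eq_zero]
  have hord : addOrderOf ((r : ZMod q) * x) = addOrderOf x := by
    apply Nat.dvd_antisymm <;> rw [addOrderOf_dvd_iff_nsmul_eq_zero]
    · rw [← mul_smul_comm, addOrderOf_nsmul_eq_zero, mul_zero]
    · rw [← hu.mul_right_eq_zero, mul_smul_comm, addOrderOf_nsmul_eq_zero]
  rw [majorant, if_neg hrx, hord, norm_mul, norm_div, Complex.norm_natCast, div_mul_eq_mul_div]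
  refine div_le_div_of_nonneg_right ?_ (Nat.cast_nonneg _)
  have h1 : ‖((ArithmeticFunction.moebius (addOrderOf x) : ℤ) : ℂ)‖ ≤ 1 := by
    rw [Complex.norm_intCast]
    exact_mod_cast ArithmeticFunction.abs_moebius_le_one
  refine (mul_le_mul h1 (norm_apExpSum_le_peak hr hh c hrx) (norm_nonneg _) zero_le_one).trans_eq ?_
  rw [one_mul]

end ExponentialSum

/-! ### Perfect matchings and the main term. -/

section Matchings

variable {k : ℕ} {σ σ' : Finset (Fin k × Fin k)}

lemma mem_perfectMatchings : σ ∈ perfectMatchings k ↔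
    (∀ p ∈ σ, p.1 < p.2) ∧ ∀ i, ∃! j, (i, j) ∈ σ ∨ (j, i) ∈ σ := by
  simp [perfectMatchings]

lemma exists_partner (hσ : σ ∈ perfectMatchings k) :
    ∃ τ : Fin k → Fin k, (∀ i j, ((i, j) ∈ σ ∨ (j, i) ∈ σ) ↔ τ i = j) ∧ (∀ i, τ (τ i) = i) ∧
      ∀ i, τ i ≠ i := by
  rw [mem_perfectMatchings] at hσ
  choose τ h1 h2 using hσ.2
  have h3 : ∀ i j, ((i, j) ∈ σ ∨ (j, i) ∈ σ) ↔ τ i = j :=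
    fun i j => ⟨fun h => (h2 i j h).symm, fun h => h ▸ h1 i⟩
  refine ⟨τ, h3, fun i => (h3 _ _).mp ((h3 i _).mpr rfl).symm, fun i hi => ?_⟩
  have h4 : (i, i) ∈ σ := ((h3 i i).mpr hi).elim id id
  exact lt_irrefl _ (hσ.1 _ h4)

/-- Both entries of `x` at each pair of the matching `σ` cancel. -/
def IsCompatible {K : Type*} [AddCommGroup K] (σ : Finset (Fin k × Fin k)) (x : Fin k → K) : Prop :=
  ∀ p ∈ σ, x p.1 + x p.2 = 0

section Compatible

variable {K : Type*} [AddCommGroup K] {x : Fin k → K}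

lemma IsCompatible.add_partner (hx : IsCompatible σ x) {i j : Fin k}
    (h : (i, j) ∈ σ ∨ (j, i) ∈ σ) : x i + x j = 0 := by
  obtain h | h := h
  · exact hx _ h
  · rw [add_comm]; exact hx _ h

/-- Pairs are stored with the smaller element first, so distinct matchings have distinct partner
maps. An index with two different partners has both entries there equal to minus its own. -/
lemma exists_repeated_of_ne (hσ : σ ∈ perfectMatchings k) (hσ' : σ' ∈ perfectMatchings k)
    (hne : σ ≠ σ') (hx : IsCompatible σ x) (hx' : IsCompatible σ' x) :
    ∃ i j l : Fin k, (i ≠ j ∧ l ≠ i ∧ l ≠ j) ∧ x i + x j = 0 ∧ x j = x l := by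
  obtain ⟨τ, h1, -, h3⟩ := exists_partner hσ
  obtain ⟨τ', h1', -, h3'⟩ := exists_partner hσ'
  by_cases hτ : τ = τ'
  · subst hτ
    have key : ∀ {ρ ρ' : Finset (Fin k × Fin k)}, ρ ∈ perfectMatchings k →
        ρ' ∈ perfectMatchings k → (∀ i j, ((i, j) ∈ ρ ∨ (j, i) ∈ ρ) ↔ τ i = j) →
        (∀ i j, ((i, j) ∈ ρ' ∨ (j, i) ∈ ρ') ↔ τ i = j) → ρ ⊆ ρ' := by
      rintro ρ ρ' hρ hρ' h4 h5 ⟨i, j⟩ hp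
      obtain h | h := (h5 i j).mpr ((h4 i j).mp (Or.inl hp))
      · exact h
      · exact absurd ((mem_perfectMatchings.mp hρ).1 _ hp)
          ((mem_perfectMatchings.mp hρ').1 _ h).le.not_gt
    exact absurd ((key hσ hσ' h1 h1').antisymm (key hσ' hσ h1' h1)) hne
  · obtain ⟨i, hi⟩ := Function.ne_iff.mp hτ
    have h4 := hx.add_partner ((h1 i _).mpr rfl)
    have h5 := hx'.add_partner ((h1' i _).mpr rfl)
    exact ⟨i, τ i, τ' i, ⟨(h3 i).symm, h3' i, hi.symm⟩, h4, add_left_cancel (h4.trans h5.symm)⟩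

variable [Fintype K]

-- One free value for each pair, placed with a minus sign at the first element, parametrizes the
-- compatible tuples, and their sum vanishes automatically.
open Classical in
lemma prod_matching_eq_sum_zeroSum {R : Type*} [CommSemiring R] (hσ : σ ∈ perfectMatchings k)
    (f : Fin k → K → R) :
    ∏ p ∈ σ, ∑ v, f p.1 (-v) * f p.2 v =
      ∑ x ∈ zeroSum K k, if IsCompatible σ x then ∏ i, f i (x i) else 0 := by
  obtain ⟨τ, h1, h2, h3⟩ := exists_partner hσ
  have hlt := (mem_perfectMatchings.mp hσ).1
  have hp1 : ∀ p ∈ σ, τ p.1 = p.2 := fun p hp => (h1 _ _).mp (Or.inl hp)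
  have hp2 : ∀ p ∈ σ, τ p.2 = p.1 := fun p hp => (h1 _ _).mp (Or.inr hp)
  let e : σ ⊕ σ → Fin k := Sum.elim (fun p => p.1.1) (fun p => p.1.2)
  have he : Function.Bijective e := by
    constructor
    · have hmix : ∀ p ∈ σ, ∀ p' ∈ σ, p.1 ≠ p'.2 := by
        intro p hp p' hp' h
        have h4 : p.2 = p'.1 := by rw [← hp1 p hp, ← hp2 p' hp', h]
        have h5 := hlt p hp
        have h6 := hlt p' hp'
        rw [h, h4] at h5
        exact lt_asymm h5 h6
      rintro (⟨p, hp⟩ | ⟨p, hp⟩) (⟨p', hp'⟩ | ⟨p', hp'⟩) h <;> simp only [e, Sum.elim_inl, Sum.elim_inr] at h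
      · congr 2
        exact Prod.ext h (by rw [← hp1 p hp, ← hp1 p' hp', h])
      · exact absurd h (hmix p hp p' hp')
      · exact absurd h.symm (hmix p' hp' p hp)
      · congr 2
        exact Prod.ext (by rw [← hp2 p hp, ← hp2 p' hp', h]) h
    · intro i
      obtain h | h := (h1 i (τ i)).mpr rfl
      · exact ⟨Sum.inl ⟨_, h⟩, rfl⟩
      · exact ⟨Sum.inr ⟨_, h⟩, rfl⟩
  let E := Equiv.ofBijective e he
  have hE1 : ∀ p : σ, E.symm p.1.1 = Sum.inl p := fun p => E.symm_apply_apply (Sum.inl p)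
  have hE2 : ∀ p : σ, E.symm p.1.2 = Sum.inr p := fun p => E.symm_apply_apply (Sum.inr p)
  rw [← sum_filter, ← prod_coe_sort, prod_univ_sum, Fintype.piFinset_univ]
  refine sum_bij' (fun V _ i => Sum.elim (fun p => -V p) V (E.symm i)) (fun x _ p => x p.1.2)
    ?_ ?_ ?_ ?_ ?_
  · intro V _
    rw [mem_filter, mem_zeroSum, Equiv.sum_comp E.symm (Sum.elim (fun p => -V p) V),
      Fintype.sum_sum_type]
    refine ⟨by simp, fun p hp => ?_⟩
    have h4 := hE1 ⟨p, hp⟩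
    have h5 := hE2 ⟨p, hp⟩
    simp only at h4 h5
    simp only [h4, h5, Sum.elim_inl, Sum.elim_inr, neg_add_cancel]
  · simp
  · intro V _
    funext p
    simp only [hE2, Sum.elim_inr]
  · intro x hx
    funext i
    obtain ⟨s, rfl⟩ := E.surjective i
    simp only [Equiv.symm_apply_apply]
    obtain p | p := s
    · exact (eq_neg_of_add_eq_zero_left ((mem_filter.mp hx).2 p.1 p.2)).symm
    · rfl
  · intro V _
    rw [← Equiv.prod_comp E, Fintype.prod_sum_type, ← prod_mul_distrib]
    refine prod_congr rfl fun p _ => ?_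
    simp only [Equiv.symm_apply_apply, Sum.elim_inl, Sum.elim_inr]
    rfl

end Compatible

variable {q : ℕ} [NeZero q]

lemma IsCompatible.isPairable {x : Fin k → ZMod q} (hσ : σ ∈ perfectMatchings k)
    (hx : IsCompatible σ x) : IsPairable x := by
  obtain ⟨τ, h1, h2, h3⟩ := exists_partner hσ
  exact ⟨τ, fun i => ⟨h2 i, h3 i, hx.add_partner ((h1 i _).mpr rfl)⟩⟩

lemma IsPairable.exists_isCompatible {x : Fin k → ZMod q} (hx : IsPairable x) :
    ∃ σ ∈ perfectMatchings k, IsCompatible σ x := by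
  classical
  obtain ⟨τ, hτ⟩ := hx
  refine ⟨univ.filter fun p => p.1 < p.2 ∧ τ p.1 = p.2, ?_, ?_⟩
  · rw [mem_perfectMatchings]
    refine ⟨fun p hp => (mem_filter.mp hp).2.1, fun i => ⟨τ i, ?_, ?_⟩⟩
    · simp only [mem_filter, mem_univ, true_and, (hτ i).1, and_true]
      exact lt_or_gt_of_ne (hτ i).2.1.symm
    · rintro j (h | h)
      · exact (mem_filter.mp h).2.2.symm
      · have h1 : τ j = i := (mem_filter.mp h).2.2
        rw [← h1]
        exact (hτ j).1.symm
  · intro p hp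
    rw [← (mem_filter.mp hp).2.2]
    exact (hτ p.1).2.2

lemma IsPairable.smul_iff {u : ZMod q} (hu : IsUnit u) {x : Fin k → ZMod q} :
    IsPairable (fun i => u * x i) ↔ IsPairable x := by
  unfold IsPairable
  simp_rw [← mul_add, hu.mul_right_eq_zero]

lemma sum_zeroSum_mul_unit {M : Type*} [AddCommMonoid M] {u : ZMod q} (hu : IsUnit u)
    (Φ : (Fin k → ZMod q) → M) :
    ∑ x ∈ zeroSum (ZMod q) k, Φ (fun i => u * x i) = ∑ x ∈ zeroSum (ZMod q) k, Φ x := by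
  obtain ⟨u, rfl⟩ := hu
  refine sum_nbij' (fun x i => u * x i) (fun x i => (u⁻¹ : (ZMod q)ˣ) * x i) ?_ ?_ ?_ ?_ ?_
  · intro x hx
    rw [mem_zeroSum] at *
    rw [← mul_sum, hx, mul_zero]
  · intro x hx
    rw [mem_zeroSum] at *
    rw [← mul_sum, hx, mul_zero]
  · intro x _; funext i; simp
  · intro x _; funext i; simp
  · intro x _; rfl

lemma apV_two {r : ℕ} (hr : r.Coprime q) (h : ℝ) (c d : ZMod r) :
    apV 2 q h r ![c, d] = ∑ v : ZMod q, apWeight h c (-v) * apWeight h d v := by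
  rw [apV_eq_sum_zeroSum hr, sum_zeroSum_succ, sum_univ_cons]
  simp only [univ_unique, sum_singleton, Fin.prod_univ_succ, Fin.cons_zero, Fin.cons_succ]
  simp

-- A tuple compatible with `N` matchings enters with coefficient `1 - N`: none means unpaired, one
-- cancels exactly, and two or more force a repeated triple. The factor `r` from the majorants is
-- removed at the end by reindexing the zero-sum tuples.
open Classical in
lemma norm_apV_sub_le {r : ℕ} (hr : 1 ≤ r) (hrq : r.Coprime q) {h : ℝ} (hh : 0 ≤ h)
    (c : Fin k → ZMod r) :
    ‖apV k q h r c - ∑ σ ∈ perfectMatchings k, ∏ p ∈ σ, apV 2 q h r ![c p.1, c p.2]‖ ≤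
      unpairedSum q h k + #(perfectMatchings k) *
        ∑ t : Fin k × Fin k × Fin k with t.1 ≠ t.2.1 ∧ t.2.2 ≠ t.1 ∧ t.2.2 ≠ t.2.1,
          ∑ x ∈ zeroSum (ZMod q) k, if x t.1 + x t.2.1 = 0 ∧ x t.2.1 = x t.2.2 then
            ∏ i, majorant h (x i) else 0 := by
  set T := (univ.filter fun t : Fin k × Fin k × Fin k =>
    t.1 ≠ t.2.1 ∧ t.2.2 ≠ t.1 ∧ t.2.2 ≠ t.2.1) with hT
  set K : ℝ := (#(perfectMatchings k) : ℝ) with hK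
  have hu : IsUnit (r : ZMod q) := (ZMod.isUnit_iff_coprime r q).mpr hrq
  have hP : ∀ x : Fin k → ZMod q, 0 ≤ ∏ i, majorant h (x i) :=
    fun x => prod_nonneg fun i _ => majorant_nonneg hh _
  have h1 : apV k q h r c - ∑ σ ∈ perfectMatchings k, ∏ p ∈ σ, apV 2 q h r ![c p.1, c p.2] =
      ∑ x ∈ zeroSum (ZMod q) k, (1 - #{σ ∈ perfectMatchings k | IsCompatible σ x} : ℂ) *
        ∏ i, apWeight h (c i) (x i) := by
    simp_rw [apV_two hrq]
    rw [sum_congr rfl fun σ hσ => prod_matching_eq_sum_zeroSum hσ fun i => apWeight (q := q) h (c i),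
      sum_comm, apV_eq_sum_zeroSum hrq, ← sum_sub_distrib]
    refine sum_congr rfl fun x _ => ?_
    rw [← sum_filter, sum_const, nsmul_eq_mul, sub_mul, one_mul]
  set F : (Fin k → ZMod q) → ℝ := fun y => (if IsPairable y then 0 else ∏ i, majorant h (y i)) +
    K * ∑ t ∈ T, if y t.1 + y t.2.1 = 0 ∧ y t.2.1 = y t.2.2 then ∏ i, majorant h (y i) else 0
    with hF
  have h2 : ∀ x : Fin k → ZMod q, ‖(1 - #{σ ∈ perfectMatchings k | IsCompatible σ x} : ℂ) *
      ∏ i, apWeight h (c i) (x i)‖ ≤ F fun i => (r : ZMod q) * x i := by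
    intro x
    set P : ℝ := ∏ i, majorant h ((r : ZMod q) * x i) with hPd
    have hP0 : 0 ≤ P := hP _
    have h3 : ‖∏ i, apWeight h (c i) (x i)‖ ≤ P := by
      rw [norm_prod]
      exact prod_le_prod (fun i _ => norm_nonneg _) fun i _ => norm_apWeight_le hr hrq hh _ _
    have h4 : ∀ t : Fin k × Fin k × Fin k, 0 ≤ if (r : ZMod q) * x t.1 + r * x t.2.1 = 0 ∧
        (r : ZMod q) * x t.2.1 = r * x t.2.2 then P else 0 := by
      intro t
      split_ifs
      · exact hP0
      · exact le_rfl
    set N := #{σ ∈ perfectMatchings k | IsCompatible σ x} with hN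
    simp only [hF]
    rw [IsPairable.smul_iff hu, norm_mul]
    obtain hN0 | hN1 | hN2 : N = 0 ∨ N = 1 ∨ 1 < N := by omega
    · have h5 : ¬IsPairable x := by
        intro hx
        obtain ⟨σ, hσ, hσx⟩ := hx.exists_isCompatible
        have : 0 < N := card_pos.mpr ⟨σ, by rw [mem_filter]; exact ⟨hσ, hσx⟩⟩
        omega
      rw [if_neg h5, hN0]
      simp only [Nat.cast_zero, sub_zero, norm_one, one_mul]
      exact h3.trans (le_add_of_nonneg_right (mul_nonneg (Nat.cast_nonneg _)
        (sum_nonneg fun t _ => h4 t)))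
    · rw [hN1]
      simp only [Nat.cast_one, sub_self, norm_zero, zero_mul]
      refine add_nonneg ?_ (mul_nonneg (Nat.cast_nonneg _) (sum_nonneg fun t _ => h4 t))
      split_ifs
      · exact le_rfl
      · exact hP0
    · obtain ⟨σ, hσ, σ', hσ', hne⟩ := one_lt_card.mp hN2
      rw [mem_filter] at hσ hσ'
      rw [if_pos (hσ.2.isPairable hσ.1), zero_add]
      have h5 : ‖(1 - N : ℂ)‖ ≤ K := by
        obtain ⟨m, hm⟩ : ∃ m, N = m + 1 := ⟨N - 1, by omega⟩
        have h6 : N ≤ #(perfectMatchings k) := card_filter_le _ _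
        rw [hm, Nat.cast_succ, sub_add_cancel_right, norm_neg, Complex.norm_natCast, hK]
        exact_mod_cast (by omega : m ≤ #(perfectMatchings k))
      refine mul_le_mul h5 (h3.trans ?_) (norm_nonneg _) (Nat.cast_nonneg _)
      obtain ⟨i, j, l, h6, h7, h8⟩ := exists_repeated_of_ne hσ.1 hσ'.1 hne hσ.2 hσ'.2
      refine le_trans ?_ (single_le_sum (fun t _ => h4 t)
        (mem_filter.mpr ⟨mem_univ (i, j, l), h6⟩))
      rw [if_pos]
      rw [← mul_add, h7, h8]
      simp
  rw [h1]
  refine (norm_sum_le _ _).trans ((sum_le_sum fun x _ => h2 x).trans_eq ?_)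
  rw [sum_zeroSum_mul_unit hu F]
  simp only [hF]
  rw [sum_add_distrib, ← mul_sum, sum_comm, unpairedSum]

end Matchings

/-! ### Assembling the exponents. -/

lemma totientRatio_pow_le_rpow {q : ℕ} (hq : q ≠ 0) {m : ℕ} {s : ℝ} (hm : (m : ℝ) ≤ s) :
    totientRatio q ^ m ≤ totientRatio q ^ s := by
  rw [← Real.rpow_natCast]
  exact Real.rpow_le_rpow_of_exponent_le (one_le_totientRatio hq) hm

-- The repeated triple saves a whole factor `h`, more than the `h ^ (1 / (7 k))` required.
open Classical in
lemma sum_zeroSum_triple_le {q : ℕ} [NeZero q] (hq : Squarefree q) {h : ℝ} (hh : 1 ≤ h) {k : ℕ}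
    {i j l : Fin k} (hij : i ≠ j) (hli : l ≠ i) (hlj : l ≠ j) :
    ∑ x ∈ zeroSum (ZMod q) k, (if x i + x j = 0 ∧ x j = x l then ∏ i, majorant h (x i) else 0) ≤
      2 ^ k * (h ^ ((k : ℝ) / 2 - 1 / (7 * (k : ℝ))) *
        totientRatio q ^ ((2 : ℝ) ^ k + (k : ℝ) / 2)) := by
  obtain _ | _ | n := k
  · exact i.elim0
  · exact absurd (Subsingleton.elim (α := Fin 1) i j) hij
  refine (sum_zeroSum_repeated_le hq hh hij hli hlj).trans ?_
  rw [mul_assoc]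
  have h0 : (0 : ℝ) ≤ h := by linarith
  have h1 : √h ^ n ≤ h ^ (((n + 2 : ℕ) : ℝ) / 2 - 1 / (7 * ((n + 2 : ℕ) : ℝ))) := by
    rw [Real.sqrt_eq_rpow, ← Real.rpow_natCast, ← Real.rpow_mul h0]
    refine Real.rpow_le_rpow_of_exponent_le hh ?_
    have h2 : 1 / (7 * ((n + 2 : ℕ) : ℝ)) ≤ 1 := by
      rw [div_le_one (by positivity)]
      push_cast
      linarith [(Nat.cast_nonneg n : (0 : ℝ) ≤ n)]
    have h3 : ((n + 2 : ℕ) : ℝ) = n + 2 := by push_cast; rfl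
    rw [h3] at h2 ⊢
    linarith
  have h2 : totientRatio q ^ (2 ^ n + 1) ≤
      totientRatio q ^ ((2 : ℝ) ^ (n + 2) + ((n + 2 : ℕ) : ℝ) / 2) := by
    refine totientRatio_pow_le_rpow (NeZero.ne q) ?_
    push_cast
    have h3 : (1 : ℝ) ≤ 2 ^ n := one_le_pow₀ (by norm_num)
    rw [pow_add]
    linarith [(Nat.cast_nonneg n : (0 : ℝ) ≤ n)]
  have h4 := totientRatio_nonneg q
  have h5 : (2 : ℝ) ^ n ≤ 2 ^ (n + 1 + 1) := pow_le_pow_right₀ (by norm_num) (by omega)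
  exact mul_le_mul h5 (mul_le_mul h1 h2 (by positivity) (by positivity)) (by positivity)
    (by positivity)

theorem theorem1 (r : ℕ) (hr : 1 ≤ r) (k : ℕ) (hk : 1 ≤ k) :
    ∃ C : ℝ, ∀ (c : Fin k → ZMod r) (q : ℕ) (h : ℝ),
      1 ≤ q → Squarefree q → Nat.Coprime r q → 3 ≤ h →
        ‖apV k q h r c -
            ∑ σ ∈ perfectMatchings k, ∏ p ∈ σ, apV 2 q h r ![c p.1, c p.2]‖ ≤
          C * (h ^ ((k : ℝ) / 2 - 1 / (7 * (k : ℝ))) *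
            ((q : ℝ) / (Nat.totient q : ℝ)) ^ ((2 : ℝ) ^ k + (k : ℝ) / 2)) := by
  obtain ⟨C, hC, hb⟩ := exists_unpairedSum_le k
  -- `C` serves the unpaired tuples. In the other term the number of matchings bounds `|1 - N|`, and
  -- the cardinality counts the possible index triples.
  refine ⟨C + #(perfectMatchings k) *
    (#(univ : Finset (Fin k × Fin k × Fin k)) * 2 ^ k), fun c q h hq1 hq hrq hh => ?_⟩
  have hq0 : q ≠ 0 := by omega
  have : NeZero q := ⟨hq0⟩
  have hh1 : 1 ≤ h := by linarith
  have hh0 : 0 < h := by linarith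
  change _ ≤ _ * (_ * totientRatio q ^ _)
  have h1 := totientRatio_nonneg q
  refine (norm_apV_sub_le hr hrq hh0.le c).trans ?_
  rw [add_mul, mul_assoc (#(perfectMatchings k) : ℝ)]
  refine add_le_add ((hb q h hq hh1).trans (mul_le_mul_of_nonneg_left ?_ hC))
    (mul_le_mul_of_nonneg_left ?_ (Nat.cast_nonneg _))
  · have h2 : √h ^ k / h ^ (1 / (7 * (k : ℝ))) = h ^ ((k : ℝ) / 2 - 1 / (7 * (k : ℝ))) := by
      rw [Real.rpow_sub hh0, Real.sqrt_eq_rpow, ← Real.rpow_natCast, ← Real.rpow_mul hh0.le]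
      congr 2
      ring
    rw [h2]
    refine mul_le_mul_of_nonneg_left (totientRatio_pow_le_rpow hq0 ?_) (by positivity)
    rw [Nat.cast_sub Nat.one_le_two_pow]
    push_cast
    linarith [(Nat.cast_nonneg k : (0 : ℝ) ≤ k)]
  · rw [mul_assoc]
    set D : ℝ := 2 ^ k * (h ^ ((k : ℝ) / 2 - 1 / (7 * (k : ℝ))) *
      totientRatio q ^ ((2 : ℝ) ^ k + (k : ℝ) / 2)) with hD
    have h2 : 0 ≤ D := by positivity
    refine (sum_le_card_nsmul _ _ D fun t ht => ?_).trans ?_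
    · obtain ⟨h3, h4, h5⟩ := (mem_filter.mp ht).2
      exact sum_zeroSum_triple_le hq hh1 h3 h4 h5
    · rw [nsmul_eq_mul]
      exact mul_le_mul_of_nonneg_right (by exact_mod_cast card_filter_le _ _) h2
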